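/- **Setting.** Let $N\ge 2$ be an integer, $\mathcal I_0=\{0,\dots,N-1\}$ and $\lambda>0$. Let $H\in C^2(\mathbb R^2)$ satisfy $H(x)\to\infty$ as $|x|\to\infty$. Assume that $H$ has exactly $N$ critical points $z_i$, $i\in\mathcal I_0$, that $H$ has a local minimum at $z_i$ for $i\ne 0$, and that $z_0=0$, $H(0)=0$. Assume also that for some constants $m\ge 0$, $n>0$, $A_1,A_2>0$ with $n<m+2$ and all $x$ in a neighborhood of $0$, $|H_{x_ix_j}(x)|\le A_1|x|^m$ ($i,j\in\{1,2\}$) and $|DH(x)|\ge A_2|x|^n$. Let $D_0=\{H>0\}$ and, for $i\neq0$, let $D_i$ be the connected component of $\{H<0\}$ containing $z_i$. Choose $h_0>0$ and $H(z_i)<h_i<0$ for $i\ne0$, and set $$\Omega_0=\{x\in D_0: H(x)<h_0\},\quad \Omega_i=\{x\in D_i: H(x)>h_i\}\ (i\neq 0),\quad \Omega=\{H=0\}\cup\bigcup_{i\in\mathcal I_0}\Omega_i,$$ $$c_i(h)=\{x\in\overline\Omega_i: H(x)=h\},\quad \partial_i\Omega=c_i(h_i),\quad J_0=(0,h_0),\quad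 J_i=(h_i,0)\ (i\ne0),\quad b=(H_{x_2},-H_{x_1}).$$ A modulus is a continuous nondecreasing function $[0,\infty)\to[0,\infty)$ vanishing at $0$. Let $G\in C(\overline\Omega\times\mathbb R^2)$ and $g\in C(\partial\Omega)$. Assume that there are moduli $m_1,m_2$ and constants $\nu,M>0$ and $\gamma\in(0,\min_i|h_i|)$ such that, for all $x,y\in\overline\Omega$ and $p,q\in\mathbb R^2$, $$|G(x,p)-G(y,p)|\le m_1(|x-y|(1+|p|)),\quad |G(x,p)-G(x,q)|\le m_2(|p-q|),\quad G(x,p)\ge\nu|p|-M,$$ and that, whenever $|H(x)|<\gamma$ and $x\notin c_0(0)$, the function $\mathbb R\ni q\mapsto G(x,qDH(x))$ is convex. **Viscosity solutions.** For a locally bounded function $u$ on a set $S$, let $u^*,u_*$ be its upper and lower semicontinuous envelopes on $S$. For $\varepsilon>0$ put $F_\varepsilon(x,r,p)=\lambda r-\varepsilon^{-1}b(x)\cdot p+G(x,p)$. Let $\mathcal S_\varepsilon$ be the set of viscosity solutions of $F_\varepsilon(x,u,Du)=0$ in $\Omega$, $u=g$ on $\partial\Omega$, with the boundary condition in the viscosity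 sense. That is, $\mathcal S_\varepsilon$ is the set of all bounded $u:\overline\Omega\to\mathbb R$ such that: * if $\phi\in C^1(\Omega)$ and $u^*-\phi$ (resp. $u_*-\phi$) has a local maximum (resp. minimum) at $x\in\Omega$, then $F_\varepsilon(x,u^*(x),D\phi(x))\le0$ (resp. $F_\varepsilon(x,u_*(x),D\phi(x))\ge0$); * if $\phi\in C^1(\overline\Omega)$ and $u^*-\phi$ (resp. $u_*-\phi$) has a local maximum (resp. minimum) relative to $\overline\Omega$ at $x\in\partial\Omega$, then $\min\{F_\varepsilon(x,u^*(x),D\phi(x)),\,u^*(x)-g(x)\}\le0$ (resp. $\max\{F_\varepsilon(x,u_*(x),D\phi(x)),\,u_*(x)-g(x)\}\ge0$). **Relaxed limits.** For $x\in\overline\Omega$ let $$v^+(x)=\lim_{r\to0+}\sup\{u(y): u\in\mathcal S_\varepsilon,\ y\in B_r(x)\cap\overline\Omega,\ \varepsilon\in(0,r)\},$$ $$v^-(x)=\lim_{r\to0+}\inf\{u(y): u\in\mathcal S_\varepsilon,\ y\in B_r(x)\cap\overline\Omega,\ \varepsilon\in(0,r)\}.$$ For $i\in\mathcal I_0$ put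 $v_i^+(h)=\max_{c_i(h)}v^+$ for $h\in\overline J_i\setminus\{h_i\}$, $v_i^+(h_i)=\limsup_{J_i\ni h\to h_i}v_i^+(h)$, and $v_i^-(h)=\min_{c_i(h)}v^-$ for $h\in\overline J_i$. **Effective problem.** For $h\in\overline J_i\setminus\{0\}$ and $q\in\mathbb R$ let, with $dl$ the arc length element, $$\overline G_i(h,q)=\frac1{T_i(h)}\int_{c_i(h)}\frac{G(x,qDH(x))}{|DH(x)|}\,dl,\qquad T_i(h)=\int_{c_i(h)}\frac{dl}{|DH(x)|}.$$ The effective problem is $$(\mathrm{HJ}_i)\ \ \lambda u+\overline G_i(h,u')=0\ \text{ in }J_i,\qquad(\mathrm{BC}_i)\ \ u(h_i)=\min_{\partial_i\Omega}g .$$ A locally bounded $u:\overline J_i\setminus\{0\}\to\mathbb R$ is a viscosity subsolution (resp. supersolution) of $(\mathrm{HJ}_i)$ and $(\mathrm{BC}_i)$ if: * whenever $\phi\in C^1(J_i)$ and $u^*-\phi$ has a local maximum (resp. $u_*-\phi$ has a local minimum) at $h\in J_i$, then $\lambda u^*(h)+\overline G_i(h,\phi'(h))\le0$ (resp. $\lambda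 u_*(h)+\overline G_i(h,\phi'(h))\ge0$); * whenever $\phi\in C^1(\overline J_i\setminus\{0\})$ and $u^*-\phi$ has a local maximum (resp. $u_*-\phi$ has a local minimum) at $h_i$ relative to $\overline J_i\setminus\{0\}$, then $\min\{\lambda u^*(h_i)+\overline G_i(h_i,\phi'(h_i)),\,u^*(h_i)-\min_{\partial_i\Omega}g\}\le0$ (resp. $\max\{\lambda u_*(h_i)+\overline G_i(h_i,\phi'(h_i)),\,u_*(h_i)-\min_{\partial_i\Omega}g\}\ge0$). **Theorem.** For every $i\in\mathcal I_0$, the functions $v_i^+$ and $v_i^-$ are, respectively, a viscosity subsolution and a viscosity supersolution of $(\mathrm{HJ}_i)$ and $(\mathrm{BC}_i)$. In particular, $v_i^+(h_i)\le\min_{\partial_i\Omega}g$. -/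

import Mathlib

open Set Filter Topology MeasureTheory
open scoped NNReal Gradient

noncomputable section

namespace HamiltonianAveraging

/-- The Euclidean plane. -/
abbrev Plane : Type := EuclideanSpace ℝ (Fin 2)

/-- The partial derivative `∂f/∂x_j` (the coordinates are numbered `0` and `1`). -/
def partialDeriv (j : Fin 2) (f : Plane → ℝ) (x : Plane) : ℝ :=
  fderiv ℝ f x (EuclideanSpace.single j 1)

/-- The Hamiltonian vector field `b = (H_{x₂}, -H_{x₁})`. -/
def drift (H : Plane → ℝ) (x : Plane) : Plane :=
  !₂[partialDeriv 1 H x, -partialDeriv 0 H x]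

/-! ### The geometry -/

/-- `D₀ = {H > 0}`; for `i ≠ 0`, `D_i` is the connected component of `{H < 0}` containing `z_i`. -/
def basin {N : ℕ} [NeZero N] (H : Plane → ℝ) (z : Fin N → Plane) (i : Fin N) : Set Plane :=
  if i = 0 then {x | 0 < H x} else connectedComponentIn {x | H x < 0} (z i)

/-- `Ω₀ = {x ∈ D₀ | H x < h₀}` and `Ω_i = {x ∈ D_i | H x > h_i}` for `i ≠ 0`. -/
def edgeDomain {N : ℕ} [NeZero N] (H : Plane → ℝ) (z : Fin N → Plane) (h : Fin N → ℝ)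
    (i : Fin N) : Set Plane :=
  if i = 0 then {x ∈ basin H z i | H x < h i} else {x ∈ basin H z i | h i < H x}

/-- `Ω = {H = 0} ∪ ⋃ i, Ω_i`. -/
def domain {N : ℕ} [NeZero N] (H : Plane → ℝ) (z : Fin N → Plane) (h : Fin N → ℝ) : Set Plane :=
  {x | H x = 0} ∪ ⋃ i, edgeDomain H z h i

/-- The level curve `c_i(s) = {x ∈ closure Ω_i | H x = s}`. -/
def levelCurve {N : ℕ} [NeZero N] (H : Plane → ℝ) (z : Fin N → Plane) (h : Fin N → ℝ)
    (i : Fin N) (s : ℝ) : Set Plane :=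
  {x ∈ closure (edgeDomain H z h i) | H x = s}

/-- The boundary piece `∂_iΩ = {x ∈ closure Ω_i | H x = h_i}`. -/
def boundaryPart {N : ℕ} [NeZero N] (H : Plane → ℝ) (z : Fin N → Plane) (h : Fin N → ℝ)
    (i : Fin N) : Set Plane :=
  {x ∈ closure (edgeDomain H z h i) | H x = h i}

/-- The open edges `J₀ = (0, h₀)` and `J_i = (h_i, 0)` for `i ≠ 0`. -/
def edge {N : ℕ} [NeZero N] (h : Fin N → ℝ) (i : Fin N) : Set ℝ :=
  if i = 0 then Ioo 0 (h i) else Ioo (h i) 0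

/-- `closure J_i \ {0}`, the edge with its outer end point `h_i` and without the node. -/
def edgeClosed {N : ℕ} [NeZero N] (h : Fin N → ℝ) (i : Fin N) : Set ℝ :=
  closure (edge h i) \ {0}

/-- `min_i |h_i|`. -/
def hbar {N : ℕ} (h : Fin N → ℝ) : ℝ := ⨅ i, |h i|

/-! ### Assumptions on the Hamiltonian `H` -/

/-- `H ∈ C²(ℝ²)` and `H(x) → ∞` as `|x| → ∞`. -/
def CondH1 (H : Plane → ℝ) : Prop :=
  ContDiff ℝ 2 H ∧ Tendsto H (cocompact Plane) atTop

/-- `H` has exactly the `N` (distinct) critical points `z_i`, it has a local minimum at `z_i` for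
`i ≠ 0`, and `z₀ = 0`, `H(0) = 0`. -/
def CondH2 {N : ℕ} [NeZero N] (H : Plane → ℝ) (z : Fin N → Plane) : Prop :=
  Function.Injective z ∧ {x | ∇ H x = 0} = range z ∧
    (∀ i, i ≠ 0 → IsLocalMin H (z i)) ∧ z 0 = 0 ∧ H 0 = 0

/-- The growth conditions on the derivatives of `H` at the origin. -/
def CondH3 (H : Plane → ℝ) : Prop :=
  ∃ m n A₁ A₂ : ℝ, 0 ≤ m ∧ 0 < n ∧ 0 < A₁ ∧ 0 < A₂ ∧ n < m + 2 ∧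
    ∃ V ∈ 𝓝 (0 : Plane), ∀ x ∈ V,
      (∀ i j : Fin 2, |partialDeriv j (partialDeriv i H) x| ≤ A₁ * ‖x‖ ^ m) ∧
      A₂ * ‖x‖ ^ n ≤ ‖∇ H x‖

/-- The choice of the levels: `h₀ > 0` and `H(z_i) < h_i < 0` for `i ≠ 0`. -/
def CondLevels {N : ℕ} [NeZero N] (H : Plane → ℝ) (z : Fin N → Plane) (h : Fin N → ℝ) : Prop :=
  0 < h 0 ∧ ∀ i, i ≠ 0 → H (z i) < h i ∧ h i < 0

/-! ### Assumptions on `G` and `g` (only their values over `closure Ω` and on `∂Ω` matter) -/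

/-- `G ∈ C(closure Ω × ℝ²)` and `g ∈ C(∂Ω)`. -/
def CondG1 (Ω : Set Plane) (G : Plane → Plane → ℝ) (g : Plane → ℝ) : Prop :=
  ContinuousOn (Function.uncurry G) (closure Ω ×ˢ univ) ∧ ContinuousOn g (frontier Ω)

/-- `|G(x,p) - G(y,p)| ≤ m₁(|x-y|(1+|p|))` for a modulus `m₁`. -/
def CondG2 (Ω : Set Plane) (G : Plane → Plane → ℝ) : Prop :=
  ∃ m₁ : ℝ≥0 → ℝ≥0, Continuous m₁ ∧ Monotone m₁ ∧ m₁ 0 = 0 ∧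
    ∀ x ∈ closure Ω, ∀ y ∈ closure Ω, ∀ p : Plane,
      |G x p - G y p| ≤ m₁ (‖x - y‖₊ * (1 + ‖p‖₊))

/-- `|G(x,p) - G(x,q)| ≤ m₂(|p-q|)` for a modulus `m₂`. -/
def CondG3 (Ω : Set Plane) (G : Plane → Plane → ℝ) : Prop :=
  ∃ m₂ : ℝ≥0 → ℝ≥0, Continuous m₂ ∧ Monotone m₂ ∧ m₂ 0 = 0 ∧
    ∀ x ∈ closure Ω, ∀ p q : Plane, |G x p - G x q| ≤ m₂ ‖p - q‖₊

/-- There is `γ ∈ (0, min_i |h_i|)` such that `q ↦ G(x, q DH(x))` is convex for every `x` with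
`|H x| < γ` off the curve `c₀(0)`. -/
def CondG4 {N : ℕ} [NeZero N] (H : Plane → ℝ) (z : Fin N → Plane) (h : Fin N → ℝ)
    (G : Plane → Plane → ℝ) : Prop :=
  ∃ γ : ℝ, 0 < γ ∧ γ < hbar h ∧ ∀ x ∈ {x | |H x| < γ} \ levelCurve H z h 0 0,
    ConvexOn ℝ univ (fun q : ℝ => G x (q • ∇ H x))

/-- `G(x,p) ≥ ν|p| - M` with `ν, M > 0`. -/
def CondG5 (Ω : Set Plane) (G : Plane → Plane → ℝ) : Prop :=
  ∃ ν M : ℝ, 0 < ν ∧ 0 < M ∧ ∀ x ∈ closure Ω, ∀ p : Plane, ν * ‖p‖ - M ≤ G x p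

/-! ### Semicontinuous envelopes -/

/-- `u` is locally bounded on `S`. -/
def LocBddOn {X : Type*} [TopologicalSpace X] (u : X → ℝ) (S : Set X) : Prop :=
  ∀ x ∈ S, ∃ C : ℝ, ∀ᶠ y in 𝓝[S] x, |u y| ≤ C

/-- The upper semicontinuous envelope on `S` of `u : S → ℝ` (at `x ∈ S` the filter `𝓝[S] x`
sees the point `x` itself). -/
def uscEnv {X : Type*} [TopologicalSpace X] (S : Set X) (u : X → ℝ) (x : X) : ℝ :=
  limsup u (𝓝[S] x)

/-- The lower semicontinuous envelope on `S` of `u : S → ℝ`. -/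
def lscEnv {X : Type*} [TopologicalSpace X] (S : Set X) (u : X → ℝ) (x : X) : ℝ :=
  liminf u (𝓝[S] x)

/-! ### Viscosity solutions of the problem with large drift -/

/-- The left-hand side `lam r - ε⁻¹ b(x)·p + G(x,p)` of the equation. -/
def hjOp (H : Plane → ℝ) (G : Plane → Plane → ℝ) (lam ε : ℝ) (x : Plane) (r : ℝ) (p : Plane) : ℝ :=
  lam * r - ε⁻¹ * inner ℝ (drift H x) p + G x p

/-- Viscosity subsolution of `lam u - ε⁻¹ b·Du + G(x,Du) = 0` in `Ω`. -/
def IsSubHJeps (Ω : Set Plane) (H : Plane → ℝ) (G : Plane → Plane → ℝ) (lam ε : ℝ)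
    (u : Plane → ℝ) : Prop :=
  LocBddOn u Ω ∧ ∀ φ : Plane → ℝ, ContDiffOn ℝ 1 φ Ω → ∀ x ∈ Ω,
    IsLocalMaxOn (fun y => uscEnv Ω u y - φ y) Ω x →
      hjOp H G lam ε x (uscEnv Ω u x) (∇ φ x) ≤ 0

/-- Viscosity supersolution of `lam u - ε⁻¹ b·Du + G(x,Du) = 0` in `Ω`. -/
def IsSuperHJeps (Ω : Set Plane) (H : Plane → ℝ) (G : Plane → Plane → ℝ) (lam ε : ℝ)
    (u : Plane → ℝ) : Prop :=
  LocBddOn u Ω ∧ ∀ φ : Plane → ℝ, ContDiffOn ℝ 1 φ Ω → ∀ x ∈ Ω,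
    IsLocalMinOn (fun y => lscEnv Ω u y - φ y) Ω x →
      0 ≤ hjOp H G lam ε x (lscEnv Ω u x) (∇ φ x)

/-- Viscosity subsolution of the equation in `Ω` with the Dirichlet condition `u = g` on `∂Ω`
in the viscosity sense; `u` is a function on `closure Ω` (its values elsewhere play no role), and
`C¹(closure Ω)` is the set of restrictions of `C¹` functions on the plane. -/
def IsSubDirichletEps (Ω : Set Plane) (H : Plane → ℝ) (G : Plane → Plane → ℝ) (g : Plane → ℝ)
    (lam ε : ℝ) (u : Plane → ℝ) : Prop :=
  (∃ C : ℝ, ∀ x ∈ closure Ω, |u x| ≤ C) ∧ IsSubHJeps Ω H G lam ε u ∧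
  ∀ φ : Plane → ℝ, ContDiff ℝ 1 φ → ∀ x ∈ frontier Ω,
    IsLocalMaxOn (fun y => uscEnv (closure Ω) u y - φ y) (closure Ω) x →
      min (hjOp H G lam ε x (uscEnv (closure Ω) u x) (∇ φ x))
        (uscEnv (closure Ω) u x - g x) ≤ 0

/-- Viscosity supersolution of the equation in `Ω` with the Dirichlet condition `u = g` on `∂Ω`
in the viscosity sense. -/
def IsSuperDirichletEps (Ω : Set Plane) (H : Plane → ℝ) (G : Plane → Plane → ℝ) (g : Plane → ℝ)
    (lam ε : ℝ) (u : Plane → ℝ) : Prop :=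
  (∃ C : ℝ, ∀ x ∈ closure Ω, |u x| ≤ C) ∧ IsSuperHJeps Ω H G lam ε u ∧
  ∀ φ : Plane → ℝ, ContDiff ℝ 1 φ → ∀ x ∈ frontier Ω,
    IsLocalMinOn (fun y => lscEnv (closure Ω) u y - φ y) (closure Ω) x →
      0 ≤ max (hjOp H G lam ε x (lscEnv (closure Ω) u x) (∇ φ x))
        (lscEnv (closure Ω) u x - g x)

/-- `𝒮_ε`: all viscosity solutions of the Dirichlet problem with parameter `ε`. -/
def solutionSet (Ω : Set Plane) (H : Plane → ℝ) (G : Plane → Plane → ℝ) (g : Plane → ℝ)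
    (lam ε : ℝ) : Set (Plane → ℝ) :=
  {u | IsSubDirichletEps Ω H G g lam ε u ∧ IsSuperDirichletEps Ω H G g lam ε u}

/-! ### Half-relaxed limits and their reductions to the edges -/

/-- The values `u(y)` with `u ∈ 𝒮_ε`, `y ∈ B_r(x) ∩ closure Ω`, `ε ∈ (0, r)`. -/
def nearValues (Ω : Set Plane) (H : Plane → ℝ) (G : Plane → Plane → ℝ) (g : Plane → ℝ)
    (lam : ℝ) (x : Plane) (r : ℝ) : Set ℝ :=
  {a | ∃ ε ∈ Ioo 0 r, ∃ u ∈ solutionSet Ω H G g lam ε,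
    ∃ y ∈ Metric.ball x r ∩ closure Ω, a = u y}

/-- The upper half-relaxed limit `v⁺` of `𝒮_ε` as `ε → 0+`. -/
def vPlus (Ω : Set Plane) (H : Plane → ℝ) (G : Plane → Plane → ℝ) (g : Plane → ℝ)
    (lam : ℝ) (x : Plane) : ℝ :=
  limUnder (𝓝[>] (0 : ℝ)) (fun r => sSup (nearValues Ω H G g lam x r))

/-- The lower half-relaxed limit `v⁻` of `𝒮_ε` as `ε → 0+`. -/
def vMinus (Ω : Set Plane) (H : Plane → ℝ) (G : Plane → Plane → ℝ) (g : Plane → ℝ)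
    (lam : ℝ) (x : Plane) : ℝ :=
  limUnder (𝓝[>] (0 : ℝ)) (fun r => sInf (nearValues Ω H G g lam x r))

/-- `max_{c_i(s)} v⁺`. -/
def curveMax {N : ℕ} [NeZero N] (H : Plane → ℝ) (z : Fin N → Plane) (h : Fin N → ℝ)
    (G : Plane → Plane → ℝ) (g : Plane → ℝ) (lam : ℝ) (i : Fin N) (s : ℝ) : ℝ :=
  sSup (vPlus (domain H z h) H G g lam '' levelCurve H z h i s)

/-- `v_i⁺(s) = max_{c_i(s)} v⁺` for `s ≠ h_i`, and `v_i⁺(h_i)` is the upper limit of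
`v_i⁺(s)` as `s → h_i` in `J_i`. -/
def vEdgePlus {N : ℕ} [NeZero N] (H : Plane → ℝ) (z : Fin N → Plane) (h : Fin N → ℝ)
    (G : Plane → Plane → ℝ) (g : Plane → ℝ) (lam : ℝ) (i : Fin N) (s : ℝ) : ℝ :=
  if s = h i then limsup (curveMax H z h G g lam i) (𝓝[edge h i] (h i))
  else curveMax H z h G g lam i s

/-- `v_i⁻(s) = min_{c_i(s)} v⁻`. -/
def vEdgeMinus {N : ℕ} [NeZero N] (H : Plane → ℝ) (z : Fin N → Plane) (h : Fin N → ℝ)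
    (G : Plane → Plane → ℝ) (g : Plane → ℝ) (lam : ℝ) (i : Fin N) (s : ℝ) : ℝ :=
  sInf (vMinus (domain H z h) H G g lam '' levelCurve H z h i s)

/-! ### The effective problem on an edge -/

/-- `T_i(s) = ∫_{c_i(s)} |DH|⁻¹ dl`, with `dl` the arc length (one-dimensional Hausdorff
measure). -/
def period {N : ℕ} [NeZero N] (H : Plane → ℝ) (z : Fin N → Plane) (h : Fin N → ℝ)
    (i : Fin N) (s : ℝ) : ℝ :=
  ∫ x in levelCurve H z h i s, 1 / ‖∇ H x‖ ∂(Measure.hausdorffMeasure 1)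

/-- The effective Hamiltonian
`Ḡ_i(s,q) = T_i(s)⁻¹ ∫_{c_i(s)} G(x, q DH(x)) / |DH(x)| dl`. -/
def effG {N : ℕ} [NeZero N] (H : Plane → ℝ) (z : Fin N → Plane) (h : Fin N → ℝ)
    (G : Plane → Plane → ℝ) (i : Fin N) (s q : ℝ) : ℝ :=
  1 / period H z h i s *
    ∫ x in levelCurve H z h i s, G x (q • ∇ H x) / ‖∇ H x‖ ∂(Measure.hausdorffMeasure 1)

/-- The effective boundary value `min_{∂_iΩ} g`. -/
def effBdry {N : ℕ} [NeZero N] (H : Plane → ℝ) (z : Fin N → Plane) (h : Fin N → ℝ)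
    (g : Plane → ℝ) (i : Fin N) : ℝ :=
  sInf (g '' boundaryPart H z h i)

/-- Viscosity subsolution of `lam u + F(s, u') = 0` in the open set `J ⊆ ℝ`. -/
def IsSubEdge (J : Set ℝ) (F : ℝ → ℝ → ℝ) (lam : ℝ) (u : ℝ → ℝ) : Prop :=
  LocBddOn u J ∧ ∀ φ : ℝ → ℝ, ContDiffOn ℝ 1 φ J → ∀ s ∈ J,
    IsLocalMaxOn (fun t => uscEnv J u t - φ t) J s →
      lam * uscEnv J u s + F s (deriv φ s) ≤ 0

/-- Viscosity supersolution of `lam u + F(s, u') = 0` in the open set `J ⊆ ℝ`. -/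
def IsSuperEdge (J : Set ℝ) (F : ℝ → ℝ → ℝ) (lam : ℝ) (u : ℝ → ℝ) : Prop :=
  LocBddOn u J ∧ ∀ φ : ℝ → ℝ, ContDiffOn ℝ 1 φ J → ∀ s ∈ J,
    IsLocalMinOn (fun t => lscEnv J u t - φ t) J s →
      0 ≤ lam * lscEnv J u s + F s (deriv φ s)

/-- Viscosity subsolution of the effective equation `lam u + Ḡ_i(s, u') = 0` in `J_i` with
`u(h_i) = min_{∂_iΩ} g`, for a function `u` on `closure J_i \ {0}`. -/
def IsSubEffective {N : ℕ} [NeZero N] (H : Plane → ℝ) (z : Fin N → Plane) (h : Fin N → ℝ)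
    (G : Plane → Plane → ℝ) (g : Plane → ℝ) (lam : ℝ) (i : Fin N) (u : ℝ → ℝ) : Prop :=
  LocBddOn u (edgeClosed h i) ∧ IsSubEdge (edge h i) (effG H z h G i) lam u ∧
  ∀ φ : ℝ → ℝ, ContDiffOn ℝ 1 φ (edgeClosed h i) →
    IsLocalMaxOn (fun t => uscEnv (edgeClosed h i) u t - φ t) (edgeClosed h i) (h i) →
      min (lam * uscEnv (edgeClosed h i) u (h i) +
            effG H z h G i (h i) (derivWithin φ (edgeClosed h i) (h i)))
        (uscEnv (edgeClosed h i) u (h i) - effBdry H z h g i) ≤ 0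

/-- Viscosity supersolution of the effective equation `lam u + Ḡ_i(s, u') = 0` in `J_i` with
`u(h_i) = min_{∂_iΩ} g`, for a function `u` on `closure J_i \ {0}`. -/
def IsSuperEffective {N : ℕ} [NeZero N] (H : Plane → ℝ) (z : Fin N → Plane) (h : Fin N → ℝ)
    (G : Plane → Plane → ℝ) (g : Plane → ℝ) (lam : ℝ) (i : Fin N) (u : ℝ → ℝ) : Prop :=
  LocBddOn u (edgeClosed h i) ∧ IsSuperEdge (edge h i) (effG H z h G i) lam u ∧
  ∀ φ : ℝ → ℝ, ContDiffOn ℝ 1 φ (edgeClosed h i) →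
    IsLocalMinOn (fun t => lscEnv (edgeClosed h i) u t - φ t) (edgeClosed h i) (h i) →
      0 ≤ max (lam * lscEnv (edgeClosed h i) u (h i) +
            effG H z h G i (h i) (derivWithin φ (edgeClosed h i) (h i)))
        (lscEnv (edgeClosed h i) u (h i) - effBdry H z h g i)

end HamiltonianAveraging

end

open HamiltonianAveraging

/-!
The large drift `-ε⁻¹ b · Du` makes solutions nearly constant along the level curves of `H`, and
the next order of the equation is averaged along each curve with the invariant density `dl / |∇H|`.
This is made rigorous by the perturbed test function method.

Over an edge, `H` has no critical points and each level curve is one periodic orbit of the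
Hamiltonian field `b` (`IsBand.exists_periodic_orbit`), so that `dl / |∇H|` is the time element of
the orbit (`IsBand.exists_orbit_integral`). Integrating in time along the orbit solves the cell
problem `b · ∇ψ = f - mean f` on one level curve with a `C¹` function `ψ` on the plane
(`IsBand.exists_corrector`). If `φ` touches the upper envelope of `s ↦ max v⁺` from above at `s`,
take `f = G(x, φ'(s) ∇H)` and test the solutions `u` with `φ ∘ H + (H - s)² + ε ψ`. Since
`b · ∇(φ ∘ H) = 0`, the singular term contributes only `-b · ∇ψ = mean f - f`, which turns
`G(x, φ'(s) ∇H)` into its mean, and the effective inequality results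
(`IsEdge.effective_le_zero`). The argument is symmetric: `-u` solves the problem with the
nonlinearity `dualG G` and the boundary datum `-g`, and `v⁻` is minus the upper limit of that
problem (`IsProblem.vMinus_eq`), so supersolutions need no separate treatment, at the boundary level
included. The half-relaxed limits are finite because the solutions are bounded uniformly in `ε` and
exist for every `ε` by Perron's method (`solutionSet_nonempty`).

For the boundary inequality `v_i⁺(h_i) ≤ min g`, coercivity of `G` makes steep functions of `H`
strict supersolutions, whatever `ε` is, because the drift does not see them. Hence each solution is
at most `g` on the boundary (`IsEdge.uscEnv_le_of_mem_level`). In a thin layer at the boundary curve,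
a corrector that decreases fast along `b` off a small arc carries the bound from an arc where `g` is
almost minimal to the whole level curve, with an error of order `ε`; a barrier linear in `H`, with a
slope that does not depend on `ε`, carries it on to a fixed neighbourhood of the boundary curve
(`IsEdge.exists_vPlus_le`).

The topological input is that `{H > 0}` is connected and that every component of `{H < 0}` contains
exactly one minimum point (`isPreconnected_pos`, `exists_mem_component`,
`eq_of_mem_connectedComponentIn`); the second fact is a mountain pass argument with the gradient
flow.
-/

open Set Filter Topology MeasureTheory
open scoped NNReal Gradient

noncomputable section

namespace HamiltonianAveraging

/-! ### Global flows of bounded Lipschitz vector fields -/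

section Flow

variable {E : Type*} [NormedAddCommGroup E] [NormedSpace ℝ E]

/-- The bound `C` on the field confines the curve to a ball of radius `C n` up to time `n`, so the
Picard-Lindelöf theorem applies on every interval. -/
theorem exists_integralCurve_Ioo [CompleteSpace E] {V : E → E} {K C : ℝ≥0} (hV : LipschitzWith K V)
    (hC : ∀ x, ‖V x‖ ≤ C) (x : E) (n : ℝ) (hn : 0 < n) :
    ∃ α : ℝ → E, α 0 = x ∧ ∀ t ∈ Ioo (-n) n, HasDerivAt α (V (α t)) t := by
  have h0 : (0 : ℝ) ∈ Icc (-n) n := ⟨by linarith, hn.le⟩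
  have hpl : IsPicardLindelof (fun _ => V) (⟨0, h0⟩ : Icc (-n) n) x (C * n.toNNReal) 0 C K := by
    refine IsPicardLindelof.of_time_independent (fun y _ => hC y) hV.lipschitzOnWith ?_
    simp [hn.le]
  obtain ⟨α, hα0, hα⟩ := hpl.exists_eq_forall_mem_Icc_hasDerivWithinAt₀
  exact ⟨α, hα0, fun t ht => (hα t ⟨ht.1.le, ht.2.le⟩).hasDerivAt (Icc_mem_nhds ht.1 ht.2)⟩

theorem exists_integralCurve [CompleteSpace E] {V : E → E} {K C : ℝ≥0} (hV : LipschitzWith K V)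
    (hC : ∀ x, ‖V x‖ ≤ C) (x : E) :
    ∃ α : ℝ → E, α 0 = x ∧ ∀ t, HasDerivAt α (V (α t)) t := by
  have hp : ∀ t : ℝ, 0 < |t| + 1 := fun t => by positivity
  choose γ hγ0 hγ using fun n : {n : ℝ // 0 < n} => exists_integralCurve_Ioo hV hC x n.1 n.2
  -- By uniqueness the local curves agree where they are both defined, so they can be glued.
  have huniq : ∀ a b : {n : ℝ // 0 < n}, a.1 ≤ b.1 → EqOn (γ a) (γ b) (Ioo (-a.1) a.1) := by
    intro a b hab
    refine ODE_solution_unique_of_mem_Ioo (v := fun _ => V) (K := K) (s := fun _ => univ)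
      (fun t _ => hV.lipschitzOnWith) (t₀ := 0) ⟨by linarith [a.2], a.2⟩ ?_ ?_ (by rw [hγ0, hγ0])
    · exact fun t ht => ⟨hγ a t ht, trivial⟩
    · exact fun t ht => ⟨hγ b t ⟨by linarith [ht.1], by linarith [ht.2]⟩, trivial⟩
  have hall : ∀ a b : {n : ℝ // 0 < n}, ∀ t, |t| < a.1 → |t| < b.1 → γ a t = γ b t := by
    intro a b t ha hb
    rcases le_total a.1 b.1 with h | h
    · exact huniq a b h (abs_lt.1 ha)
    · exact (huniq b a h (abs_lt.1 hb)).symm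
  refine ⟨fun t => γ ⟨|t| + 1, hp t⟩ t, hγ0 _, fun t => ?_⟩
  have hd := hγ ⟨|t| + 2, by positivity⟩ t (abs_lt.1 (by simp))
  have : γ ⟨|t| + 1, hp t⟩ t = γ ⟨|t| + 2, by positivity⟩ t := hall _ _ t (by simp) (by simp)
  simp only [this]
  refine hd.congr_of_eventuallyEq ?_
  have : ∀ᶠ s in 𝓝 t, |s| < |t| + 2 := (continuous_abs.tendsto t).eventually_lt_const (by simp)
  filter_upwards [this] with s hs
  exact hall _ _ s (by simp) hs

theorem dist_integralCurve_le {V : E → E} {K : ℝ≥0} (hV : LipschitzWith K V) {α β : ℝ → E}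
    (hα : ∀ t, HasDerivAt α (V (α t)) t) (hβ : ∀ t, HasDerivAt β (V (β t)) t) (t : ℝ) :
    dist (α t) (β t) ≤ dist (α 0) (β 0) * Real.exp (K * |t|) := by
  rcases le_total 0 t with ht | ht
  · have := dist_le_of_trajectories_ODE (v := fun _ => V) (fun _ => hV)
      (f := α) (g := β) (a := 0) (b := t) (δ := dist (α 0) (β 0))
      (fun s _ => (hα s).continuousAt.continuousWithinAt)
      (fun s _ => (hα s).hasDerivWithinAt)
      (fun s _ => (hβ s).continuousAt.continuousWithinAt)
      (fun s _ => (hβ s).hasDerivWithinAt) le_rfl t ⟨ht, le_rfl⟩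
    simpa [abs_of_nonneg ht] using this
  · have hneg : ∀ {γ : ℝ → E}, (∀ t, HasDerivAt γ (V (γ t)) t) →
        ∀ s, HasDerivAt (fun r => γ (-r)) (-V (γ (-s))) s := fun {γ} h s => by
      have := (h (-s)).scomp s (hasDerivAt_neg s)
      rwa [neg_one_smul] at this
    have hVn : LipschitzWith K (fun x => -V x) := hV.neg
    have := dist_le_of_trajectories_ODE (v := fun _ => fun x => -V x) (fun _ => hVn)
      (f := fun r => α (-r)) (g := fun r => β (-r)) (a := 0) (b := -t) (δ := dist (α 0) (β 0))
      (fun s _ => (hneg hα s).continuousAt.continuousWithinAt)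
      (fun s _ => (hneg hα s).hasDerivWithinAt)
      (fun s _ => (hneg hβ s).continuousAt.continuousWithinAt)
      (fun s _ => (hneg hβ s).hasDerivWithinAt) (by simp) (-t) ⟨by linarith, le_rfl⟩
    simpa [abs_of_nonpos ht] using this

theorem integralCurve_unique {V : E → E} {K : ℝ≥0} (hV : LipschitzWith K V) {α β : ℝ → E}
    (hα : ∀ t, HasDerivAt α (V (α t)) t) (hβ : ∀ t, HasDerivAt β (V (β t)) t) (t₀ : ℝ)
    (h : α t₀ = β t₀) : α = β :=
  ODE_solution_unique_univ (v := fun _ => V) (K := K) (s := fun _ => univ)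
    (fun _ => hV.lipschitzOnWith) (fun t => ⟨hα t, trivial⟩) (fun t => ⟨hβ t, trivial⟩) h

/-- A bounded Lipschitz vector field has a global, jointly continuous flow. -/
theorem exists_flow [CompleteSpace E] {V : E → E} {K C : ℝ≥0} (hV : LipschitzWith K V)
    (hC : ∀ x, ‖V x‖ ≤ C) :
    ∃ Φ : ℝ → E → E, (∀ x, Φ 0 x = x) ∧ (∀ x t, HasDerivAt (fun s => Φ s x) (V (Φ t x)) t) ∧
      Continuous (fun p : ℝ × E => Φ p.1 p.2) := by
  choose γ hγ0 hγ using fun x => exists_integralCurve hV hC x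
  refine ⟨fun t x => γ x t, hγ0, fun x t => hγ x t, ?_⟩
  rw [continuous_iff_continuousAt]
  rintro ⟨t, x⟩
  rw [ContinuousAt, tendsto_iff_dist_tendsto_zero]
  have hb : ∀ p : ℝ × E, dist (γ p.2 p.1) (γ x t) ≤
      dist p.2 x * Real.exp (K * |p.1|) + dist (γ x p.1) (γ x t) := by
    intro p
    have := dist_integralCurve_le hV (hγ p.2) (hγ x) p.1
    rw [hγ0, hγ0] at this
    linarith [dist_triangle (γ p.2 p.1) (γ x p.1) (γ x t)]
  refine squeeze_zero (fun _ => dist_nonneg) hb ?_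
  have hc : Continuous (γ x) := continuous_iff_continuousAt.2 fun s => (hγ x s).continuousAt
  have : Tendsto (fun p : ℝ × E => dist p.2 x * Real.exp (K * |p.1|) + dist (γ x p.1) (γ x t))
      (𝓝 (t, x)) (𝓝 (dist x x * Real.exp (K * |t|) + dist (γ x t) (γ x t))) := by
    refine Continuous.tendsto (f := fun p : ℝ × E =>
      dist p.2 x * Real.exp (K * |p.1|) + dist (γ x p.1) (γ x t)) ?_ (t, x)
    fun_prop
  simpa using this

end Flow

/-- A compactly supported `C¹` vector field has a global, jointly continuous flow, and its integral
curves are determined by one of their points. -/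
theorem exists_flow_of_hasCompactSupport {V : Plane → Plane} (hV : ContDiff ℝ 1 V)
    (hc : HasCompactSupport V) :
    ∃ Φ : ℝ → Plane → Plane, (∀ x, Φ 0 x = x) ∧
      (∀ x t, HasDerivAt (fun s => Φ s x) (V (Φ t x)) t) ∧
      Continuous (fun p : ℝ × Plane => Φ p.1 p.2) ∧
      ∀ α β : ℝ → Plane, (∀ t, HasDerivAt α (V (α t)) t) → (∀ t, HasDerivAt β (V (β t)) t) →
        ∀ t₀, α t₀ = β t₀ → α = β := by
  obtain ⟨K, hK⟩ := ContDiff.lipschitzWith_of_hasCompactSupport hc hV one_ne_zero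
  obtain ⟨C, hC⟩ := hc.exists_bound_of_continuous hV.continuous
  obtain ⟨Φ, h0, h1, h2⟩ := exists_flow hK (C := C.toNNReal)
    (fun x => (hC x).trans (Real.le_coe_toNNReal C))
  exact ⟨Φ, h0, h1, h2, fun α β hα hβ t₀ h => integralCurve_unique hK hα hβ t₀ h⟩

/-! ### Level curves in a band without critical points -/

theorem contDiff_gradient {H : Plane → ℝ} (hH : ContDiff ℝ 2 H) : ContDiff ℝ 1 (∇ H) := by
  have h1 : ContDiff ℝ 1 (fderiv ℝ H) := hH.fderiv_right (by norm_num)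
  exact (InnerProductSpace.toDual ℝ Plane).symm.toContinuousLinearEquiv.contDiff.comp h1

theorem hasDerivAt_comp_curve {f : Plane → ℝ} {γ : ℝ → Plane} {v : Plane} {t : ℝ}
    (hf : DifferentiableAt ℝ f (γ t)) (hγ : HasDerivAt γ v t) :
    HasDerivAt (fun s => f (γ s)) (inner ℝ (∇ f (γ t)) v) t := by
  rw [inner_gradient_left]
  exact hf.hasFDerivAt.comp_hasDerivAt t hγ

/-- Around a compact set without critical points of `H`, the normalized gradient field can be cut
off: along the field, `H` increases with speed between `0` and `1`, and with speed `1` on the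
compact set. -/
theorem exists_ascending_field {H : Plane → ℝ} (hH : ContDiff ℝ 2 H) {K : Set Plane}
    (hK : IsCompact K) (hcrit : ∀ x ∈ K, ∇ H x ≠ 0) :
    ∃ V : Plane → Plane, ContDiff ℝ 1 V ∧ HasCompactSupport V ∧
      (∀ x, 0 ≤ inner ℝ (∇ H x) (V x) ∧ inner ℝ (∇ H x) (V x) ≤ 1) ∧
      ∀ x ∈ K, inner ℝ (∇ H x) (V x) = 1 := by
  have hg := contDiff_gradient hH
  have hU : IsOpen {x | ∇ H x ≠ 0} := isOpen_ne_fun hg.continuous continuous_const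
  obtain ⟨L, hL, hKL, hLU⟩ := exists_compact_between hK hU hcrit
  obtain ⟨η, hη, hηr, hη0, hη1⟩ := exists_contMDiff_zero_iff_one_iff_of_isClosed
    (modelWithCornersSelf ℝ Plane) (n := 1) (s := (interior L)ᶜ) (t := K)
    isOpen_interior.isClosed_compl hK.isClosed
    (disjoint_compl_left_iff_subset.2 hKL)
  have hη' : ContDiff ℝ 1 η := contMDiff_iff_contDiff.1 hη
  have hsupp : tsupport η ⊆ L := by
    refine closure_minimal (fun x hx => ?_) hL.isClosed
    by_contra hxL
    exact hx ((hη0 x).1 fun h => hxL (interior_subset h))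
  have hηc : HasCompactSupport η := hL.of_isClosed_subset (isClosed_tsupport η) hsupp
  have hin : ∀ x, inner ℝ (∇ H x) ((η x / ‖∇ H x‖ ^ 2) • ∇ H x) = η x := by
    intro x
    rw [real_inner_smul_right, real_inner_self_eq_norm_sq]
    by_cases hx : ∇ H x = 0
    · have : η x = 0 := (hη0 x).1 fun h => hLU (interior_subset h) hx
      simp [hx, this]
    · have : ‖∇ H x‖ ≠ 0 := norm_ne_zero_iff.2 hx
      field_simp
  refine ⟨fun x => (η x / ‖∇ H x‖ ^ 2) • ∇ H x, ?_, ?_, fun x => ?_, fun x hx => ?_⟩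
  · rw [contDiff_iff_contDiffAt]
    intro x
    by_cases hx : x ∈ tsupport η
    · have hne : ∇ H x ≠ 0 := hLU (hsupp hx)
      refine ContDiffAt.smul (hη'.contDiffAt.div (hg.contDiffAt.norm_sq ℝ) ?_) hg.contDiffAt
      exact pow_ne_zero 2 (norm_ne_zero_iff.2 hne)
    · have h0 : η =ᶠ[𝓝 x] 0 := notMem_tsupport_iff_eventuallyEq.1 hx
      have : (fun x => (η x / ‖∇ H x‖ ^ 2) • ∇ H x) =ᶠ[𝓝 x] fun _ => 0 := by
        filter_upwards [h0] with y hy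
        simp [hy]
      exact contDiffAt_const.congr_of_eventuallyEq this
  · refine hηc.mono fun x hx => ?_
    simp only [Function.mem_support] at hx ⊢
    intro h
    simp [h] at hx
  · rw [hin]
    exact hηr (mem_range_self x)
  · rw [hin]
    exact (hη1 x).1 hx

/-- The flow of the field of `exists_ascending_field`. -/
theorem exists_ascending_flow {H : Plane → ℝ} (hH : ContDiff ℝ 2 H) {K : Set Plane}
    (hK : IsCompact K) (hcrit : ∀ x ∈ K, ∇ H x ≠ 0) :
    ∃ Φ : ℝ → Plane → Plane, (∀ x, Φ 0 x = x) ∧ Continuous (fun p : ℝ × Plane => Φ p.1 p.2) ∧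
      (∀ x, Monotone fun t => H (Φ t x)) ∧ (∀ x, Monotone fun t => t - H (Φ t x)) ∧
      ∀ x s t, (∀ r ∈ uIcc s t, Φ r x ∈ K) → H (Φ t x) - H (Φ s x) = t - s := by
  obtain ⟨V, hV, hVc, hV01, hV1⟩ := exists_ascending_field hH hK hcrit
  obtain ⟨Φ, h0, hd, hc, -⟩ := exists_flow_of_hasCompactSupport hV hVc
  have hHd : ∀ x t, HasDerivAt (fun s => H (Φ s x)) (inner ℝ (∇ H (Φ t x)) (V (Φ t x))) t :=
    fun x t => hasDerivAt_comp_curve (hH.differentiable (by norm_num) _) (hd x t)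
  have hHd' : ∀ x t, HasDerivAt (fun s => s - H (Φ s x))
      (1 - inner ℝ (∇ H (Φ t x)) (V (Φ t x))) t := fun x t => (hasDerivAt_id t).sub (hHd x t)
  refine ⟨Φ, h0, hc, fun x => ?_, fun x => ?_, fun x s t hK => ?_⟩
  · exact monotone_of_hasDerivAt_nonneg (hHd x) fun t => (hV01 _).1
  · exact monotone_of_hasDerivAt_nonneg (hHd' x) fun t => by simpa using (hV01 _).2
  · have := Convex.norm_image_sub_le_of_norm_hasDerivWithin_le (C := 0) (s := uIcc s t)
      (fun r _ => (hHd' x r).hasDerivWithinAt) (fun r hr => by simp [hV1 _ (hK r hr)])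
      (convex_uIcc s t) left_mem_uIcc right_mem_uIcc
    rw [zero_mul, norm_le_zero_iff] at this
    linarith

/-- An open connected region `W` foliated by the compact level curves `W ∩ {H = s}`, `s ∈ I`, and
free of critical points of `H`. -/
structure IsBand (H : Plane → ℝ) (W : Set Plane) (I : Set ℝ) : Prop where
  isOpen : IsOpen W
  isPreconnected : IsPreconnected W
  ordConnected : I.OrdConnected
  isOpen_levels : IsOpen I
  mem_levels : ∀ x ∈ W, H x ∈ I
  nonempty : ∀ s ∈ I, (W ∩ H ⁻¹' {s}).Nonempty
  isCompact : ∀ a b, Icc a b ⊆ I → IsCompact (W ∩ H ⁻¹' Icc a b)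
  gradient_ne : ∀ x ∈ W, ∇ H x ≠ 0

namespace IsBand

variable {H : Plane → ℝ} {W : Set Plane} {I : Set ℝ}

theorem isCompact_level (hW : IsBand H W I) {s : ℝ} (hs : s ∈ I) :
    IsCompact (W ∩ H ⁻¹' {s}) := by
  have := hW.isCompact s s (by simpa using hs)
  rwa [Icc_self] at this

/-- A connected set that meets `W` and whose levels stay in a compact part of `I` cannot leave
`W`. -/
theorem subset_of_isPreconnected (hW : IsBand H W I) {a b : ℝ} (hab : Icc a b ⊆ I) {S : Set Plane}
    (hS : IsPreconnected S) (hSH : ∀ x ∈ S, H x ∈ Icc a b) (hne : (S ∩ W).Nonempty) : S ⊆ W := by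
  have hK := (hW.isCompact a b hab).isClosed
  have hcov : S ⊆ W ∪ (W ∩ H ⁻¹' Icc a b)ᶜ := fun x hx => by
    by_cases hxW : x ∈ W
    · exact Or.inl hxW
    · exact Or.inr fun h => hxW h.1
  have hdis : S ∩ (W ∩ (W ∩ H ⁻¹' Icc a b)ᶜ) = ∅ :=
    eq_empty_of_forall_notMem fun x ⟨hxS, hxW, hn⟩ => hn ⟨hxW, hSH x hxS⟩
  rcases isPreconnected_iff_subset_of_disjoint.1 hS W _ hW.isOpen hK.isOpen_compl hcov hdis
    with h | h
  · exact h
  · obtain ⟨x, hx, hxW⟩ := hne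
    exact absurd ⟨hxW, hSH x hx⟩ (h hx)

/-- The level curves of a band are connected: a path in `W` joining two points of the curve is
carried into the curve by the normalized gradient flow. -/
theorem isPreconnected_level (hH : ContDiff ℝ 2 H) (hW : IsBand H W I) {s : ℝ} :
    IsPreconnected (W ∩ H ⁻¹' {s}) := by
  refine isPreconnected_of_forall_pair fun x hx y hy => ?_
  have hpc : IsPathConnected W :=
    hW.isOpen.isConnected_iff_isPathConnected.1 ⟨⟨x, hx.1⟩, hW.isPreconnected⟩
  obtain ⟨γ, hγ⟩ := hpc.joinedIn x hx.1 y hy.1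
  have hcH : Continuous fun t => H (γ t) := hH.continuous.comp γ.continuous
  obtain ⟨t₀, -, ht₀⟩ := isCompact_univ.exists_isMinOn univ_nonempty hcH.continuousOn
  obtain ⟨t₁, -, ht₁⟩ := isCompact_univ.exists_isMaxOn univ_nonempty hcH.continuousOn
  have hmem : ∀ t, H (γ t) ∈ Icc (H (γ t₀)) (H (γ t₁)) := fun t =>
    ⟨ht₀ (mem_univ t), ht₁ (mem_univ t)⟩
  have hab : Icc (H (γ t₀)) (H (γ t₁)) ⊆ I :=
    hW.ordConnected.out (hW.mem_levels _ (hγ _)) (hW.mem_levels _ (hγ _))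
  have hsm : s ∈ Icc (H (γ t₀)) (H (γ t₁)) := by
    have := hmem 0
    rwa [γ.source, show H x = s from hx.2] at this
  obtain ⟨Φ, h0, hc, hm1, hm2, hm3⟩ := exists_ascending_flow hH (hW.isCompact _ _ hab)
    (fun x hx => hW.gradient_ne x hx.1)
  have key : ∀ w ∈ W, H w ∈ Icc (H (γ t₀)) (H (γ t₁)) → Φ (s - H w) w ∈ W ∩ H ⁻¹' {s} := by
    intro w hw hwm
    have hHm : ∀ r ∈ uIcc 0 (s - H w), H (Φ r w) ∈ Icc (H (γ t₀)) (H (γ t₁)) := by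
      intro r hr
      have h1 := hm1 w
      have h2 := hm2 w
      rcases le_total 0 (s - H w) with hle | hle
      · rw [uIcc_of_le hle] at hr
        have e1 := h1 hr.1
        have e2 := h2 hr.1
        simp only [h0] at e1 e2
        exact ⟨by linarith [hwm.1], by linarith [hsm.2, hr.2]⟩
      · rw [uIcc_of_ge hle] at hr
        have e1 := h1 hr.2
        have e2 := h2 hr.2
        simp only [h0] at e1 e2
        exact ⟨by linarith [hsm.1, hr.1], by linarith [hwm.2]⟩
    have hcw : Continuous fun r => Φ r w := hc.comp (by fun_prop : Continuous fun r : ℝ => (r, w))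
    have hsub : (fun r => Φ r w) '' uIcc 0 (s - H w) ⊆ W := by
      refine hW.subset_of_isPreconnected hab
        (isPreconnected_uIcc.image _ hcw.continuousOn) ?_ ⟨w, ⟨0, left_mem_uIcc, h0 w⟩, hw⟩
      rintro _ ⟨r, hr, rfl⟩
      exact hHm r hr
    have hK := hm3 w 0 (s - H w) fun r hr => ⟨hsub (mem_image_of_mem _ hr), hHm r hr⟩
    rw [h0] at hK
    exact ⟨hsub (mem_image_of_mem _ right_mem_uIcc), by
      simp only [mem_preimage, mem_singleton_iff]; linarith⟩
  have hcont : Continuous fun t => Φ (s - H (γ t)) (γ t) :=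
    hc.comp ((continuous_const.sub hcH).prodMk γ.continuous)
  refine ⟨range fun t => Φ (s - H (γ t)) (γ t), ?_, ⟨0, ?_⟩, ⟨1, ?_⟩, isPreconnected_range hcont⟩
  · rintro _ ⟨t, rfl⟩
    exact key _ (hγ t) (hmem t)
  · simp [show H x = s from hx.2, h0]
  · simp [show H y = s from hy.2, h0]

end IsBand

/-! ### The Hamiltonian flow on a level curve -/

theorem gradient_apply (H : Plane → ℝ) (x : Plane) (j : Fin 2) :
    (∇ H x) j = partialDeriv j H x := by
  rw [partialDeriv, ← inner_gradient_left, EuclideanSpace.inner_single_right]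
  simp

theorem drift_eq (H : Plane → ℝ) (x : Plane) : drift H x = !₂[(∇ H x) 1, -(∇ H x) 0] := by
  rw [drift, gradient_apply, gradient_apply]

theorem inner_gradient_drift (H : Plane → ℝ) (x : Plane) : inner ℝ (∇ H x) (drift H x) = 0 := by
  rw [drift_eq, PiLp.inner_apply]
  simp [Fin.sum_univ_two]
  ring

theorem inner_drift_gradient (H : Plane → ℝ) (x : Plane) : inner ℝ (drift H x) (∇ H x) = 0 := by
  rw [real_inner_comm, inner_gradient_drift]

theorem norm_drift (H : Plane → ℝ) (x : Plane) : ‖drift H x‖ = ‖∇ H x‖ := by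
  rw [drift_eq, EuclideanSpace.norm_eq, EuclideanSpace.norm_eq]
  simp [Fin.sum_univ_two, add_comm]

theorem contDiff_drift {H : Plane → ℝ} (hH : ContDiff ℝ 2 H) : ContDiff ℝ 1 (drift H) := by
  have h := contDiff_euclidean.1 (contDiff_gradient hH)
  rw [contDiff_euclidean]
  intro i
  simp only [drift_eq]
  fin_cases i
  · simpa using h 1
  · simpa using (h 0).neg

/-- In the plane, `∇H` and `b` form an orthogonal frame of vectors of equal length. -/
theorem gradient_drift_frame (H : Plane → ℝ) (x w : Plane) :
    inner ℝ (∇ H x) w • ∇ H x + inner ℝ (drift H x) w • drift H x = ‖∇ H x‖ ^ 2 • w := by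
  rw [drift_eq, EuclideanSpace.norm_sq_eq, PiLp.inner_apply, PiLp.inner_apply]
  ext i
  fin_cases i <;> simp [Fin.sum_univ_two] <;> ring

/-- `X` is a complete orbit of the Hamiltonian vector field that stays in `C`. -/
def IsOrbit (H : Plane → ℝ) (C : Set Plane) (X : ℝ → Plane) : Prop :=
  (∀ t, HasDerivAt X (drift H (X t)) t) ∧ ∀ t, X t ∈ C

theorem IsOrbit.shift {H : Plane → ℝ} {C : Set Plane} {X : ℝ → Plane} (hX : IsOrbit H C X)
    (c : ℝ) : IsOrbit H C fun t => X (t + c) :=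
  ⟨fun t => (hX.1 (t + c)).comp_add_const t c, fun _ => hX.2 _⟩

theorem IsOrbit.continuous {H : Plane → ℝ} {C : Set Plane} {X : ℝ → Plane} (hX : IsOrbit H C X) :
    Continuous X :=
  continuous_iff_continuousAt.2 fun t => (hX.1 t).continuousAt

theorem IsOrbit.contDiff {H : Plane → ℝ} (hH : ContDiff ℝ 2 H) {C : Set Plane} {X : ℝ → Plane}
    (hX : IsOrbit H C X) : ContDiff ℝ 1 X := by
  rw [contDiff_one_iff_deriv]
  refine ⟨fun t => (hX.1 t).differentiableAt, ?_⟩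
  rw [show deriv X = fun t => drift H (X t) from funext fun t => (hX.1 t).deriv]
  exact (contDiff_drift hH).continuous.comp hX.continuous

namespace IsBand

variable {H : Plane → ℝ} {W : Set Plane} {I : Set ℝ}

theorem drift_ne (hW : IsBand H W I) {x : Plane} (hx : x ∈ W) : drift H x ≠ 0 := by
  rw [← norm_ne_zero_iff, norm_drift, norm_ne_zero_iff]
  exact hW.gradient_ne x hx

/-- Through every point of a level curve there is exactly one orbit, and it is complete: on the
compact curve the drift can be replaced by a compactly supported field, whose flow preserves
`H`. -/
theorem exists_orbits (hH : ContDiff ℝ 2 H) (hW : IsBand H W I) {s : ℝ} (hs : s ∈ I) :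
    (∀ x ∈ W ∩ H ⁻¹' {s}, ∃ X, IsOrbit H (W ∩ H ⁻¹' {s}) X ∧ X 0 = x) ∧
    ∀ X Y, IsOrbit H (W ∩ H ⁻¹' {s}) X → IsOrbit H (W ∩ H ⁻¹' {s}) Y →
      ∀ t, X t = Y t → X = Y := by
  obtain ⟨η, hη, hηr, hη0⟩ : ∃ η : Plane → ℝ, ContDiff ℝ 1 η ∧ HasCompactSupport η ∧
      ∀ x ∈ W ∩ H ⁻¹' {s}, η x = 1 := by
    have hC := hW.isCompact_level hs
    obtain ⟨R, hR0, hR⟩ := hC.isBounded.subset_closedBall_lt 0 0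
    let f : ContDiffBump (0 : Plane) := ⟨R, R + 1, hR0, by linarith⟩
    exact ⟨f, f.contDiff, f.hasCompactSupport, fun x hx => f.one_of_mem_closedBall (hR hx)⟩
  obtain ⟨Φ, h0, hd, hc, hu⟩ := exists_flow_of_hasCompactSupport (V := fun x => η x • drift H x)
    (hη.smul (contDiff_drift hH)) hηr.smul_right
  constructor
  · intro x hx
    have hHc : ∀ t, H (Φ t x) = s := by
      have hder : ∀ t, HasDerivAt (fun r => H (Φ r x)) 0 t := fun t => by
        have := hasDerivAt_comp_curve (hH.differentiable (by norm_num) _) (hd x t)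
        rwa [real_inner_smul_right, inner_gradient_drift, mul_zero] at this
      intro t
      have := is_const_of_deriv_eq_zero (fun t => (hder t).differentiableAt)
        (fun t => (hder t).deriv) t 0
      simp only [h0] at this
      rw [this]
      exact hx.2
    have hcx : Continuous fun t => Φ t x := hc.comp (by fun_prop : Continuous fun t : ℝ => (t, x))
    have hin : ∀ t, Φ t x ∈ W ∩ H ⁻¹' {s} := fun t =>
      ⟨hW.subset_of_isPreconnected (a := s) (b := s) (by simpa using hs)
        (isPreconnected_range hcx) (by rintro _ ⟨r, rfl⟩; simp [hHc])
        ⟨x, ⟨0, h0 x⟩, hx.1⟩ (mem_range_self t), hHc t⟩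
    refine ⟨fun t => Φ t x, ⟨fun t => ?_, hin⟩, h0 x⟩
    have := hd x t
    simpa only [hη0 _ (hin t), one_smul] using this
  · intro X Y hX hY t ht
    refine hu X Y (fun t => ?_) (fun t => ?_) t ht
    · simpa only [hη0 _ (hX.2 t), one_smul] using hX.1 t
    · simpa only [hη0 _ (hY.2 t), one_smul] using hY.1 t

/-- Near `X t₀`, the level curve consists of the points `X t` with `t` close to `t₀`: the
coordinates `H` and `⟨b(X t₀), ·⟩` are a local diffeomorphism, and the second one is a local
parameter on the orbit. -/
theorem orbit_nhds (hH : ContDiff ℝ 2 H) (hW : IsBand H W I) {s : ℝ}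
    {X : ℝ → Plane} (hX : IsOrbit H (W ∩ H ⁻¹' {s}) X) (t₀ : ℝ) {N : Set ℝ} (hN : N ∈ 𝓝 t₀) :
    ∀ᶠ y in 𝓝 (X t₀), y ∈ W ∩ H ⁻¹' {s} → ∃ t ∈ N, X t = y := by
  set x₀ := X t₀ with hx₀
  set v := drift H x₀ with hv
  have hne : ∇ H x₀ ≠ 0 := hW.gradient_ne _ (hX.2 t₀).1
  have hvne : v ≠ 0 := hW.drift_ne (hX.2 t₀).1
  have hc0 : ‖∇ H x₀‖ ^ 2 ≠ 0 := pow_ne_zero 2 (norm_ne_zero_iff.2 hne)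
  let Θ : Plane → Plane := fun y => H y • ∇ H x₀ + inner ℝ v y • v
  let L : Plane ≃L[ℝ] Plane := ContinuousLinearEquiv.smulLeft (Units.mk0 _ hc0)
  have hΘ : HasStrictFDerivAt Θ (L : Plane →L[ℝ] Plane) x₀ := by
    have h1 : HasStrictFDerivAt H (fderiv ℝ H x₀) x₀ :=
      hH.contDiffAt.hasStrictFDerivAt (by norm_num)
    have h2 : HasStrictFDerivAt (fun y => inner ℝ v y) (innerSL ℝ v) x₀ :=
      (innerSL ℝ v).hasStrictFDerivAt
    have h3 := (h1.smul_const (∇ H x₀)).add (h2.smul_const v)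
    refine h3.congr_fderiv ?_
    ext1 w
    have := gradient_drift_frame H x₀ w
    rw [inner_gradient_left] at this
    simpa [L, hv, Units.smul_def] using this
  have hinj := hΘ.eventually_left_inverse
  have hl : HasStrictDerivAt (fun t => inner ℝ v (X t)) (inner ℝ v v) t₀ := by
    have h1 : HasStrictDerivAt X v t₀ := by
      have := ((hX.contDiff hH).contDiffAt (x := t₀)).hasStrictDerivAt one_ne_zero
      rwa [(hX.1 t₀).deriv] at this
    exact (innerSL ℝ v).hasStrictFDerivAt.comp_hasStrictDerivAt t₀ h1
  have hmap := hl.map_nhds_eq (by simpa using hvne)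
  have hcX : ContinuousAt X t₀ := hX.continuous.continuousAt
  have hN' : ∀ᶠ t in 𝓝 t₀, t ∈ N ∧ hΘ.localInverse Θ L x₀ (Θ (X t)) = X t :=
    (eventually_mem_set.2 hN).and (hcX.eventually hinj)
  have himg : (fun t => inner ℝ v (X t)) ''
      {t | t ∈ N ∧ hΘ.localInverse Θ L x₀ (Θ (X t)) = X t} ∈ 𝓝 (inner ℝ v x₀) := by
    rw [← hmap]
    exact image_mem_map hN'
  have hcin : ContinuousAt (fun y : Plane => inner ℝ v y) x₀ := by fun_prop
  filter_upwards [hinj, hcin himg] with y hy1 hy2 hyC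
  obtain ⟨t, ⟨htN, ht1⟩, ht2⟩ := hy2
  refine ⟨t, htN, ?_⟩
  have : Θ (X t) = Θ y := by
    simp only [Θ]
    simp only at ht2
    rw [ht2, show H (X t) = s from (hX.2 t).2, show H y = s from hyC.2]
  rw [← ht1, this, hy1]

/-- A level curve of a band is a single periodic orbit of the Hamiltonian vector field. -/
theorem exists_periodic_orbit (hH : ContDiff ℝ 2 H) (hW : IsBand H W I) {s : ℝ} (hs : s ∈ I) :
    ∃ (X : ℝ → Plane) (T : ℝ), IsOrbit H (W ∩ H ⁻¹' {s}) X ∧ 0 < T ∧ Function.Periodic X T ∧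
      InjOn X (Ico 0 T) ∧ range X = W ∩ H ⁻¹' {s} ∧
      ∀ t t', X t = X t' → Function.Periodic X (t - t') := by
  obtain ⟨hex, huniq⟩ := hW.exists_orbits hH hs
  obtain ⟨x₀, hx₀⟩ := hW.nonempty s hs
  obtain ⟨X, hX, hX0⟩ := hex x₀ hx₀
  -- Orbits are relatively open in the connected level curve, so there is only one.
  have hrange : range X = W ∩ H ⁻¹' {s} := by
    refine Subset.antisymm (by rintro _ ⟨t, rfl⟩; exact hX.2 t) fun y hy => ?_
    have := (hW.isPreconnected_level hH).induction₂
      (fun x y => ∃ Y, IsOrbit H (W ∩ H ⁻¹' {s}) Y ∧ Y 0 = x ∧ ∃ t, Y t = y) (fun x hx => ?_)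
      ?_ ?_ hx₀ hy
    · obtain ⟨Y, hY, hY0, t, ht⟩ := this
      exact ⟨t, by rw [huniq X Y hX hY 0 (by rw [hX0, hY0]), ht]⟩
    · obtain ⟨Y, hY, hY0⟩ := hex x hx
      have := hW.orbit_nhds hH hY 0 univ_mem
      rw [hY0] at this
      refine eventually_nhdsWithin_iff.2 ?_
      filter_upwards [this] with y hy hyC
      obtain ⟨t, -, ht⟩ := hy hyC
      exact ⟨Y, hY, hY0, t, ht⟩
    · rintro x y z - - - ⟨Y, hY, hY0, t, ht⟩ ⟨Z, hZ, hZ0, t', ht'⟩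
      have : (fun r => Y (r + t)) = Z := huniq _ _ (hY.shift t) hZ 0 (by simp [hZ0, ht])
      exact ⟨Y, hY, hY0, t' + t, by rw [← ht', ← this]⟩
    · rintro x y - - ⟨Y, hY, hY0, t, ht⟩
      exact ⟨fun r => Y (r + t), hY.shift t, by simpa using ht, -t, by simpa using hY0⟩
  have hper : ∀ t t', X t = X t' → Function.Periodic X (t - t') := by
    intro t t' h r
    have := huniq _ _ (hX.shift t) (hX.shift t') 0 (by simpa using h)
    have := congrFun this (r - t')
    simp only [sub_add_cancel] at this
    rw [← this]
    congr 1
    ring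
  let P : AddSubgroup ℝ :=
    { carrier := {c | Function.Periodic X c}
      add_mem' := fun {a b} ha hb => ha.add_period hb
      zero_mem' := fun x => by simp
      neg_mem' := fun {a} ha => ha.neg }
  have hmemP : ∀ c, c ∈ P ↔ Function.Periodic X c := fun c => Iff.rfl
  -- Without a period, `X` would be injective; but the points `X n` accumulate at some `X t₁`, near
  -- which only times close to `t₁` are allowed.
  have hPne : P ≠ ⊥ := by
    intro hbot
    have hzero : ∀ t t', X t = X t' → t = t' := fun t t' h => by
      have : t - t' ∈ P := hper t t' h
      rw [hbot, AddSubgroup.mem_bot] at this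
      linarith
    obtain ⟨x₁, hx₁, hcl⟩ := (hW.isCompact_level hs).exists_mapClusterPt_of_frequently
      (l := atTop) (f := fun n : ℕ => X n) (Frequently.of_forall fun n => hX.2 n)
    rw [← hrange] at hx₁
    obtain ⟨t₁, rfl⟩ := hx₁
    have hn := hW.orbit_nhds hH hX t₁ (Metric.ball_mem_nhds t₁ (by norm_num : (0 : ℝ) < 1 / 4))
    have hfr := hcl.frequently hn
    obtain ⟨n, -, hn1⟩ := frequently_atTop.1 hfr 0
    obtain ⟨k, hk, hk1⟩ := frequently_atTop.1 hfr (n + 1)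
    obtain ⟨a, ha, hae⟩ := hn1 (hX.2 n)
    obtain ⟨b, hb, hbe⟩ := hk1 (hX.2 k)
    have ea := hzero _ _ hae
    have eb := hzero _ _ hbe
    rw [Metric.mem_ball, Real.dist_eq, abs_lt] at ha hb
    have : (n : ℝ) + 1 ≤ k := by exact_mod_cast hk
    linarith [ha.1, ha.2, hb.1, hb.2]
  -- There are no small periods, since the orbit has nonzero speed.
  obtain ⟨a, ha, hdis⟩ : ∃ a : ℝ, 0 < a ∧ Disjoint (P : Set ℝ) (Ioo 0 a) := by
    have h1 := (hX.1 0).eventually_ne (c := X 0) (hW.drift_ne (hX.2 0).1)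
    rw [eventually_nhdsWithin_iff, Metric.eventually_nhds_iff] at h1
    obtain ⟨a, ha, h⟩ := h1
    refine ⟨a, ha, disjoint_left.2 fun c hc hca => ?_⟩
    refine h (y := c) (by simpa [abs_of_pos hca.1] using hca.2) hca.1.ne' ?_
    have := hc 0
    rwa [zero_add] at this
  obtain ⟨T, ⟨hTP, hT0⟩, hTmin⟩ := AddSubgroup.exists_isLeast_pos hPne ha hdis
  refine ⟨X, T, hX, hT0, hTP, ?_, hrange, hper⟩
  have hlt : ∀ t t', t ∈ Ico 0 T → t' ∈ Ico 0 T → X t = X t' → t' ≤ t := by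
    intro t t' ht ht' h
    by_contra! hlt
    have := hTmin (a := t' - t) ⟨hper t' t h.symm, sub_pos.2 hlt⟩
    linarith [ht.1, ht'.2]
  exact fun t ht t' ht' h => le_antisymm (hlt t' t ht' ht h.symm) (hlt t t' ht ht' h)

end IsBand

/-! ### Arc length integrals along an injective curve -/

/-- A curve that expands distances by the factor `c` expands lengths by at least `c`. -/
theorem mul_hausdorffMeasure_le_image {s : Set ℝ} {X : ℝ → Plane} {c : ℝ≥0}
    (h : ∀ a ∈ s, ∀ b ∈ s, c * |a - b| ≤ dist (X a) (X b)) :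
    (c : ENNReal) * volume s ≤ Measure.hausdorffMeasure 1 (X '' s) := by
  rcases eq_or_ne c 0 with rfl | hc
  · simp
  have hc0 : (0 : ℝ) < c := by positivity
  have hinj : InjOn X s := fun a ha b hb hab => by
    have := h a ha b hb
    rw [hab, dist_self] at this
    have h2 : |a - b| ≤ 0 := nonpos_of_mul_nonpos_right this hc0
    linarith [abs_nonpos_iff.1 h2]
  have hlip : LipschitzOnWith c⁻¹ (Function.invFunOn X s) (X '' s) := by
    refine LipschitzOnWith.of_dist_le_mul ?_
    rintro _ ⟨a, ha, rfl⟩ _ ⟨b, hb, rfl⟩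
    rw [hinj.leftInvOn_invFunOn ha, hinj.leftInvOn_invFunOn hb, NNReal.coe_inv, Real.dist_eq,
      inv_mul_eq_div, le_div_iff₀ hc0]
    linarith [h a ha b hb]
  have := hlip.hausdorffMeasure_image_le (d := 1) zero_le_one
  rw [hinj.leftInvOn_invFunOn.image_image, hausdorffMeasure_real, ENNReal.rpow_one] at this
  calc (c : ENNReal) * volume s ≤ c * ((c⁻¹ : ℝ≥0) * Measure.hausdorffMeasure 1 (X '' s)) := by
        gcongr
    _ = Measure.hausdorffMeasure 1 (X '' s) := by
        rw [← mul_assoc, ← ENNReal.coe_mul, mul_inv_cancel₀ hc, ENNReal.coe_one, one_mul]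

/-- The metric density of a `C¹` curve is its speed. -/
theorem tendsto_hausdorffMeasure_image_div {X : ℝ → Plane} {v : Plane} {t₀ : ℝ}
    (hX : HasStrictDerivAt X v t₀) {S : Set ℝ} (hS : S ∈ 𝓝 t₀) :
    Tendsto (fun r => Measure.hausdorffMeasure 1 (X '' (Metric.closedBall t₀ r ∩ S)) /
      volume (Metric.closedBall t₀ r)) (𝓝[>] 0) (𝓝 (‖v‖₊ : ENNReal)) := by
  have hball : ∀ U ∈ 𝓝 t₀, ∀ᶠ r in 𝓝[>] (0 : ℝ), 0 < r ∧ Metric.closedBall t₀ r ⊆ U := by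
    intro U hU
    obtain ⟨ρ, hρ, hρU⟩ := Metric.nhds_basis_closedBall.mem_iff.1 hU
    filter_upwards [Ioc_mem_nhdsGT hρ] with r hr
    exact ⟨hr.1, (Metric.closedBall_subset_closedBall hr.2).trans hρU⟩
  have hup : ∀ K : ℝ≥0, ‖v‖₊ < K → ∀ᶠ r in 𝓝[>] (0 : ℝ),
      Measure.hausdorffMeasure 1 (X '' (Metric.closedBall t₀ r ∩ S)) /
        volume (Metric.closedBall t₀ r) ≤ K := by
    intro K hK
    obtain ⟨U, hU, hlip⟩ := hX.hasStrictFDerivAt.exists_lipschitzOnWith_of_nnnorm_lt K (by simpa)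
    filter_upwards [hball U hU] with r hr
    refine ENNReal.div_le_of_le_mul ?_
    have := (hlip.mono (inter_subset_left.trans hr.2 :
      Metric.closedBall t₀ r ∩ S ⊆ U)).hausdorffMeasure_image_le (d := 1) zero_le_one
    rw [hausdorffMeasure_real, ENNReal.rpow_one] at this
    exact this.trans (by gcongr; exact inter_subset_left)
  have hlow : ∀ c : ℝ≥0, c < ‖v‖₊ → ∀ᶠ r in 𝓝[>] (0 : ℝ), (c : ENNReal) ≤
      Measure.hausdorffMeasure 1 (X '' (Metric.closedBall t₀ r ∩ S)) /
        volume (Metric.closedBall t₀ r) := by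
    intro c hc
    obtain ⟨U, hU, happ⟩ := hX.hasStrictFDerivAt.approximates_deriv_on_nhds
      (c := ‖v‖₊ - c) (Or.inr (tsub_pos_of_lt hc))
    filter_upwards [hball (U ∩ S) (inter_mem hU hS)] with r hr
    rw [inter_eq_left.2 (hr.2.trans inter_subset_right)]
    have hvol : volume (Metric.closedBall t₀ r) = ENNReal.ofReal (2 * r) := Real.volume_closedBall t₀ r
    rw [ENNReal.le_div_iff_mul_le (Or.inl (by rw [hvol]; simp [hr.1]))
      (Or.inl (by rw [hvol]; exact ENNReal.ofReal_ne_top))]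
    refine mul_hausdorffMeasure_le_image fun a ha b hb => ?_
    have h1 := happ a (hr.2 ha).1 b (hr.2 hb).1
    have h2 : ‖(a - b) • v‖ - ‖X a - X b - (a - b) • v‖ ≤ ‖X a - X b‖ := by
      have := norm_sub_norm_le ((a - b) • v) (-(X a - X b - (a - b) • v))
      rwa [norm_neg, sub_neg_eq_add, add_sub_cancel] at this
    rw [ContinuousLinearMap.toSpanSingleton_apply] at h1
    rw [NNReal.coe_sub hc.le, coe_nnnorm, Real.norm_eq_abs] at h1
    rw [norm_smul, Real.norm_eq_abs] at h2
    rw [dist_eq_norm]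
    linarith
  rw [tendsto_order]
  constructor
  · intro a ha
    obtain ⟨c, hac, hcv⟩ := ENNReal.lt_iff_exists_nnreal_btwn.1 ha
    filter_upwards [hlow c (by exact_mod_cast hcv)] with r hr
    exact hac.trans_le hr
  · intro a ha
    obtain ⟨c, hvc, hca⟩ := ENNReal.lt_iff_exists_nnreal_btwn.1 ha
    filter_upwards [hup c (by exact_mod_cast hvc)] with r hr
    exact hr.trans_lt hca

/-- The arc length integral (with respect to the one-dimensional Hausdorff measure) along a `C¹`
curve, injective on a fundamental interval. -/
theorem setIntegral_hausdorffMeasure_curve {X X' : ℝ → Plane} (hX : ∀ t, HasDerivAt X (X' t) t)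
    (hX' : Continuous X') {L : ℝ≥0} (hL : ∀ t, ‖X' t‖₊ ≤ L) {T : ℝ} (hT : 0 < T)
    (hinj : InjOn X (Ico 0 T)) (f : Plane → ℝ) :
    ∫ x in X '' Ico 0 T, f x ∂(Measure.hausdorffMeasure 1) =
      ∫ t in (0 : ℝ)..T, ‖X' t‖ * f (X t) := by
  set S : Set ℝ := Ico 0 T with hSdef
  have hSm : MeasurableSet S := measurableSet_Ico
  have hcX : Continuous X := continuous_iff_continuousAt.2 fun t => (hX t).continuousAt
  have hstrict : ∀ t, HasStrictDerivAt X (X' t) t := fun t =>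
    hasStrictDerivAt_of_hasDerivAt_of_continuousAt (Eventually.of_forall hX) hX'.continuousAt
  have hlip : LipschitzOnWith L X univ :=
    convex_univ.lipschitzOnWith_of_nnnorm_hasDerivWithin_le
      (fun t _ => (hX t).hasDerivWithinAt) (fun t _ => hL t)
  have hemb := hcX.continuousOn.measurableEmbedding hSm hinj
  have hval := MeasurableEmbedding.subtype_coe hSm
  -- The pullback `m` of the arc length is absolutely continuous, and its density is computed by
  -- differentiation of measures.
  set m' := Measure.comap (S.domRestrict X) (Measure.hausdorffMeasure 1) with hm'
  set m : Measure ℝ := m'.map Subtype.val with hm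
  have hmA : ∀ A, m A = Measure.hausdorffMeasure 1 (X '' (A ∩ S)) := by
    intro A
    rw [hm, hval.map_apply, hm', hemb.comap_apply]
    congr 1
    ext y
    simp only [mem_image, mem_preimage, Subtype.exists, domRestrict_apply, mem_inter_iff]
    grind
  have hle : ∀ A, m A ≤ L * volume (A ∩ S) := fun A => by
    rw [hmA]
    have := (hlip.mono (subset_univ (A ∩ S))).hausdorffMeasure_image_le (d := 1) zero_le_one
    rwa [hausdorffMeasure_real, ENNReal.rpow_one] at this
  have hfin : IsFiniteMeasure m := ⟨by
    refine (hle univ).trans_lt (ENNReal.mul_lt_top ENNReal.coe_lt_top ?_)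
    rw [univ_inter, hSdef, Real.volume_Ico]
    exact ENNReal.ofReal_lt_top⟩
  have hac : m ≪ volume := fun A hA => by
    have := hle A
    rw [measure_mono_null inter_subset_left hA, mul_zero] at this
    exact le_antisymm this bot_le
  have hrn : m.rnDeriv volume =ᵐ[volume] S.indicator fun t => (‖X' t‖₊ : ENNReal) := by
    have hb : ∀ᵐ t : ℝ, t ≠ 0 ∧ t ≠ T := by
      refine (Countable.ae_notMem (s := {0, T}) (by simp) volume).mono fun t ht => ?_
      simpa using ht
    filter_upwards [Besicovitch.ae_tendsto_rnDeriv m volume, hb] with t ht htb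
    refine tendsto_nhds_unique ht ?_
    by_cases htS : t ∈ S
    · have hn : S ∈ 𝓝 t := Ico_mem_nhds (lt_of_le_of_ne htS.1 htb.1.symm) htS.2
      rw [indicator_of_mem htS]
      simp only [hmA]
      exact tendsto_hausdorffMeasure_image_div (hstrict t) hn
    · have hn : (Icc 0 T)ᶜ ∈ 𝓝 t := isClosed_Icc.isOpen_compl.mem_nhds fun h =>
        htS ⟨h.1, lt_of_le_of_ne h.2 htb.2⟩
      rw [indicator_of_notMem htS]
      refine tendsto_const_nhds.congr' ?_
      obtain ⟨ρ, hρ, hρU⟩ := Metric.nhds_basis_closedBall.mem_iff.1 hn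
      filter_upwards [Ioc_mem_nhdsGT hρ] with r hr
      have : Metric.closedBall t r ∩ S = ∅ := eq_empty_of_forall_notMem fun y hy =>
        hρU (Metric.closedBall_subset_closedBall hr.2 hy.1) ⟨hy.2.1, hy.2.2.le⟩
      rw [hmA, this]
      simp
  have hmeq : m = (volume.restrict S).withDensity fun t => (‖X' t‖₊ : ENNReal) := by
    rw [← Measure.withDensity_rnDeriv_eq m volume hac, withDensity_congr_ae hrn,
      withDensity_indicator hSm]
  have himage : X '' S = range (S.domRestrict X) := (range_domRestrict X S).symm
  rw [himage, ← hemb.map_comap, hemb.integral_map, ← hm']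
  calc ∫ t, f (S.domRestrict X t) ∂m' = ∫ t, f (X t) ∂m := by
        rw [hm, hval.integral_map]
        rfl
    _ = ∫ t in S, ‖X' t‖ * f (X t) := by
        rw [hmeq, integral_withDensity_eq_integral_smul hX'.nnnorm.measurable]
        rfl
    _ = ∫ t in (0 : ℝ)..T, ‖X' t‖ * f (X t) := by
        rw [intervalIntegral.integral_of_le hT.le, hSdef, integral_Ico_eq_integral_Ioc]

/-! ### The cell problem on a level curve -/

namespace IsBand

variable {H : Plane → ℝ} {W : Set Plane} {I : Set ℝ}

/-- Weighted arc length integrals along a level curve are time integrals along the orbit. -/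
theorem exists_orbit_integral (hH : ContDiff ℝ 2 H) (hW : IsBand H W I) {s : ℝ} (hs : s ∈ I) :
    ∃ (X : ℝ → Plane) (T : ℝ), IsOrbit H (W ∩ H ⁻¹' {s}) X ∧ 0 < T ∧ Function.Periodic X T ∧
      range X = W ∩ H ⁻¹' {s} ∧ (∀ t t', X t = X t' → Function.Periodic X (t - t')) ∧
      ∀ f : Plane → ℝ, ∫ x in W ∩ H ⁻¹' {s}, f x / ‖∇ H x‖ ∂(Measure.hausdorffMeasure 1) =
        ∫ t in (0 : ℝ)..T, f (X t) := by
  obtain ⟨X, T, hX, hT, hper, hinj, hran, hall⟩ := hW.exists_periodic_orbit hH hs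
  refine ⟨X, T, hX, hT, hper, hran, hall, fun f => ?_⟩
  have hcd : Continuous (drift H) := (contDiff_drift hH).continuous
  obtain ⟨L, hL⟩ := (hW.isCompact_level hs).exists_bound_of_continuousOn hcd.continuousOn
  have himg : X '' Ico 0 T = W ∩ H ⁻¹' {s} := by
    rw [← hran]
    refine Subset.antisymm (image_subset_range X _) ?_
    rintro _ ⟨t, rfl⟩
    obtain ⟨r, hr, hre⟩ := hper.exists_mem_Ico₀ hT t
    exact ⟨r, hr, hre.symm⟩
  rw [← himg, setIntegral_hausdorffMeasure_curve hX.1 (hcd.comp hX.continuous) (L := L.toNNReal)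
    (fun t => by
      rw [← NNReal.coe_le_coe, coe_nnnorm]
      exact (hL _ (hX.2 t)).trans (Real.le_coe_toNNReal L)) hT hinj]
  refine intervalIntegral.integral_congr fun t _ => ?_
  have : ‖∇ H (X t)‖ ≠ 0 := norm_ne_zero_iff.2 (hW.gradient_ne _ (hX.2 t).1)
  simp only [norm_drift]
  field_simp

/-- A `C¹` function of time along the orbit, compatible with the period, extends to a `C¹`
function on the plane. -/
theorem exists_contDiff_extension (hH : ContDiff ℝ 2 H) (hW : IsBand H W I) {s : ℝ} (hs : s ∈ I)
    {X : ℝ → Plane} (hX : IsOrbit H (W ∩ H ⁻¹' {s}) X) (hran : range X = W ∩ H ⁻¹' {s})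
    {F : ℝ → ℝ} (hF : ContDiff ℝ 1 F) (hFX : ∀ t t', X t = X t' → F t = F t') :
    ∃ ψ : Plane → ℝ, ContDiff ℝ 1 ψ ∧ ∀ t, ψ (X t) = F t := by
  -- A partition of unity glues local extensions, because prescribing the values on the orbit is a
  -- convex condition; the local extensions use `⟨b(X t₀), ·⟩` as a coordinate.
  have hconv : ∀ x, Convex ℝ {r : ℝ | ∀ t, X t = x → F t = r} := by
    intro x
    by_cases hx : ∃ t, X t = x
    · obtain ⟨t, ht⟩ := hx
      exact Set.Subsingleton.convex fun a ha b hb => by rw [← ha t ht, ← hb t ht]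
    · have : {r : ℝ | ∀ t, X t = x → F t = r} = univ :=
        eq_univ_of_forall fun r t ht => absurd ⟨t, ht⟩ hx
      rw [this]
      exact convex_univ
  have hloc : ∀ x : Plane, ∃ U ∈ 𝓝 x, ∃ g : Plane → ℝ,
      ContMDiffOn (modelWithCornersSelf ℝ Plane) (modelWithCornersSelf ℝ ℝ) ((1 : ℕ∞) : WithTop ℕ∞)
        g U ∧ ∀ y ∈ U, g y ∈ {r : ℝ | ∀ t, X t = y → F t = r} := by
    intro x
    by_cases hx : x ∈ W ∩ H ⁻¹' {s}
    · rw [← hran] at hx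
      obtain ⟨t₀, rfl⟩ := hx
      set v := drift H (X t₀) with hv
      have hvne : v ≠ 0 := hW.drift_ne (hX.2 t₀).1
      have hvv : (inner ℝ v v : ℝ) ≠ 0 := by simpa using hvne
      have hlc : ContDiffAt ℝ 1 (fun t => (inner ℝ v (X t) : ℝ)) t₀ :=
        ((innerSL ℝ v).contDiff.comp (hX.contDiff hH)).contDiffAt
      let e : ℝ ≃L[ℝ] ℝ := ContinuousLinearEquiv.unitsEquivAut ℝ (Units.mk0 _ hvv)
      have hld : HasFDerivAt (fun t => (inner ℝ v (X t) : ℝ)) (e : ℝ →L[ℝ] ℝ) t₀ := by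
        have h1 : HasDerivAt (fun t => (inner ℝ v (X t) : ℝ)) (inner ℝ v v) t₀ :=
          (innerSL ℝ v).hasFDerivAt.comp_hasDerivAt t₀ (hX.1 t₀)
        refine h1.hasFDerivAt.congr_fderiv ?_
        ext
        simp [e]
      set σ := hlc.localInverse hld one_ne_zero with hσ
      have hσc : ContDiffAt ℝ 1 σ (inner ℝ v (X t₀)) := hlc.to_localInverse hld one_ne_zero
      have hσi : ∀ᶠ t in 𝓝 t₀, σ (inner ℝ v (X t)) = t :=
        (hlc.hasStrictFDerivAt' hld one_ne_zero).eventually_left_inverse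
      have hg : ContDiffAt ℝ 1 (fun y : Plane => F (σ (inner ℝ v y))) (X t₀) :=
        hF.contDiffAt.comp _ (ContDiffAt.comp (X t₀) hσc (innerSL ℝ v).contDiff.contDiffAt)
      obtain ⟨U, hU, hUc⟩ := hg.contDiffOn le_rfl (by simp)
      have hnear := hW.orbit_nhds hH hX t₀ hσi
      refine ⟨_, inter_mem hU hnear, _, contMDiffOn_iff_contDiffOn.2 (hUc.mono inter_subset_left), ?_⟩
      rintro y ⟨-, hy⟩ t' rfl
      obtain ⟨t, ht, hte⟩ := hy (hX.2 t')
      simp only [mem_ofPred_eq] at ht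
      rw [← hte, ht]
      exact hFX t' t hte.symm
    · refine ⟨_, (hW.isCompact_level hs).isClosed.isOpen_compl.mem_nhds hx, fun _ => 0,
        contMDiffOn_const, fun y hy t ht => ?_⟩
      exact absurd (ht ▸ hX.2 t) hy
  obtain ⟨ψ, hψ⟩ := exists_contMDiffMap_forall_mem_convex_of_local
    (modelWithCornersSelf ℝ Plane) (n := 1) hconv hloc
  exact ⟨ψ, contMDiff_iff_contDiff.1 ψ.contMDiff, fun t => (hψ (X t) t rfl).symm⟩

/-- The cell problem: along a level curve, a continuous function differs from its mean (with
respect to `dl / |∇H|`) by the derivative of a `C¹` function in the direction of the drift. -/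
theorem exists_corrector (hH : ContDiff ℝ 2 H) (hW : IsBand H W I) {s : ℝ} (hs : s ∈ I)
    {f : Plane → ℝ} (hf : ContinuousOn f (W ∩ H ⁻¹' {s})) :
    ∃ ψ : Plane → ℝ, ContDiff ℝ 1 ψ ∧ ∀ x ∈ W ∩ H ⁻¹' {s}, inner ℝ (drift H x) (∇ ψ x) = f x -
      1 / (∫ x in W ∩ H ⁻¹' {s}, 1 / ‖∇ H x‖ ∂(Measure.hausdorffMeasure 1)) *
        ∫ x in W ∩ H ⁻¹' {s}, f x / ‖∇ H x‖ ∂(Measure.hausdorffMeasure 1) := by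
  obtain ⟨X, T, hX, hT, hper, hran, hall, hint⟩ := hW.exists_orbit_integral hH hs
  rw [hint f, hint fun _ => 1]
  simp only [intervalIntegral.integral_const, smul_eq_mul, mul_one, sub_zero]
  set a := 1 / T * ∫ t in (0 : ℝ)..T, f (X t) with ha
  have hc : Continuous fun t => f (X t) - a :=
    (hf.comp_continuous hX.continuous hX.2).sub continuous_const
  set F : ℝ → ℝ := fun t => ∫ r in (0 : ℝ)..t, (f (X r) - a) with hFdef
  have hFd : ∀ t, HasDerivAt F (f (X t) - a) t := fun t =>
    (hc.integral_hasStrictDerivAt 0 t).hasDerivAt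
  have hF : ContDiff ℝ 1 F := by
    rw [contDiff_one_iff_deriv, funext fun t => (hFd t).deriv]
    exact ⟨fun t => (hFd t).differentiableAt, hc⟩
  have hFper : ∀ c, Function.Periodic X c → ∀ t, F (t + c) - F t = F c - F 0 := by
    intro c hcp t
    have hder : ∀ t, HasDerivAt (fun t => F (t + c) - F t) 0 t := fun t => by
      have := ((hFd (t + c)).comp_add_const t c).sub (hFd t)
      rwa [hcp t, sub_self] at this
    have := is_const_of_deriv_eq_zero (fun t => (hder t).differentiableAt)
        (fun t => (hder t).deriv) t 0
    simpa using this
  have hF0 : F 0 = 0 := by simp [hFdef]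
  have hFT : F T = 0 := by
    have hi : IntervalIntegrable (fun t => f (X t)) volume 0 T :=
      (hf.comp_continuous hX.continuous hX.2).intervalIntegrable 0 T
    simp only [hFdef]
    rw [intervalIntegral.integral_sub hi (by simp)]
    simp only [intervalIntegral.integral_const, smul_eq_mul, sub_zero, ha]
    field_simp
    ring
  -- `F` is bounded, being continuous and `T`-periodic, so its increment over any period vanishes.
  have hFzero : ∀ c, Function.Periodic X c → F c = 0 := by
    have hFT' : Function.Periodic F T := fun t => by
      have := hFper T hper t
      rw [hFT, hF0] at this
      linarith
    obtain ⟨M, hM⟩ := isCompact_Icc.exists_bound_of_continuousOn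
      (s := Icc 0 T) hF.continuous.continuousOn
    have hMall : ∀ t, |F t| ≤ M := fun t => by
      obtain ⟨y, hy, hye⟩ := hFT'.exists_mem_Ico₀ hT t
      rw [hye]
      exact hM y ⟨hy.1, hy.2.le⟩
    intro c hcp
    have hmul : ∀ n : ℕ, F (n * c) = n * F c := by
      intro n
      induction n with
      | zero => simp [hF0]
      | succ n ih =>
        have := hFper c hcp (n * c)
        rw [hF0] at this
        push_cast
        rw [add_mul, one_mul]
        linarith
    by_contra hne
    obtain ⟨n, hn⟩ := exists_nat_gt (M / |F c|)
    rw [div_lt_iff₀ (abs_pos.2 hne)] at hn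
    have := hMall (n * c)
    rw [hmul, abs_mul, Nat.abs_cast] at this
    linarith
  obtain ⟨ψ, hψ, hψX⟩ := hW.exists_contDiff_extension hH hs hX hran hF (fun t t' h => by
    have h1 := hall t t' h
    have := hFper _ h1 t'
    rw [hFzero _ h1, hF0] at this
    simp only [add_sub_cancel] at this
    linarith)
  refine ⟨ψ, hψ, fun x hx => ?_⟩
  rw [← hran] at hx
  obtain ⟨t, rfl⟩ := hx
  have h1 := hasDerivAt_comp_curve (hψ.differentiable one_ne_zero _) (hX.1 t)
  rw [funext hψX] at h1
  rw [real_inner_comm]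
  exact h1.unique (hFd t)

end IsBand

/-! ### Critical points and the components of the sublevel set -/

theorem gradient_eq_zero_of_isLocalMin {H : Plane → ℝ} {x : Plane} (h : IsLocalMin H x) :
    ∇ H x = 0 := by
  simp [gradient, h.fderiv_eq_zero]

theorem gradient_eq_zero_of_isLocalMax {H : Plane → ℝ} {x : Plane} (h : IsLocalMax H x) :
    ∇ H x = 0 := by
  simp [gradient, h.fderiv_eq_zero]

theorem isCompact_sublevel {H : Plane → ℝ} (hH : CondH1 H) (a : ℝ) : IsCompact {x | H x ≤ a} := by
  obtain ⟨t, ht, hta⟩ := mem_cocompact.1 (hH.2.eventually_gt_atTop a)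
  refine ht.of_isClosed_subset (isClosed_le hH.1.continuous continuous_const) fun x hx => ?_
  by_contra hxt
  have : a < H x := hta hxt
  exact absurd hx (not_le.2 this)

/-- A connected component of `F` is relatively closed in `F`. -/
theorem closure_connectedComponentIn_inter {X : Type*} [TopologicalSpace X] {F : Set X} {x : X}
    (hx : x ∈ F) : closure (connectedComponentIn F x) ∩ F ⊆ connectedComponentIn F x := by
  have h1 : connectedComponentIn F x ⊆ closure (connectedComponentIn F x) ∩ F :=
    subset_inter subset_closure (connectedComponentIn_subset F x)
  exact (isPreconnected_connectedComponentIn.subset_closure h1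
    inter_subset_left).subset_connectedComponentIn (h1 (mem_connectedComponentIn hx))
    inter_subset_right

theorem one_lt_rank_plane : 1 < Module.rank ℝ Plane := by
  rw [← Module.finrank_eq_rank, finrank_euclideanSpace_fin]
  norm_num

/-- Removing a point from an open connected subset of the plane leaves it connected. -/
theorem isPreconnected_diff_singleton {D : Set Plane} (hD : IsOpen D) (hc : IsPreconnected D)
    (p : Plane) : IsPreconnected (D \ {p}) := by
  by_cases hp : p ∈ D
  swap
  · rwa [sdiff_singleton_eq_self hp]
  obtain ⟨r, hr, hrD⟩ := Metric.isOpen_iff.1 hD p hp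
  -- A punctured disc is the continuous image of the product of a circle and an interval.
  have hB : IsPreconnected (Metric.ball p r \ {p}) := by
    have himg : Metric.ball p r \ {p} =
        (fun q : Plane × ℝ => p + q.2 • q.1) '' (Metric.sphere 0 1 ×ˢ Ioo 0 r) := by
      ext y
      constructor
      · rintro ⟨hy, hyp⟩
        have hne : ‖y - p‖ ≠ 0 := norm_ne_zero_iff.2 (sub_ne_zero.2 hyp)
        refine ⟨(‖y - p‖⁻¹ • (y - p), ‖y - p‖), ⟨?_, ?_, ?_⟩, ?_⟩
        · simp [norm_smul, hne]
        · exact lt_of_le_of_ne (norm_nonneg _) hne.symm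
        · rwa [← dist_eq_norm]
        · simp [smul_smul, hne]
      · rintro ⟨⟨w, t⟩, ⟨hw, ht0, htr⟩, rfl⟩
        have hw1 : ‖w‖ = 1 := by simpa using hw
        refine ⟨?_, ?_⟩
        · simpa [norm_smul, hw1, abs_of_pos ht0] using htr
        · simp only [mem_singleton_iff, add_eq_left, smul_eq_zero, not_or]
          exact ⟨ht0.ne', fun h => by simp [h] at hw1⟩
    rw [himg]
    exact ((isPreconnected_sphere one_lt_rank_plane 0 1).prod isPreconnected_Ioo).image _
      (by fun_prop)
  have hBD : Metric.ball p r \ {p} ⊆ D \ {p} := sdiff_subset_sdiff_left hrD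
  -- If a separation of `D \ {p}` has the punctured disc on one side, filling in the centre gives
  -- a separation of `D`.
  have key : ∀ u v : Set Plane, IsOpen u → IsOpen v → D \ {p} ⊆ u ∪ v →
      (D \ {p}) ∩ (u ∩ v) = ∅ → Metric.ball p r \ {p} ⊆ u → D \ {p} ⊆ u ∨ D \ {p} ⊆ v := by
    intro u v hu hv huv hdis hBu
    have hv' : IsOpen (v ∩ {p}ᶜ) := hv.inter isOpen_compl_singleton
    have hcov : D ⊆ (u ∪ Metric.ball p r) ∪ (v ∩ {p}ᶜ) := by
      intro y hy
      by_cases hyp : y = p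
      · exact Or.inl (Or.inr (by rw [hyp]; exact Metric.mem_ball_self hr))
      · rcases huv ⟨hy, hyp⟩ with h | h
        · exact Or.inl (Or.inl h)
        · exact Or.inr ⟨h, hyp⟩
    have hdis' : D ∩ ((u ∪ Metric.ball p r) ∩ (v ∩ {p}ᶜ)) = ∅ := by
      refine eq_empty_of_forall_notMem ?_
      rintro y ⟨hyD, hyu, hyv, hyp⟩
      have hyu' : y ∈ u := hyu.elim id fun h => hBu ⟨h, hyp⟩
      exact (hdis.subset ⟨⟨hyD, hyp⟩, hyu', hyv⟩ : y ∈ (∅ : Set Plane))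
    rcases isPreconnected_iff_subset_of_disjoint.1 hc _ _ (hu.union Metric.isOpen_ball) hv' hcov
      hdis' with h | h
    · left
      rintro y ⟨hy, hyp⟩
      exact (h hy).elim id fun h => hBu ⟨h, hyp⟩
    · exact Or.inr fun y hy => (h hy.1).1
  rw [isPreconnected_iff_subset_of_disjoint]
  intro u v hu hv huv hdis
  rcases isPreconnected_iff_subset_of_disjoint.1 hB u v hu hv (hBD.trans huv)
    (subset_empty_iff.1 ((inter_subset_inter_left _ hBD).trans hdis.subset)) with h | h
  · exact key u v hu hv huv hdis h
  · exact (key v u hv hu (by rwa [union_comm]) (by rwa [inter_comm v u]) h).symm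

section Critical

variable {N : ℕ} [NeZero N] {H : Plane → ℝ} {z : Fin N → Plane} {h : Fin N → ℝ}

theorem exists_eq_of_gradient_eq_zero (hH2 : CondH2 H z) {x : Plane} (hx : ∇ H x = 0) :
    ∃ k, z k = x := by
  have : x ∈ {x | ∇ H x = 0} := hx
  rwa [hH2.2.1] at this

theorem apply_crit_lt (hlev : CondLevels H z h) {k : Fin N} (hk : k ≠ 0) : H (z k) < 0 :=
  (hlev.2 k hk).1.trans (hlev.2 k hk).2

theorem apply_crit_zero (hH2 : CondH2 H z) : H (z 0) = 0 := by
  rw [hH2.2.2.2.1, hH2.2.2.2.2]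

/-- Around the minimum points there are pairwise disjoint potential wells, separated from the rest
of the plane by a potential barrier. -/
theorem exists_wells (hH1 : CondH1 H) (hH2 : CondH2 H z) :
    ∃ r δ : Fin N → ℝ, (∀ k, k ≠ 0 → 0 < r k ∧ 0 < δ k ∧
      ∀ x ∈ Metric.sphere (z k) (r k), H (z k) + δ k ≤ H x) ∧
      ∀ k l, k ≠ l → Disjoint (Metric.ball (z k) (r k)) (Metric.ball (z l) (r l)) := by
  obtain ⟨U, hU, hdis⟩ := (finite_range z).t2_separation
  have hr : ∀ k : Fin N, ∃ r > 0, Metric.closedBall (z k) r ⊆ U (z k) ∧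
      (k ≠ 0 → ∀ x ∈ Metric.ball (z k) (2 * r), H (z k) ≤ H x) := by
    intro k
    obtain ⟨r₁, hr₁, h₁⟩ := Metric.nhds_basis_closedBall.mem_iff.1
      ((hU (z k)).2.mem_nhds (hU (z k)).1)
    by_cases hk : k = 0
    · exact ⟨r₁, hr₁, h₁, fun h => absurd hk h⟩
    · obtain ⟨r₂, hr₂, h₂⟩ := Metric.eventually_nhds_iff_ball.1 (hH2.2.2.1 k hk)
      refine ⟨min r₁ (r₂ / 2), by positivity,
        (Metric.closedBall_subset_closedBall (min_le_left _ _)).trans h₁, fun _ x hx => h₂ x ?_⟩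
      exact Metric.ball_subset_ball (by linarith [min_le_right r₁ (r₂ / 2)]) hx
  choose r hr0 hrU hrmin using hr
  have hδ : ∀ k : Fin N, ∃ δ : ℝ, k ≠ 0 → 0 < δ ∧
      ∀ x ∈ Metric.sphere (z k) (r k), H (z k) + δ ≤ H x := by
    intro k
    by_cases hk : k = 0
    · exact ⟨0, fun h => absurd hk h⟩
    obtain ⟨y, hy, hmin⟩ := (isCompact_sphere (z k) (r k)).exists_isMinOn
      ((NormedSpace.sphere_nonempty (E := Plane)).2 (hr0 k).le) hH1.1.continuous.continuousOn
    refine ⟨H y - H (z k), fun _ => ⟨?_, fun x hx => ?_⟩⟩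
    · have hyball : y ∈ Metric.ball (z k) (2 * r k) := by
        rw [Metric.mem_ball, Metric.mem_sphere.1 hy]
        linarith [hr0 k]
      have hle := hrmin k hk y hyball
      refine sub_pos.2 (lt_of_le_of_ne hle fun heq => ?_)
      -- A point of the sphere at the same level would be another critical point.
      have hloc : IsLocalMin H y := by
        filter_upwards [Metric.isOpen_ball.mem_nhds hyball] with x hx
        rw [← heq]
        exact hrmin k hk x hx
      obtain ⟨l, hl⟩ := exists_eq_of_gradient_eq_zero hH2 (gradient_eq_zero_of_isLocalMin hloc)
      have hne : z l ≠ z k := by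
        intro he
        rw [hl] at he
        rw [he, Metric.mem_sphere, dist_self] at hy
        exact (hr0 k).ne hy
      refine disjoint_left.1 (hdis (mem_range_self l) (mem_range_self k) hne) (hU (z l)).1 ?_
      rw [hl]
      exact hrU k (Metric.sphere_subset_closedBall hy)
    · have := hmin hx
      simp only [mem_ofPred_eq] at this
      linarith
  choose δ hδ using hδ
  refine ⟨r, δ, fun k hk => ⟨hr0 k, hδ k hk⟩, fun k l hkl => ?_⟩
  exact (hdis (mem_range_self k) (mem_range_self l) fun he => hkl (hH2.1 he)).mono
    (Metric.ball_subset_closedBall.trans (hrU k)) (Metric.ball_subset_closedBall.trans (hrU l))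

/-- Different minimum points lie in different components of `{H < 0}`: the gradient flow would
carry a path between them into the disjoint union of the wells. -/
theorem eq_of_mem_connectedComponentIn (hH1 : CondH1 H) (hH2 : CondH2 H z)
    (hlev : CondLevels H z h) {i j : Fin N} (hi : i ≠ 0) (hj : j ≠ 0)
    (hij : z j ∈ connectedComponentIn {x | H x < 0} (z i)) : i = j := by
  by_contra hne
  have hcont := hH1.1.continuous
  have hopen : IsOpen {x | H x < 0} := isOpen_lt hcont continuous_const
  have hzi : z i ∈ {x | H x < 0} := apply_crit_lt hlev hi
  have hpc : IsPathConnected (connectedComponentIn {x | H x < 0} (z i)) :=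
    hopen.connectedComponentIn.isConnected_iff_isPathConnected.1
      (isConnected_connectedComponentIn_iff.2 hzi)
  obtain ⟨γ, hγ⟩ := hpc.joinedIn _ (mem_connectedComponentIn hzi) _ hij
  obtain ⟨t₀, -, ht₀⟩ := isCompact_univ.exists_isMaxOn univ_nonempty
    (hcont.comp γ.continuous).continuousOn
  set s₀ := H (γ t₀) with hs₀
  have hs₀neg : s₀ < 0 := connectedComponentIn_subset {x | H x < 0} _ (hγ t₀)
  have hγle : ∀ t, H (γ t) ≤ s₀ := fun t => ht₀ (mem_univ t)
  obtain ⟨r, δ, hrδ, hdis⟩ := exists_wells hH1 hH2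
  -- The wells. Outside of them there is no critical point below the level `s₀ < 0`.
  let Q : Fin N → Set Plane := fun k => Metric.ball (z k) (r k) ∩ {x | H x < H (z k) + δ k}
  have hQo : ∀ k, IsOpen (Q k) := fun k =>
    Metric.isOpen_ball.inter (isOpen_lt hcont continuous_const)
  have hzQ : ∀ k, k ≠ 0 → z k ∈ Q k := fun k hk =>
    ⟨Metric.mem_ball_self (hrδ k hk).1, by simpa using (hrδ k hk).2.1⟩
  have hK : IsCompact ({x | H x ≤ s₀} \ ⋃ k ∈ {k : Fin N | k ≠ 0}, Q k) :=
    (isCompact_sublevel hH1 s₀).diff (isOpen_biUnion fun k _ => hQo k)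
  obtain ⟨Φ, h0, hc, hm, -, hm3⟩ := exists_ascending_flow hH1.1 hK (by
    rintro x ⟨hx, hxQ⟩ hcr
    obtain ⟨k, rfl⟩ := exists_eq_of_gradient_eq_zero hH2 hcr
    have hk : k ≠ 0 := by
      rintro rfl
      have : H (z 0) ≤ s₀ := hx
      rw [apply_crit_zero hH2] at this
      linarith
    exact hxQ (mem_biUnion (show k ∈ {k : Fin N | k ≠ 0} from hk) (hzQ k hk)))
  -- Backwards in time `H` decreases, so the flow cannot cross the barrier around a well.
  have hinv : ∀ k, k ≠ 0 → ∀ x t, Φ t x ∈ Q k → ∀ s ≤ t, Φ s x ∈ Q k := by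
    intro k hk x t hx s hs
    have hlow : ∀ s ≤ t, H (Φ s x) < H (z k) + δ k := fun s hs => (hm x hs).trans_lt hx.2
    have hcx : Continuous fun t => Φ t x := hc.comp (by fun_prop : Continuous fun r : ℝ => (r, x))
    have hS : IsPreconnected ((fun t => Φ t x) '' Iic t) :=
      isPreconnected_Iic.image _ hcx.continuousOn
    have hcov : (fun t => Φ t x) '' Iic t ⊆
        Metric.ball (z k) (r k) ∪ (Metric.closedBall (z k) (r k))ᶜ := by
      rintro _ ⟨s, hs, rfl⟩
      rcases lt_trichotomy (dist (Φ s x) (z k)) (r k) with hd | hd | hd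
      · exact Or.inl hd
      · exact absurd ((hrδ k hk).2.2 _ hd) (not_le.2 (hlow s hs))
      · exact Or.inr fun h => absurd h (not_le.2 hd)
    have hdj : Disjoint (Metric.ball (z k) (r k)) (Metric.closedBall (z k) (r k))ᶜ :=
      disjoint_compl_right_iff_subset.2 Metric.ball_subset_closedBall
    exact ⟨hS.subset_left_of_subset_union Metric.isOpen_ball
      Metric.isClosed_closedBall.isOpen_compl hdj hcov ⟨_, mem_image_of_mem _ self_mem_Iic, hx.1⟩
      (mem_image_of_mem _ hs), hlow s hs⟩
  obtain ⟨y, hy⟩ := hcont.exists_forall_le hH1.2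
  -- By the time `τ` the flow would have brought `H` below its minimum outside of the wells.
  set τ := H y - s₀ - 1 with hτdef
  have hneg : τ ≤ 0 := by linarith [hy (γ t₀)]
  have hτ : ∀ x, H x ≤ s₀ → Φ τ x ∈ ⋃ k ∈ {k : Fin N | k ≠ 0}, Q k := by
    intro x hx
    by_contra hnot
    have hall : ∀ t ∈ uIcc τ 0, Φ t x ∈ {x | H x ≤ s₀} \ ⋃ k ∈ {k : Fin N | k ≠ 0}, Q k := by
      intro t ht
      rw [uIcc_of_le hneg] at ht
      refine ⟨?_, fun hmem => hnot ?_⟩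
      · have := hm x ht.2
        simp only [h0] at this
        exact this.trans hx
      · simp only [mem_iUnion] at hmem ⊢
        obtain ⟨k, hk, hkQ⟩ := hmem
        exact ⟨k, hk, hinv k hk x t hkQ τ ht.1⟩
    have := hm3 x _ _ hall
    rw [h0] at this
    linarith [hy (Φ τ x)]
  have hcτ : Continuous fun t => Φ τ (γ t) := hc.comp (continuous_const.prodMk γ.continuous)
  have hzt : ∀ k, k ≠ 0 → Φ τ (z k) ∈ Q k := fun k hk =>
    hinv k hk (z k) 0 (by rw [h0]; exact hzQ k hk) τ hneg
  have hQd : ∀ k, k ≠ i → Disjoint (Q i) (Q k) := fun k hk =>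
    (hdis i k (Ne.symm hk)).mono inter_subset_left inter_subset_left
  have hsub : range (fun t => Φ τ (γ t)) ⊆ Q i := by
    refine (isPreconnected_range hcτ).subset_left_of_subset_union (hQo i)
      (v := ⋃ k ∈ {k : Fin N | k ≠ i}, Q k) (isOpen_biUnion fun k _ => hQo k) ?_ ?_
      ⟨Φ τ (z i), ⟨0, by simp⟩, hzt i hi⟩
    · rw [disjoint_iUnion₂_right]
      exact fun k hk => hQd k hk
    · rintro _ ⟨t, rfl⟩
      have := hτ (γ t) (hγle t)
      simp only [mem_iUnion] at this
      obtain ⟨k, -, hkQ⟩ := this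
      by_cases hki : k = i
      · exact Or.inl (hki ▸ hkQ)
      · exact Or.inr (mem_biUnion (show k ∈ {k : Fin N | k ≠ i} from hki) hkQ)
  have hjQ : Φ τ (z j) ∈ Q i := hsub ⟨1, by simp⟩
  exact disjoint_left.1 (hQd j (Ne.symm hne)) hjQ (hzt j hj)

/-- Every component of `{H < 0}` contains one of the minimum points. -/
theorem exists_mem_component (hH1 : CondH1 H) (hH2 : CondH2 H z) {x : Plane} (hx : H x < 0) :
    ∃ k, k ≠ 0 ∧ x ∈ connectedComponentIn {x | H x < 0} (z k) ∧ H (z k) ≤ H x := by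
  have hcont := hH1.1.continuous
  have hopen : IsOpen {x | H x < 0} := isOpen_lt hcont continuous_const
  set D := connectedComponentIn {x | H x < 0} x with hD
  have hxD : x ∈ D := mem_connectedComponentIn hx
  have hcpt : IsCompact (D ∩ {y | H y ≤ H x}) := by
    have heq : D ∩ {y | H y ≤ H x} = closure D ∩ {y | H y ≤ H x} := by
      refine Subset.antisymm (inter_subset_inter_left _ subset_closure) fun y hy => ?_
      have hlt : H y < 0 := lt_of_le_of_lt (show H y ≤ H x from hy.2) hx
      exact ⟨closure_connectedComponentIn_inter (F := {x | H x < 0}) hx ⟨hy.1, hlt⟩, hy.2⟩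
    rw [heq]
    exact (isCompact_sublevel hH1 _).inter_left isClosed_closure
  obtain ⟨y, hy, hmin⟩ := hcpt.exists_isMinOn ⟨x, hxD, le_refl (H x)⟩ hcont.continuousOn
  have hloc : IsLocalMin H y := by
    filter_upwards [hopen.connectedComponentIn.mem_nhds hy.1] with w hw
    rcases le_total (H w) (H x) with hle | hle
    · exact hmin ⟨hw, hle⟩
    · exact hy.2.trans hle
  obtain ⟨k, rfl⟩ := exists_eq_of_gradient_eq_zero hH2 (gradient_eq_zero_of_isLocalMin hloc)
  refine ⟨k, ?_, ?_, hy.2⟩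
  · rintro rfl
    have h1 : H (z 0) ≤ H x := hy.2
    rw [apply_crit_zero hH2] at h1
    linarith
  · rw [← connectedComponentIn_eq hy.1]
    exact hxD

theorem component_unique (hH1 : CondH1 H) (hH2 : CondH2 H z) (hlev : CondLevels H z h)
    {i j : Fin N} (hi : i ≠ 0) (hj : j ≠ 0) {x : Plane}
    (hxi : x ∈ connectedComponentIn {x | H x < 0} (z i))
    (hxj : x ∈ connectedComponentIn {x | H x < 0} (z j)) : i = j := by
  refine eq_of_mem_connectedComponentIn hH1 hH2 hlev hi hj ?_
  rw [connectedComponentIn_eq hxi, ← connectedComponentIn_eq hxj]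
  exact mem_connectedComponentIn (apply_crit_lt hlev hj)

/-- `z i` is the strict minimum point of `H` over its component. -/
theorem apply_min_lt (hH1 : CondH1 H) (hH2 : CondH2 H z) (hlev : CondLevels H z h)
    {i : Fin N} (hi : i ≠ 0) {x : Plane}
    (hx : x ∈ connectedComponentIn {x | H x < 0} (z i)) (hne : x ≠ z i) : H (z i) < H x := by
  have hle : ∀ y ∈ connectedComponentIn {x | H x < 0} (z i), H (z i) ≤ H y := by
    intro y hy
    obtain ⟨k, hk, hyk, hle⟩ :=
      exists_mem_component hH1 hH2 (connectedComponentIn_subset {x | H x < 0} _ hy)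
    rwa [component_unique hH1 hH2 hlev hi hk hy hyk]
  refine lt_of_le_of_ne (hle x hx) fun heq => hne ?_
  have hopen : IsOpen {x | H x < 0} := isOpen_lt hH1.1.continuous continuous_const
  have hloc : IsLocalMin H x := by
    filter_upwards [hopen.connectedComponentIn.mem_nhds hx] with w hw
    rw [← heq]
    exact hle w hw
  obtain ⟨k, rfl⟩ := exists_eq_of_gradient_eq_zero hH2 (gradient_eq_zero_of_isLocalMin hloc)
  have hk : k ≠ 0 := by
    rintro rfl
    have := connectedComponentIn_subset {x | H x < 0} _ hx
    rw [mem_ofPred_eq, apply_crit_zero hH2] at this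
    exact lt_irrefl _ this
  rw [eq_of_mem_connectedComponentIn hH1 hH2 hlev hi hk hx]

theorem gradient_ne_zero_of_mem_component (hH1 : CondH1 H) (hH2 : CondH2 H z)
    (hlev : CondLevels H z h) {i : Fin N} (hi : i ≠ 0) {x : Plane}
    (hx : x ∈ connectedComponentIn {x | H x < 0} (z i)) (hne : x ≠ z i) : ∇ H x ≠ 0 := by
  intro hcr
  obtain ⟨k, rfl⟩ := exists_eq_of_gradient_eq_zero hH2 hcr
  have hk : k ≠ 0 := by
    rintro rfl
    have := connectedComponentIn_subset {x | H x < 0} _ hx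
    rw [mem_ofPred_eq, apply_crit_zero hH2] at this
    exact lt_irrefl _ this
  exact hne (by rw [eq_of_mem_connectedComponentIn hH1 hH2 hlev hi hk hx])

theorem gradient_ne_zero_of_pos (hH2 : CondH2 H z) (hlev : CondLevels H z h) {x : Plane}
    (hx : 0 < H x) : ∇ H x ≠ 0 := by
  intro hcr
  obtain ⟨k, rfl⟩ := exists_eq_of_gradient_eq_zero hH2 hcr
  by_cases hk : k = 0
  · rw [hk, apply_crit_zero hH2] at hx
    exact lt_irrefl _ hx
  · exact absurd (apply_crit_lt hlev hk) (not_lt.2 hx.le)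

theorem isPreconnected_compl_closedBall (R : ℝ) :
    IsPreconnected (Metric.closedBall (0 : Plane) R)ᶜ := by
  rcases lt_or_ge R 0 with hR | hR
  · rw [Metric.closedBall_eq_empty.2 hR, compl_empty]
    exact isPreconnected_univ
  have himg : (Metric.closedBall (0 : Plane) R)ᶜ =
      (fun q : Plane × ℝ => q.2 • q.1) '' (Metric.sphere 0 1 ×ˢ Ioi R) := by
    ext y
    simp only [mem_compl_iff, mem_closedBall_zero_iff, not_le, mem_image, mem_prod,
      mem_sphere_zero_iff_norm, mem_Ioi, Prod.exists]
    constructor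
    · intro hy
      have hne : ‖y‖ ≠ 0 := (hR.trans_lt hy).ne'
      exact ⟨‖y‖⁻¹ • y, ‖y‖, ⟨by simp [norm_smul, hne], hy⟩, by simp [smul_smul, hne]⟩
    · rintro ⟨w, t, ⟨hw, ht⟩, rfl⟩
      rwa [norm_smul, hw, mul_one, Real.norm_eq_abs, abs_of_pos (hR.trans_lt ht)]
  rw [himg]
  exact ((isPreconnected_sphere one_lt_rank_plane 0 1).prod isPreconnected_Ioi).image _
    (by fun_prop)

/-- The set `{H > 0}` is connected: its components contain no critical point, so they are
unbounded, and a neighbourhood of infinity is connected. -/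
theorem isPreconnected_pos (hH1 : CondH1 H) (hH2 : CondH2 H z) (hlev : CondLevels H z h) :
    IsPreconnected {x | 0 < H x} := by
  have hcont := hH1.1.continuous
  have hopen : IsOpen {x | 0 < H x} := isOpen_lt continuous_const hcont
  obtain ⟨R, hR⟩ := (isCompact_sublevel hH1 0).isBounded.subset_closedBall 0
  have hout : (Metric.closedBall (0 : Plane) R)ᶜ ⊆ {x | 0 < H x} := fun x hx => by
    by_contra hn
    have hle : H x ≤ 0 := not_lt.1 hn
    exact hx (hR hle)
  have hmeet : ∀ x, 0 < H x → ∃ y ∈ connectedComponentIn {x | 0 < H x} x,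
      y ∈ (Metric.closedBall (0 : Plane) R)ᶜ := by
    intro x hx
    by_contra! hno
    set D := connectedComponentIn {x | 0 < H x} x with hD
    have hDR : D ⊆ Metric.closedBall 0 R := fun y hy => by
      by_contra hn
      exact hno y hy hn
    have hxD : x ∈ D := mem_connectedComponentIn hx
    have hcl : IsCompact (closure D) :=
      (isCompact_closedBall (0 : Plane) R).of_isClosed_subset isClosed_closure
        (closure_minimal hDR Metric.isClosed_closedBall)
    obtain ⟨y, hy, hmax⟩ := hcl.exists_isMaxOn ⟨x, subset_closure hxD⟩ hcont.continuousOn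
    have hypos : 0 < H y := lt_of_lt_of_le hx (hmax (subset_closure hxD))
    have hyD : y ∈ D := closure_connectedComponentIn_inter (F := {x | 0 < H x}) hx ⟨hy, hypos⟩
    refine gradient_ne_zero_of_pos hH2 hlev hypos (gradient_eq_zero_of_isLocalMax ?_)
    filter_upwards [hopen.connectedComponentIn.mem_nhds hyD] with w hw
    exact hmax (subset_closure hw)
  refine isPreconnected_of_forall_pair fun x hx y hy => ?_
  obtain ⟨x', hx', hx'R⟩ := hmeet x hx
  obtain ⟨y', hy', hy'R⟩ := hmeet y hy
  have hsub : (Metric.closedBall (0 : Plane) R)ᶜ ⊆ connectedComponentIn {x | 0 < H x} x := by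
    rw [connectedComponentIn_eq hx']
    exact (isPreconnected_compl_closedBall R).subset_connectedComponentIn hx'R hout
  have hyx : y ∈ connectedComponentIn {x | 0 < H x} x := by
    rw [connectedComponentIn_eq (hsub hy'R), ← connectedComponentIn_eq hy']
    exact mem_connectedComponentIn hy
  exact ⟨_, connectedComponentIn_subset _ _, mem_connectedComponentIn hx, hyx,
    isPreconnected_connectedComponentIn⟩

end Critical

/-! ### The part of the domain over an edge -/

/-- The part over an edge of an open set `Ω`: inside the band `W` of `H`, the set `Ω` is
the side `σ (H - e) > 0` of the level `e`, where the sign `σ = ±1` gives the side. -/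
structure IsEdge (H : Plane → ℝ) (Ω W : Set Plane) (I : Set ℝ) (σ e : ℝ) : Prop where
  band : IsBand H W I
  contDiff : ContDiff ℝ 2 H
  sign : σ = 1 ∨ σ = -1
  mem : e ∈ I
  isOpen : IsOpen Ω
  mem_iff : ∀ x ∈ W, x ∈ Ω ↔ 0 < σ * (H x - e)

namespace IsEdge

variable {H : Plane → ℝ} {Ω W : Set Plane} {I : Set ℝ} {σ e : ℝ}

theorem mem_closure_iff (hE : IsEdge H Ω W I σ e) {x : Plane} (hx : x ∈ W) :
    x ∈ closure Ω ↔ 0 ≤ σ * (H x - e) := by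
  have hcont : Continuous fun y => σ * (H y - e) :=
    continuous_const.mul (hE.contDiff.continuous.sub continuous_const)
  have hWx := hE.band.isOpen.mem_nhds hx
  constructor
  · intro hcl
    by_contra! hneg
    have h1 : ∀ᶠ y in 𝓝 x, σ * (H y - e) < 0 := hcont.continuousAt.eventually_lt_const hneg
    obtain ⟨y, hyΩ, hy1, hy2⟩ := (mem_closure_iff_frequently.1 hcl).and_eventually
      (h1.and hWx) |>.exists
    exact absurd ((hE.mem_iff y hy2).1 hyΩ) (not_lt.2 hy1.le)
  · intro hle
    by_contra hncl
    have h1 : ∀ᶠ y in 𝓝 x, σ * (H y - e) ≤ 0 := by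
      filter_upwards [isClosed_closure.isOpen_compl.mem_nhds hncl, hWx] with y hy hyW
      by_contra! hpos
      exact hy (subset_closure ((hE.mem_iff y hyW).2 hpos))
    have h0 : σ * (H x - e) = 0 := le_antisymm h1.self_of_nhds hle
    have hloc : IsLocalMax (fun y => σ * (H y - e)) x := by
      filter_upwards [h1] with y hy
      rwa [h0]
    refine hE.band.gradient_ne x hx ?_
    rcases hE.sign with rfl | rfl
    · refine gradient_eq_zero_of_isLocalMax ?_
      filter_upwards [hloc] with y hy
      linarith
    · refine gradient_eq_zero_of_isLocalMin ?_
      filter_upwards [hloc] with y hy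
      linarith

theorem mem_frontier_iff (hE : IsEdge H Ω W I σ e) {x : Plane} (hx : x ∈ W) :
    x ∈ frontier Ω ↔ H x = e := by
  rw [hE.isOpen.frontier_eq, Set.mem_sdiff, hE.mem_closure_iff hx, hE.mem_iff x hx]
  rcases hE.sign with rfl | rfl
  · constructor
    · rintro ⟨h1, h2⟩
      linarith
    · intro h
      simp [h]
  · constructor
    · rintro ⟨h1, h2⟩
      linarith
    · intro h
      simp [h]

end IsEdge

section Construction

variable {N : ℕ} [NeZero N]

/-- The regular part of the `i`-th basin: all of `D₀`, and `D_i` without its minimum point. -/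
def bandSet (H : Plane → ℝ) (z : Fin N → Plane) (i : Fin N) : Set Plane :=
  if i = 0 then {x | 0 < H x} else connectedComponentIn {x | H x < 0} (z i) \ {z i}

/-- The levels of `H` on `bandSet`. -/
def bandLevels (H : Plane → ℝ) (z : Fin N → Plane) (i : Fin N) : Set ℝ :=
  if i = 0 then Ioi 0 else Ioo (H (z i)) 0

/-- The side of the level `h i` on which the edge domain lies: below it for `i = 0`, above it for
`i ≠ 0`. -/
def edgeSign (i : Fin N) : ℝ := if i = 0 then -1 else 1

variable {H : Plane → ℝ} {z : Fin N → Plane} {h : Fin N → ℝ}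

theorem isBand_bandSet (hH1 : CondH1 H) (hH2 : CondH2 H z) (hlev : CondLevels H z h) (i : Fin N) :
    IsBand H (bandSet H z i) (bandLevels H z i) := by
  have hcont := hH1.1.continuous
  have hopen : IsOpen {x | H x < 0} := isOpen_lt hcont continuous_const
  by_cases hi : i = 0
  · simp only [bandSet, bandLevels, hi, if_true]
    refine ⟨isOpen_lt continuous_const hcont, isPreconnected_pos hH1 hH2 hlev, ordConnected_Ioi,
      isOpen_Ioi, fun x hx => hx, fun s hs => ?_, fun a b hab => ?_,
      fun x hx => gradient_ne_zero_of_pos hH2 hlev hx⟩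
    · obtain ⟨y, hy⟩ := (hH1.2.eventually_ge_atTop s).exists
      have := isPreconnected_univ.intermediate_value (mem_univ (z 0)) (mem_univ y)
        hcont.continuousOn
      rw [apply_crit_zero hH2] at this
      obtain ⟨x, -, hx⟩ := this ⟨(mem_Ioi.1 hs).le, hy⟩
      exact ⟨x, by rw [mem_ofPred_eq, hx]; exact hs, hx⟩
    · have : {x | 0 < H x} ∩ H ⁻¹' Icc a b = H ⁻¹' Icc a b :=
        inter_eq_right.2 fun x hx => hab hx
      rw [this]
      exact (isCompact_sublevel hH1 b).of_isClosed_subset (isClosed_Icc.preimage hcont)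
        fun x hx => hx.2
  · simp only [bandSet, bandLevels, hi, if_false]
    set D := connectedComponentIn {x | H x < 0} (z i) with hD
    have hzi : z i ∈ {x | H x < 0} := apply_crit_lt hlev hi
    have hDo : IsOpen D := hopen.connectedComponentIn
    have hneg : ∀ x ∈ D, H x < 0 := fun x hx => connectedComponentIn_subset {x | H x < 0} _ hx
    have hzD : z i ∈ D := mem_connectedComponentIn hzi
    have hclD : ∀ x ∈ closure D, H x < 0 → x ∈ D := fun x hx hlt =>
      closure_connectedComponentIn_inter (F := {x | H x < 0}) hzi ⟨hx, hlt⟩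
    refine ⟨hDo.sdiff isClosed_singleton, isPreconnected_diff_singleton hDo
      isPreconnected_connectedComponentIn _, ordConnected_Ioo, isOpen_Ioo,
      fun x hx => ⟨apply_min_lt hH1 hH2 hlev hi hx.1 hx.2, hneg x hx.1⟩, fun s hs => ?_,
      fun a b hab => ?_,
      fun x hx => gradient_ne_zero_of_mem_component hH1 hH2 hlev hi hx.1 hx.2⟩
    · obtain ⟨y, hyD, hy⟩ : ∃ y ∈ D, s ≤ H y := by
        by_contra! hlt
        have hclosed : IsClosed D := isClosed_of_closure_subset fun x hx => by
          have : H x ≤ s := closure_minimal (fun y hy => (hlt y hy).le)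
            (isClosed_le hcont continuous_const) hx
          exact hclD x hx (this.trans_lt hs.2)
        have huniv : D = univ := IsClopen.eq_univ ⟨hclosed, hDo⟩ ⟨z i, hzD⟩
        have := hneg (z 0) (huniv ▸ mem_univ _)
        rw [apply_crit_zero hH2] at this
        exact lt_irrefl _ this
      obtain ⟨x, hxD, hx⟩ := isPreconnected_connectedComponentIn.intermediate_value hzD hyD
        hcont.continuousOn ⟨hs.1.le, hy⟩
      refine ⟨x, ⟨hxD, ?_⟩, hx⟩
      rintro rfl
      exact hs.1.ne hx
    · rcases lt_or_ge b a with hba | hba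
      · simp [Icc_eq_empty_of_lt hba]
      have ha := hab (left_mem_Icc.2 hba)
      have hb := hab (right_mem_Icc.2 hba)
      have heq : D \ {z i} ∩ H ⁻¹' Icc a b = closure D ∩ H ⁻¹' Icc a b := by
        ext x
        constructor
        · exact fun hx => ⟨subset_closure hx.1.1, hx.2⟩
        · intro hx
          refine ⟨⟨hclD x hx.1 (hx.2.2.trans_lt hb.2), ?_⟩, hx.2⟩
          rintro rfl
          exact absurd ha.1 (not_lt.2 hx.2.1)
      rw [heq]
      exact (isCompact_sublevel hH1 b).of_isClosed_subset
        (isClosed_closure.inter (isClosed_Icc.preimage hcont)) fun x hx => hx.2.2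

theorem edgeDomain_eq (hlev : CondLevels H z h) (i : Fin N) :
    edgeDomain H z h i = bandSet H z i ∩ {x | 0 < edgeSign i * (H x - h i)} := by
  by_cases hi : i = 0
  · ext x
    simp [edgeDomain, basin, bandSet, edgeSign, hi]
  · ext x
    simp only [edgeDomain, basin, bandSet, edgeSign, hi, if_false, mem_ofPred_eq, mem_inter_iff,
      one_mul, sub_pos, Set.mem_sdiff, mem_singleton_iff]
    constructor
    · rintro ⟨h1, h2⟩
      refine ⟨⟨h1, ?_⟩, h2⟩
      rintro rfl
      exact absurd (hlev.2 i hi).1 (not_lt.2 h2.le)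
    · rintro ⟨⟨h1, -⟩, h2⟩
      exact ⟨h1, h2⟩

theorem bandSet_ne_zero {i : Fin N} {x : Plane} (hx : x ∈ bandSet H z i) : H x ≠ 0 := by
  by_cases hi : i = 0
  · simp only [bandSet, hi, if_true, mem_ofPred_eq] at hx
    exact hx.ne'
  · simp only [bandSet, hi, if_false] at hx
    exact (connectedComponentIn_subset {x | H x < 0} _ hx.1 : H x < 0).ne

theorem bandSet_index_unique (hH1 : CondH1 H) (hH2 : CondH2 H z) (hlev : CondLevels H z h)
    {i j : Fin N} {x : Plane} (hxi : x ∈ bandSet H z i) (hxj : x ∈ bandSet H z j) : i = j := by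
  have hneg : ∀ k : Fin N, k ≠ 0 → x ∈ bandSet H z k →
      x ∈ connectedComponentIn {x | H x < 0} (z k) ∧ H x < 0 := fun k hk hx => by
    simp only [bandSet, hk, if_false] at hx
    exact ⟨hx.1, connectedComponentIn_subset {x | H x < 0} _ hx.1⟩
  have hpos : x ∈ bandSet H z 0 → 0 < H x := fun hx => by simpa [bandSet] using hx
  by_cases hi : i = 0
  · by_cases hj : j = 0
    · rw [hi, hj]
    · subst hi
      linarith [hpos hxi, (hneg j hj hxj).2]
  · by_cases hj : j = 0
    · subst hj
      linarith [hpos hxj, (hneg i hi hxi).2]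
    · exact component_unique hH1 hH2 hlev hi hj (hneg i hi hxi).1 (hneg j hj hxj).1

theorem isOpen_domain (hH1 : CondH1 H) (hH2 : CondH2 H z) (hlev : CondLevels H z h) :
    IsOpen (domain H z h) := by
  have hcont := hH1.1.continuous
  have hopen : ∀ i, IsOpen (edgeDomain H z h i) := fun i => by
    rw [edgeDomain_eq hlev]
    exact (isBand_bandSet hH1 hH2 hlev i).isOpen.inter
      (isOpen_lt continuous_const (by fun_prop))
  rw [isOpen_iff_mem_nhds]
  rintro x (hx | hx)
  · have hx0 : H x = 0 := hx
    have h1 : ∀ᶠ y in 𝓝 x, ∀ k : Fin N, k ≠ 0 → h k < H y := by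
      rw [eventually_all]
      intro k
      by_cases hk : k = 0
      · exact Eventually.of_forall fun y h => absurd hk h
      · have : ∀ᶠ y in 𝓝 x, h k < H y :=
          hcont.continuousAt.eventually_const_lt (by rw [hx0]; exact (hlev.2 k hk).2)
        exact this.mono fun y hy _ => hy
    have h2 : ∀ᶠ y in 𝓝 x, H y < h 0 :=
      hcont.continuousAt.eventually_lt_const (by rw [hx0]; exact hlev.1)
    filter_upwards [h1, h2] with y hy1 hy2
    rcases lt_trichotomy (H y) 0 with hneg | hzero | hpos
    · obtain ⟨k, hk, hyk, -⟩ := exists_mem_component hH1 hH2 hneg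
      refine Or.inr (mem_iUnion.2 ⟨k, ?_⟩)
      simp only [edgeDomain, basin, hk, if_false]
      exact ⟨hyk, hy1 k hk⟩
    · exact Or.inl hzero
    · refine Or.inr (mem_iUnion.2 ⟨0, ?_⟩)
      simp only [edgeDomain, basin, if_true]
      exact ⟨hpos, hy2⟩
  · exact mem_of_superset ((isOpen_iUnion hopen).mem_nhds hx) subset_union_right

theorem isCompact_closure_domain (hH1 : CondH1 H) (hlev : CondLevels H z h) :
    IsCompact (closure (domain H z h)) := by
  refine (isCompact_sublevel hH1 (h 0)).of_isClosed_subset isClosed_closure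
    (closure_minimal ?_ (isClosed_le hH1.1.continuous continuous_const))
  rintro x (hx | hx)
  · have hx0 : H x = 0 := hx
    show H x ≤ h 0
    rw [hx0]
    exact hlev.1.le
  · obtain ⟨i, hi⟩ := mem_iUnion.1 hx
    show H x ≤ h 0
    by_cases hi0 : i = 0
    · simp only [edgeDomain, basin, hi0, if_true] at hi
      exact hi.2.le
    · simp only [edgeDomain, basin, hi0, if_false] at hi
      have : H x < 0 := connectedComponentIn_subset {x | H x < 0} _ hi.1
      linarith [hlev.1]

theorem edge_eq (hlev : CondLevels H z h) (i : Fin N) :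
    edge h i = bandLevels H z i ∩ {s | 0 < edgeSign i * (s - h i)} := by
  by_cases hi : i = 0
  · ext s
    simp [edge, bandLevels, edgeSign, hi]
  · ext s
    simp only [edge, bandLevels, edgeSign, hi, if_false, mem_Ioo, mem_inter_iff, mem_ofPred_eq,
      one_mul, sub_pos]
    have := (hlev.2 i hi).1
    constructor
    · exact fun hs => ⟨⟨by linarith [hs.1], hs.2⟩, hs.1⟩
    · exact fun hs => ⟨hs.2, hs.1.2⟩

theorem edgeClosed_eq (hlev : CondLevels H z h) (i : Fin N) :
    edgeClosed h i = bandLevels H z i ∩ {s | 0 ≤ edgeSign i * (s - h i)} := by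
  by_cases hi : i = 0
  · have h0 := hlev.1
    ext s
    simp only [edgeClosed, edge, bandLevels, edgeSign, hi, if_true, closure_Ioo h0.ne, Set.mem_sdiff,
      mem_Icc, mem_singleton_iff, mem_inter_iff, mem_Ioi, mem_ofPred_eq]
    constructor
    · rintro ⟨⟨h1, h2⟩, h3⟩
      exact ⟨lt_of_le_of_ne h1 (Ne.symm h3), by linarith⟩
    · rintro ⟨h1, h2⟩
      exact ⟨⟨h1.le, by linarith⟩, h1.ne'⟩
  · have h0 := hlev.2 i hi
    ext s
    simp only [edgeClosed, edge, bandLevels, edgeSign, hi, if_false, closure_Ioo h0.2.ne, Set.mem_sdiff,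
      mem_Icc, mem_singleton_iff, mem_inter_iff, mem_Ioo, mem_ofPred_eq, one_mul, sub_nonneg]
    constructor
    · rintro ⟨⟨h1, h2⟩, h3⟩
      exact ⟨⟨h0.1.trans_le h1, lt_of_le_of_ne h2 h3⟩, h1⟩
    · rintro ⟨⟨h1, h2⟩, h3⟩
      exact ⟨⟨h3, h2.le⟩, h2.ne⟩

theorem isEdge_domain (hH1 : CondH1 H) (hH2 : CondH2 H z) (hlev : CondLevels H z h) (i : Fin N) :
    IsEdge H (domain H z h) (bandSet H z i) (bandLevels H z i) (edgeSign i) (h i) where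
  band := isBand_bandSet hH1 hH2 hlev i
  contDiff := hH1.1
  sign := by
    by_cases hi : i = 0 <;> simp [edgeSign, hi]
  mem := by
    by_cases hi : i = 0
    · simpa [bandLevels, hi] using hlev.1
    · simpa [bandLevels, hi] using hlev.2 i hi
  isOpen := isOpen_domain hH1 hH2 hlev
  mem_iff := by
    intro x hx
    constructor
    · rintro (h0 | hu)
      · exact absurd h0 (bandSet_ne_zero hx)
      · obtain ⟨j, hj⟩ := mem_iUnion.1 hu
        rw [edgeDomain_eq hlev] at hj
        rw [bandSet_index_unique hH1 hH2 hlev hx hj.1]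
        exact hj.2
    · intro hpos
      refine Or.inr (mem_iUnion.2 ⟨i, ?_⟩)
      rw [edgeDomain_eq hlev]
      exact ⟨hx, hpos⟩

theorem levelCurve_eq (hH1 : CondH1 H) (hH2 : CondH2 H z) (hlev : CondLevels H z h) {i : Fin N}
    {s : ℝ} (hs : s ∈ edgeClosed h i) : levelCurve H z h i s = bandSet H z i ∩ H ⁻¹' {s} := by
  have hE := isEdge_domain hH1 hH2 hlev i
  have hcont := hH1.1.continuous
  rw [edgeClosed_eq hlev] at hs
  have hsub : edgeDomain H z h i ⊆ bandSet H z i := by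
    rw [edgeDomain_eq hlev]
    exact inter_subset_left
  ext x
  constructor
  · rintro ⟨hx, hxs⟩
    refine ⟨?_, hxs⟩
    have hxI : H x ∈ bandLevels H z i := by
      rw [hxs]
      exact hs.1
    have hcl := closure_mono hsub hx
    by_cases hi : i = 0
    · simp only [bandLevels, bandSet, hi, if_true] at hxI ⊢
      exact hxI
    · simp only [bandLevels, bandSet, hi, if_false] at hxI hcl ⊢
      refine ⟨closure_connectedComponentIn_inter (F := {x | H x < 0}) (apply_crit_lt hlev hi)
        ⟨closure_mono sdiff_subset hcl, hxI.2⟩, ?_⟩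
      rintro rfl
      exact lt_irrefl _ hxI.1
  · rintro ⟨hxW, hxs⟩
    have hxs' : H x = s := hxs
    refine ⟨?_, hxs⟩
    have hcl : x ∈ closure (domain H z h) := (hE.mem_closure_iff hxW).2 (by rw [hxs']; exact hs.2)
    have heq : edgeDomain H z h i = domain H z h ∩ bandSet H z i := by
      rw [edgeDomain_eq hlev]
      ext y
      constructor
      · exact fun hy => ⟨(hE.mem_iff y hy.1).2 hy.2, hy.1⟩
      · exact fun hy => ⟨hy.2, (hE.mem_iff y hy.2).1 hy.1⟩
    rw [heq, mem_closure_iff_frequently]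
    exact (mem_closure_iff_frequently.1 hcl).and_eventually (hE.band.isOpen.mem_nhds hxW)

end Construction

/-! ### Semicontinuous envelopes and localization of test functions -/

section Envelope

variable {X : Type*} [TopologicalSpace X] {S : Set X} {u v : X → ℝ} {x : X} {c : ℝ}

theorem isBoundedUnder_of_locBdd (hb : ∃ C : ℝ, ∀ᶠ y in 𝓝[S] x, |u y| ≤ C) :
    IsBoundedUnder (· ≤ ·) (𝓝[S] x) u := by
  obtain ⟨C, hC⟩ := hb
  exact isBoundedUnder_of_eventually_le (a := C) (hC.mono fun y hy => (abs_le.1 hy).2)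

theorem isCoboundedUnder_of_locBdd (hx : x ∈ closure S)
    (hb : ∃ C : ℝ, ∀ᶠ y in 𝓝[S] x, |u y| ≤ C) : IsCoboundedUnder (· ≤ ·) (𝓝[S] x) u := by
  obtain ⟨C, hC⟩ := hb
  have : (𝓝[S] x).NeBot := mem_closure_iff_nhdsWithin_neBot.1 hx
  exact IsBoundedUnder.isCoboundedUnder_le
    (isBoundedUnder_of_eventually_ge (a := -C) (hC.mono fun y hy => (abs_le.1 hy).1))

theorem eventually_lt_of_uscEnv_lt (hb : ∃ C : ℝ, ∀ᶠ y in 𝓝[S] x, |u y| ≤ C)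
    (h : uscEnv S u x < c) : ∀ᶠ y in 𝓝[S] x, u y < c :=
  eventually_lt_of_limsup_lt h (isBoundedUnder_of_locBdd hb)

theorem frequently_lt_of_lt_uscEnv (hx : x ∈ closure S)
    (hb : ∃ C : ℝ, ∀ᶠ y in 𝓝[S] x, |u y| ≤ C) (h : c < uscEnv S u x) :
    ∃ᶠ y in 𝓝[S] x, c < u y :=
  frequently_lt_of_lt_limsup (isCoboundedUnder_of_locBdd hx hb) h

theorem uscEnv_le (hx : x ∈ closure S) (hb : ∃ C : ℝ, ∀ᶠ y in 𝓝[S] x, |u y| ≤ C)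
    (h : ∀ᶠ y in 𝓝[S] x, u y ≤ c) : uscEnv S u x ≤ c :=
  limsup_le_of_le (isCoboundedUnder_of_locBdd hx hb) h

theorem le_uscEnv (hx : x ∈ S) (hb : ∃ C : ℝ, ∀ᶠ y in 𝓝[S] x, |u y| ≤ C) : u x ≤ uscEnv S u x := by
  by_contra! h
  exact lt_irrefl _ ((eventually_lt_of_uscEnv_lt hb h).self_of_nhdsWithin hx)

theorem locBdd_of_bdd {C : ℝ} (hC : ∀ x ∈ S, |u x| ≤ C) (x : X) :
    ∃ C : ℝ, ∀ᶠ y in 𝓝[S] x, |u y| ≤ C :=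
  ⟨C, eventually_mem_nhdsWithin.mono fun y hy => hC y hy⟩

theorem LocBddOn_of_bdd {C : ℝ} (hC : ∀ x ∈ S, |u x| ≤ C) : LocBddOn u S :=
  fun x _ => locBdd_of_bdd hC x

theorem uscEnv_mono (hx : x ∈ closure S) (hu : ∃ C : ℝ, ∀ᶠ y in 𝓝[S] x, |u y| ≤ C)
    (hv : ∃ C : ℝ, ∀ᶠ y in 𝓝[S] x, |v y| ≤ C) (h : ∀ᶠ y in 𝓝[S] x, u y ≤ v y) :
    uscEnv S u x ≤ uscEnv S v x :=
  limsup_le_limsup h (isCoboundedUnder_of_locBdd hx hu) (isBoundedUnder_of_locBdd hv)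

theorem eventually_uscEnv_lt (hx : x ∈ S) (hb : LocBddOn u S) (h : uscEnv S u x < c) :
    ∀ᶠ y in 𝓝[S] x, uscEnv S u y < c := by
  obtain ⟨d, hd, hdc⟩ := exists_between h
  have h1 := eventually_lt_of_uscEnv_lt (hb x hx) hd
  filter_upwards [eventually_eventually_nhdsWithin.2 h1, self_mem_nhdsWithin] with y hy hyS
  exact (uscEnv_le (subset_closure hyS) (hb y hyS) (hy.mono fun _ h => h.le)).trans_lt hdc

theorem abs_uscEnv_le {C : ℝ} (hC : ∀ x ∈ S, |u x| ≤ C) (hx : x ∈ S) : |uscEnv S u x| ≤ C := by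
  have hb := locBdd_of_bdd hC x
  refine abs_le.2 ⟨(abs_le.1 (hC x hx)).1.trans (le_uscEnv hx hb), uscEnv_le (subset_closure hx) hb ?_⟩
  exact eventually_mem_nhdsWithin.mono fun y hy => (abs_le.1 (hC y hy)).2

theorem upperSemicontinuousOn_uscEnv (hb : LocBddOn u S) : UpperSemicontinuousOn (uscEnv S u) S :=
  fun _ hx _ h => eventually_uscEnv_lt hx hb h

theorem uscEnv_congr (h : u =ᶠ[𝓝[S] x] v) : uscEnv S u x = uscEnv S v x := limsup_congr h

theorem uscEnv_congr_set {S' : Set X} (h : 𝓝[S] x = 𝓝[S'] x) : uscEnv S u x = uscEnv S' u x := by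
  rw [uscEnv, uscEnv, h]

theorem uscEnv_const (hx : x ∈ closure S) (c : ℝ) : uscEnv S (fun _ => c) x = c := by
  have : (𝓝[S] x).NeBot := mem_closure_iff_nhdsWithin_neBot.1 hx
  exact limsup_const c

theorem lscEnv_eq_neg (S : Set X) (u : X → ℝ) (x : X) :
    lscEnv S u x = -uscEnv S (fun y => -u y) x := by
  rw [lscEnv, uscEnv, limsup_eq, liminf_eq, ← Real.sSup_neg]
  congr 1
  ext a
  simp

/-- If the semicontinuous envelope minus `φ` is at most `c` on the outer part of a compact set and
exceeds `c` somewhere, it has a local maximum with value above `c` in the inner part. -/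
theorem exists_isLocalMaxOn {K M : Set X} {φ : X → ℝ} (hK : IsCompact K) (hKS : K ⊆ S)
    (hb : LocBddOn u S) (hφ : ContinuousOn φ K) (hM : ∀ y ∈ M, K ∈ 𝓝[S] y)
    (hout : ∀ y ∈ K, y ∉ M → uscEnv S u y - φ y ≤ c)
    (hin : ∃ y ∈ K, c < uscEnv S u y - φ y) :
    ∃ y ∈ K ∩ M, IsLocalMaxOn (fun y => uscEnv S u y - φ y) S y ∧ c < uscEnv S u y - φ y := by
  obtain ⟨y₁, hy₁, hcy₁⟩ := hin
  have husc : UpperSemicontinuousOn (fun y => uscEnv S u y - φ y) K := by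
    have h1 : UpperSemicontinuousOn (uscEnv S u) K := (upperSemicontinuousOn_uscEnv hb).mono hKS
    have h2 : UpperSemicontinuousOn (fun y => -φ y) K := hφ.neg.upperSemicontinuousOn
    simpa only [sub_eq_add_neg] using h1.add h2
  obtain ⟨y, hy, hmax⟩ := husc.exists_isMaxOn ⟨y₁, hy₁⟩ hK
  have hc : c < uscEnv S u y - φ y := hcy₁.trans_le (hmax hy₁)
  have hyM : y ∈ M := by
    by_contra hn
    exact absurd (hout y hy hn) (not_le.2 hc)
  refine ⟨y, ⟨hy, hyM⟩, ?_, hc⟩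
  filter_upwards [hM y hyM] with w hw
  exact hmax hw

end Envelope

/-- A `C¹` function on an open set agrees near any of its points with a `C¹` function on the whole
space. -/
theorem exists_contDiff_eventuallyEq {E : Type*} [NormedAddCommGroup E] [InnerProductSpace ℝ E]
    [FiniteDimensional ℝ E] {φ : E → ℝ} {U : Set E} (hU : IsOpen U) (hφ : ContDiffOn ℝ 1 φ U)
    {x : E} (hx : x ∈ U) : ∃ ψ : E → ℝ, ContDiff ℝ 1 ψ ∧ ψ =ᶠ[𝓝 x] φ := by
  obtain ⟨r, hr, hrU⟩ := Metric.nhds_basis_closedBall.mem_iff.1 (hU.mem_nhds hx)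
  let f : ContDiffBump x := ⟨r / 2, r, by positivity, by linarith⟩
  refine ⟨fun y => f y * φ y, ?_, ?_⟩
  · rw [contDiff_iff_contDiffAt]
    intro y
    by_cases hy : y ∈ tsupport f
    · rw [f.tsupport_eq] at hy
      exact f.contDiff.contDiffAt.mul (hφ.contDiffAt (hU.mem_nhds (hrU hy)))
    · have h0 : f =ᶠ[𝓝 y] 0 := notMem_tsupport_iff_eventuallyEq.1 hy
      have : (fun y => f y * φ y) =ᶠ[𝓝 y] fun _ => 0 := by
        filter_upwards [h0] with w hw
        simp [hw]
      exact contDiffAt_const.congr_of_eventuallyEq this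
  · filter_upwards [f.eventuallyEq_one] with y hy
    simp [hy]

/-! ### Viscosity subsolutions up to the boundary -/

/-- The viscosity subsolution test of the Dirichlet problem, with `C¹` test functions on the whole
plane and with interior and boundary points treated at once. -/
def SubTest (Ω : Set Plane) (H : Plane → ℝ) (G : Plane → Plane → ℝ) (g : Plane → ℝ) (lam ε : ℝ)
    (u : Plane → ℝ) : Prop :=
  ∀ φ : Plane → ℝ, ContDiff ℝ 1 φ → ∀ x ∈ closure Ω,
    IsLocalMaxOn (fun y => uscEnv (closure Ω) u y - φ y) (closure Ω) x →
      hjOp H G lam ε x (uscEnv (closure Ω) u x) (∇ φ x) ≤ 0 ∨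
        (x ∈ frontier Ω ∧ uscEnv (closure Ω) u x ≤ g x)

section Viscosity

variable {Ω : Set Plane} {H : Plane → ℝ} {G : Plane → Plane → ℝ} {g : Plane → ℝ} {lam ε : ℝ}
  {u : Plane → ℝ}

theorem nhdsWithin_closure_of_mem (hΩ : IsOpen Ω) {x : Plane} (hx : x ∈ Ω) :
    𝓝[closure Ω] x = 𝓝[Ω] x := by
  rw [hΩ.nhdsWithin_eq hx, nhdsWithin_eq_nhds.2 (mem_of_superset (hΩ.mem_nhds hx) subset_closure)]

/-- The tests in `Ω` and on `∂Ω` combine into one test on `closure Ω`: a test function on `Ω` can be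
localized. -/
theorem isSubDirichletEps_iff (hΩ : IsOpen Ω) :
    IsSubDirichletEps Ω H G g lam ε u ↔
      (∃ C : ℝ, ∀ x ∈ closure Ω, |u x| ≤ C) ∧ SubTest Ω H G g lam ε u := by
  have henv : ∀ y ∈ Ω, uscEnv Ω u y = uscEnv (closure Ω) u y := fun y hy =>
    uscEnv_congr_set (nhdsWithin_closure_of_mem hΩ hy).symm
  constructor
  · rintro ⟨hb, ⟨-, hin⟩, hbd⟩
    refine ⟨hb, fun φ hφ x hx hmax => ?_⟩
    by_cases hxΩ : x ∈ Ω
    · left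
      rw [← henv x hxΩ]
      refine hin φ hφ.contDiffOn x hxΩ ?_
      rw [IsLocalMaxOn, IsMaxFilter, nhdsWithin_closure_of_mem hΩ hxΩ] at hmax
      filter_upwards [hmax, self_mem_nhdsWithin] with y hy hyΩ
      rw [henv y hyΩ, henv x hxΩ]
      exact hy
    · have hxf : x ∈ frontier Ω := by
        rw [hΩ.frontier_eq]
        exact ⟨hx, hxΩ⟩
      rcases min_le_iff.1 (hbd φ hφ x hxf hmax) with h | h
      · exact Or.inl h
      · exact Or.inr ⟨hxf, by linarith⟩
  · rintro ⟨⟨C, hC⟩, htest⟩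
    refine ⟨⟨C, hC⟩, ⟨LocBddOn_of_bdd fun x hx => hC x (subset_closure hx), ?_⟩, ?_⟩
    · intro φ hφ x hx hmax
      obtain ⟨ψ, hψ, hψφ⟩ := exists_contDiff_eventuallyEq hΩ hφ hx
      have h1 := htest ψ hψ x (subset_closure hx) (by
        rw [IsLocalMaxOn, IsMaxFilter, nhdsWithin_closure_of_mem hΩ hx]
        filter_upwards [hmax, self_mem_nhdsWithin, mem_nhdsWithin_of_mem_nhds hψφ] with y hy hyΩ hyψ
        rw [henv y hyΩ, henv x hx] at hy
        rw [hyψ, hψφ.self_of_nhds]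
        exact hy)
      rcases h1 with h1 | h1
      · rwa [henv x hx, ← hψφ.gradient_eq]
      · rw [hΩ.frontier_eq] at h1
        exact absurd hx h1.1.2
    · intro φ hφ x hx hmax
      rcases htest φ hφ x (frontier_subset_closure hx) hmax with h1 | h1
      · exact min_le_of_left_le h1
      · exact min_le_of_right_le (by linarith [h1.2])

/-- The nonlinearity of the problem satisfied by `-u`. -/
def dualG (G : Plane → Plane → ℝ) (x p : Plane) : ℝ := -G x (-p)

theorem dualG_dualG (G : Plane → Plane → ℝ) : dualG (dualG G) = G := by
  ext x p
  simp [dualG]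

theorem hjOp_neg (x : Plane) (r : ℝ) (p : Plane) :
    hjOp H (dualG G) lam ε x (-r) (-p) = -hjOp H G lam ε x r p := by
  simp only [hjOp, dualG, inner_neg_right, neg_neg]
  ring

theorem gradient_neg (φ : Plane → ℝ) (x : Plane) : ∇ (fun y => -φ y) x = -∇ φ x := by
  simp only [gradient]
  rw [fderiv_fun_neg, map_neg]

/-- The reflection `u ↦ -u` exchanges supersolutions and subsolutions of the dual problem. -/
theorem isSuperDirichletEps_iff :
    IsSuperDirichletEps Ω H G g lam ε u ↔
      IsSubDirichletEps Ω H (dualG G) (fun x => -g x) lam ε (fun x => -u x) := by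
  have hloc : ∀ (S : Set Plane) (φ : Plane → ℝ) (x : Plane),
      IsLocalMinOn (fun y => lscEnv S u y - φ y) S x ↔
        IsLocalMaxOn (fun y => uscEnv S (fun x => -u x) y - (fun y => -φ y) y) S x := by
    intro S φ x
    simp only [lscEnv_eq_neg]
    constructor
    · intro h
      filter_upwards [h] with y hy
      linarith
    · intro h
      filter_upwards [h] with y hy
      linarith
  have hop : ∀ (S : Set Plane) (φ : Plane → ℝ) (x : Plane),
      hjOp H G lam ε x (lscEnv S u x) (∇ φ x) =
        -hjOp H (dualG G) lam ε x (uscEnv S (fun x => -u x) x) (∇ (fun y => -φ y) x) := by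
    intro S φ x
    rw [lscEnv_eq_neg, gradient_neg, ← hjOp_neg, neg_neg, dualG_dualG]
  have hpair : ∀ a b : ℝ, 0 ≤ max (-a) b ↔ min a (-b) ≤ 0 := by
    intro a b
    rw [le_max_iff, min_le_iff]
    constructor <;> rintro (h | h) <;> [left; right; left; right] <;> linarith
  simp only [IsSuperDirichletEps, IsSubDirichletEps, IsSuperHJeps, IsSubHJeps, LocBddOn, abs_neg]
  refine and_congr Iff.rfl (and_congr (and_congr Iff.rfl ?_) ?_)
  · constructor
    · intro h φ hφ x hx hmax
      have h1 := h (fun y => -φ y) hφ.neg x hx ((hloc Ω _ x).2 (by simpa using hmax))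
      rw [hop] at h1
      simp only [neg_neg] at h1
      linarith
    · intro h φ hφ x hx hmin
      have h1 := h (fun y => -φ y) hφ.neg x hx ((hloc Ω _ x).1 hmin)
      rw [hop]
      linarith
  · constructor
    · intro h φ hφ x hx hmax
      have h1 := h (fun y => -φ y) hφ.neg x hx ((hloc _ _ x).2 (by simpa using hmax))
      rw [hop, hpair] at h1
      simp only [neg_neg, lscEnv_eq_neg] at h1
      convert h1 using 2
      ring
    · intro h φ hφ x hx hmin
      have h1 := h (fun y => -φ y) hφ.neg x hx ((hloc _ _ x).1 hmin)
      rw [hop, hpair, lscEnv_eq_neg]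
      convert h1 using 2
      ring

theorem mem_solutionSet_iff (hΩ : IsOpen Ω) :
    u ∈ solutionSet Ω H G g lam ε ↔ (∃ C : ℝ, ∀ x ∈ closure Ω, |u x| ≤ C) ∧
      SubTest Ω H G g lam ε u ∧ SubTest Ω H (dualG G) (fun x => -g x) lam ε (fun x => -u x) := by
  rw [solutionSet, mem_ofPred_eq, isSuperDirichletEps_iff, isSubDirichletEps_iff hΩ,
    isSubDirichletEps_iff hΩ]
  simp only [abs_neg]
  tauto

theorem neg_mem_solutionSet (hΩ : IsOpen Ω) (hu : u ∈ solutionSet Ω H G g lam ε) :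
    (fun x => -u x) ∈ solutionSet Ω H (dualG G) (fun x => -g x) lam ε := by
  rw [mem_solutionSet_iff hΩ] at hu ⊢
  simp only [dualG_dualG, neg_neg, abs_neg]
  exact ⟨hu.1, hu.2.2, hu.2.1⟩

/-- The maximum principle: subsolutions are bounded above uniformly in `ε`. -/
theorem uscEnv_le_of_subTest (hΩ : IsCompact (closure Ω)) (hlam : 0 < lam) {M : ℝ}
    (hMG : ∀ x ∈ closure Ω, -G x 0 ≤ lam * M) (hMg : ∀ x ∈ frontier Ω, g x ≤ M)
    (hb : ∃ C : ℝ, ∀ x ∈ closure Ω, |u x| ≤ C) (hu : SubTest Ω H G g lam ε u) {x : Plane}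
    (hx : x ∈ closure Ω) : uscEnv (closure Ω) u x ≤ M := by
  obtain ⟨C, hC⟩ := hb
  obtain ⟨y, hy, hmax⟩ :=
    (upperSemicontinuousOn_uscEnv (LocBddOn_of_bdd hC)).exists_isMaxOn ⟨x, hx⟩ hΩ
  have htest := hu (fun _ => 0) contDiff_const y hy (by simpa using hmax.localize)
  refine (hmax hx).trans ?_
  rcases htest with h | h
  · rw [gradient_fun_const] at h
    simp only [hjOp, inner_zero_right, mul_zero, sub_zero] at h
    have := hMG y hy
    exact le_of_mul_le_mul_left (by linarith) hlam
  · exact h.2.trans (hMg y h.1)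

end Viscosity

/-! ### Existence of solutions by Perron's method -/

section Perron

variable {Ω : Set Plane} {H : Plane → ℝ} {G : Plane → Plane → ℝ} {g : Plane → ℝ} {lam ε : ℝ}

theorem continuousWithinAt_hjOp {S : Set Plane} (hb : Continuous (drift H))
    (hG : ContinuousOn (Function.uncurry G) (S ×ˢ univ)) {a : Plane → ℝ} {p : Plane → Plane}
    {x : Plane} (hx : x ∈ S) (ha : ContinuousWithinAt a S x) (hp : ContinuousWithinAt p S x) :
    ContinuousWithinAt (fun y => hjOp H G lam ε y (a y) (p y)) S x := by
  have h1 : ContinuousWithinAt (fun y => G y (p y)) S x :=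
    ContinuousWithinAt.comp (f := fun y => (y, p y)) (t := S ×ˢ univ)
      (hG (x, p x) ⟨hx, mem_univ _⟩) (continuousWithinAt_id.prodMk hp)
      fun y hy => ⟨hy, mem_univ _⟩
  have h2 : ContinuousWithinAt (fun y => (inner ℝ (drift H y) (p y) : ℝ)) S x :=
    ContinuousWithinAt.inner (𝕜 := ℝ) hb.continuousWithinAt hp
  exact ((ha.const_mul lam).sub (h2.const_mul ε⁻¹)).add h1

theorem hjOp_sub_left (x : Plane) (r r' : ℝ) (p : Plane) :
    hjOp H G lam ε x r p = hjOp H G lam ε x r' p + lam * (r - r') := by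
  simp only [hjOp]
  ring

theorem contDiff_dist_sq (x : Plane) : ContDiff ℝ 1 fun y : Plane => ‖y - x‖ ^ 2 :=
  (contDiff_id.sub contDiff_const).norm_sq ℝ

theorem gradient_add {φ ψ : Plane → ℝ} {x : Plane} (hφ : DifferentiableAt ℝ φ x)
    (hψ : DifferentiableAt ℝ ψ x) : ∇ (fun y => φ y + ψ y) x = ∇ φ x + ∇ ψ x := by
  simp only [gradient]
  rw [fderiv_fun_add hφ hψ, map_add]

theorem gradient_sub {φ ψ : Plane → ℝ} {x : Plane} (hφ : DifferentiableAt ℝ φ x)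
    (hψ : DifferentiableAt ℝ ψ x) : ∇ (fun y => φ y - ψ y) x = ∇ φ x - ∇ ψ x := by
  simp only [gradient]
  rw [fderiv_fun_sub hφ hψ, map_sub]

theorem gradient_add_const' (φ : Plane → ℝ) (c : ℝ) (x : Plane) :
    ∇ (fun y => φ y + c) x = ∇ φ x := by
  simp only [gradient]
  rw [fderiv_add_const]

theorem gradient_const_smul (c : ℝ) {φ : Plane → ℝ} {x : Plane} (hφ : DifferentiableAt ℝ φ x) :
    ∇ (fun y => c * φ y) x = c • ∇ φ x := by
  simp only [gradient]
  rw [fderiv_const_mul hφ, map_smul]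

theorem continuous_gradient {φ : Plane → ℝ} (hφ : ContDiff ℝ 1 φ) : Continuous (∇ φ) :=
  (InnerProductSpace.toDual ℝ Plane).symm.continuous.comp (hφ.continuous_fderiv one_ne_zero)

theorem gradient_norm_sub_sq (x y : Plane) : ∇ (fun y : Plane => ‖y - x‖ ^ 2) y = (2 : ℝ) • (y - x) := by
  have h1 : HasFDerivAt (fun y : Plane => ‖y - x‖ ^ 2) (2 • (innerSL ℝ (y - x))) y := by
    simpa using ((hasFDerivAt_id y).sub_const x).norm_sq
  have h2 : HasGradientAt (fun y : Plane => ‖y - x‖ ^ 2) ((2 : ℝ) • (y - x)) y := by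
    rw [hasGradientAt_iff_hasFDerivAt]
    refine h1.congr_fderiv ?_
    ext w
    simp
  exact h2.gradient

/-- The supremum of a family of subsolutions is a subsolution. -/
theorem subTest_sup (hΩ : IsCompact (closure Ω)) (hb : Continuous (drift H)) (hlam : 0 < lam)
    (hG : ContinuousOn (Function.uncurry G) (closure Ω ×ˢ univ)) (hg : ContinuousOn g (frontier Ω))
    {𝓕 : Set (Plane → ℝ)} {U : Plane → ℝ} (hF : ∀ w ∈ 𝓕, (∃ C : ℝ, ∀ x ∈ closure Ω, |w x| ≤ C) ∧
      SubTest Ω H G g lam ε w) (hU : ∃ C : ℝ, ∀ x ∈ closure Ω, |U x| ≤ C)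
    (hle : ∀ w ∈ 𝓕, ∀ x ∈ closure Ω, w x ≤ U x)
    (hsup : ∀ x ∈ closure Ω, ∀ a < U x, ∃ w ∈ 𝓕, a < w x) : SubTest Ω H G g lam ε U := by
  intro φ hφ x hx hmax
  set S := closure Ω with hS
  obtain ⟨CU, hCU⟩ := hU
  set A := uscEnv S U x with hA
  by_contra! hcon
  obtain ⟨hF0, hgx⟩ := hcon
  -- The test function is made strict by adding `‖y - x‖²`.
  set ψ : Plane → ℝ := fun y => φ y + ‖y - x‖ ^ 2 with hψdef
  have hψ : ContDiff ℝ 1 ψ := hφ.add (contDiff_dist_sq x)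
  have hψg : ∇ ψ x = ∇ φ x := by
    rw [hψdef, gradient_add (hφ.differentiable one_ne_zero x)
      ((contDiff_dist_sq x).differentiable one_ne_zero x), gradient_norm_sub_sq]
    simp
  set κ := hjOp H G lam ε x A (∇ φ x) with hκ
  have hlk : 0 < κ / 2 / lam := by positivity
  have hψc : ∀ c > 0, ∀ᶠ y in 𝓝[S] x, |ψ y - ψ x| < c := fun c hc =>
    mem_nhdsWithin_of_mem_nhds (Metric.tendsto_nhds.1 hψ.continuous.continuousAt c hc)
  have e1 : ∀ᶠ y in 𝓝[S] x, κ / 2 < hjOp H G lam ε y A (∇ ψ y) := by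
    refine (continuousWithinAt_hjOp hb hG hx continuousWithinAt_const
      (continuous_gradient hψ).continuousWithinAt).eventually_const_lt ?_
    simp only [hψg]
    linarith
  have e2 : ∃ τ > 0, ∀ᶠ y in 𝓝[S] x, y ∈ frontier Ω → g y < A - τ := by
    by_cases hxf : x ∈ frontier Ω
    · refine ⟨(A - g x) / 2, by linarith [hgx hxf], ?_⟩
      have := (hg x hxf).eventually_lt_const (show g x < A - (A - g x) / 2 by linarith [hgx hxf])
      exact mem_nhdsWithin_of_mem_nhds (eventually_nhdsWithin_iff.1 this)
    · refine ⟨1, one_pos, mem_nhdsWithin_of_mem_nhds ?_⟩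
      filter_upwards [isClosed_frontier.isOpen_compl.mem_nhds hxf] with y hy hyf
      exact absurd hyf hy
  obtain ⟨τ, hτ, e2⟩ := e2
  set τ' := min τ (κ / 2 / lam) with hτ'
  have hτ'pos : 0 < τ' := lt_min hτ hlk
  have e3 := hψc (τ' / 2) (by positivity)
  obtain ⟨r, hr, hrS⟩ := Metric.nhdsWithin_basis_ball.mem_iff.1
    (inter_mem (inter_mem (inter_mem e1 e2) e3) hmax)
  have hball : ∀ y ∈ Metric.closedBall x (r / 2) ∩ S, y ∈ Metric.ball x r ∩ S := fun y hy =>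
    ⟨Metric.closedBall_subset_ball (by linarith) hy.1, hy.2⟩
  set ρ := r / 4 with hρ
  set η := min (ρ ^ 2) (τ' / 2) with hη
  have hηpos : 0 < η := lt_min (by positivity) (by positivity)
  -- A member of the family nearly attaining the envelope of the supremum at `x`.
  obtain ⟨y₁, ⟨hUy₁, hψy₁, hy₁r⟩, hy₁S⟩ : ∃ y, (A - η / 2 < U y ∧ |ψ y - ψ x| < η / 2 ∧
      y ∈ Metric.ball x ρ) ∧ y ∈ S := by
    have h1 := frequently_lt_of_lt_uscEnv (subset_closure hx) (locBdd_of_bdd hCU x)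
      (show A - η / 2 < uscEnv S U x by linarith)
    have h2 := hψc (η / 2) (by positivity)
    have h3 : ∀ᶠ y in 𝓝[S] x, y ∈ Metric.ball x ρ :=
      mem_nhdsWithin_of_mem_nhds (Metric.ball_mem_nhds x (by positivity))
    obtain ⟨y, hy1, hy2⟩ := (h1.and_eventually ((h2.and h3).and self_mem_nhdsWithin)).exists
    exact ⟨y, ⟨hy1, hy2.1⟩, hy2.2⟩
  obtain ⟨w, hwF, hwy₁⟩ := hsup y₁ hy₁S _ hUy₁
  obtain ⟨⟨Cw, hCw⟩, hwtest⟩ := hF w hwF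
  have hwU : ∀ y ∈ S, uscEnv S w y ≤ uscEnv S U y := fun y hy =>
    uscEnv_mono (subset_closure hy) (locBdd_of_bdd hCw y) (locBdd_of_bdd hCU y)
      (eventually_mem_nhdsWithin.mono fun y hy => hle w hwF y hy)
  have hmaxr : ∀ y ∈ Metric.closedBall x (r / 2) ∩ S, uscEnv S U y - φ y ≤ A - φ x :=
    fun y hy => (hrS (hball y hy)).2
  have hψx : ψ x = φ x := by simp [hψdef]
  obtain ⟨y, ⟨hyK, hyM⟩, hyloc, hyval⟩ := exists_isLocalMaxOn (S := S) (u := w) (φ := ψ)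
    (c := A - ψ x - η) (K := Metric.closedBall x (r / 2) ∩ S) (M := Metric.ball x ρ)
    (hΩ.inter_left Metric.isClosed_closedBall) inter_subset_right (LocBddOn_of_bdd hCw)
    hψ.continuous.continuousOn
    (fun y hy => inter_mem (mem_nhdsWithin_of_mem_nhds (mem_of_superset
      (Metric.isOpen_ball.mem_nhds hy) ((Metric.ball_subset_ball (by linarith)).trans
        Metric.ball_subset_closedBall))) self_mem_nhdsWithin)
    (fun y hy hyM => by
      have h1 := hwU y hy.2
      have h2 := hmaxr y hy
      have h3 : ρ ^ 2 ≤ ‖y - x‖ ^ 2 := by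
        rw [Metric.mem_ball, not_lt, dist_eq_norm] at hyM
        gcongr
      have h4 : η ≤ ρ ^ 2 := min_le_left _ _
      simp only [hψdef, sub_self, norm_zero]
      linarith)
    ⟨y₁, ⟨Metric.ball_subset_closedBall (Metric.ball_subset_ball (by linarith) hy₁r), hy₁S⟩, by
      have := le_uscEnv hy₁S (locBdd_of_bdd hCw y₁)
      have := (abs_lt.1 hψy₁).2
      linarith⟩
  have hyr := hrS (hball y hyK)
  have hy3 : _ ∧ _ := abs_lt.1 (show |ψ y - ψ x| < τ' / 2 from hyr.1.2)
  have hη2 : η ≤ τ' / 2 := min_le_right _ _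
  have hlow : A - τ' < uscEnv S w y := by linarith [hy3.1]
  rcases hwtest ψ hψ y hyK.2 hyloc with h | h
  · rw [hjOp_sub_left y _ A] at h
    have h1 := hyr.1.1.1
    simp only [mem_ofPred_eq] at h1
    have h2 : lam * (A - uscEnv S w y) ≤ lam * (κ / 2 / lam) := by
      have : τ' ≤ κ / 2 / lam := min_le_right _ _
      gcongr
      linarith
    rw [mul_div_cancel₀ _ hlam.ne'] at h2
    linarith
  · have h1 := hyr.1.1.2 h.1
    have : τ' ≤ τ := min_le_left _ _
    linarith [h.2]


/-- If the lower envelope of a subsolution fails the supersolution test at some point, the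
subsolution can be raised near this point. -/
theorem exists_subTest_gt (hΩ : IsOpen Ω) (hb : Continuous (drift H)) (hlam : 0 < lam)
    (hG : ContinuousOn (Function.uncurry G) (closure Ω ×ˢ univ)) (hg : ContinuousOn g (frontier Ω))
    {U : Plane → ℝ} (hU : ∃ C : ℝ, ∀ x ∈ closure Ω, |U x| ≤ C) (htest : SubTest Ω H G g lam ε U)
    {φ : Plane → ℝ} (hφ : ContDiff ℝ 1 φ) {x : Plane} (hx : x ∈ closure Ω)
    (hmin : IsLocalMinOn (fun y => lscEnv (closure Ω) U y - φ y) (closure Ω) x)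
    (hF : hjOp H G lam ε x (lscEnv (closure Ω) U x) (∇ φ x) < 0)
    (hgx : x ∈ frontier Ω → lscEnv (closure Ω) U x < g x) :
    ∃ V : Plane → ℝ, (∃ C : ℝ, ∀ x ∈ closure Ω, |V x| ≤ C) ∧ SubTest Ω H G g lam ε V ∧
      ∃ y ∈ closure Ω, U y < V y := by
  classical
  set S := closure Ω with hS
  obtain ⟨CU, hCU⟩ := hU
  have hCUn : ∀ x ∈ S, |-U x| ≤ CU := fun x hx => by rw [abs_neg]; exact hCU x hx
  set A := lscEnv S U x with hA
  set ψ : Plane → ℝ := fun y => (φ y - ‖y - x‖ ^ 2) + (A - φ x) with hψdef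
  have hψ : ContDiff ℝ 1 ψ := (hφ.sub (contDiff_dist_sq x)).add contDiff_const
  have hψg : ∇ ψ x = ∇ φ x := by
    rw [hψdef, gradient_add_const', gradient_sub (hφ.differentiable one_ne_zero x)
      ((contDiff_dist_sq x).differentiable one_ne_zero x), gradient_norm_sub_sq]
    simp
  have hψx : ψ x = A := by simp [hψdef]
  set κ := -hjOp H G lam ε x A (∇ φ x) with hκ
  have hκpos : 0 < κ := by linarith
  have e1 : ∀ᶠ y in 𝓝[S] x, hjOp H G lam ε y (ψ y) (∇ ψ y) < -(κ / 2) := by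
    refine (continuousWithinAt_hjOp hb hG hx hψ.continuous.continuousWithinAt
      (continuous_gradient hψ).continuousWithinAt).eventually_lt_const ?_
    simp only [hψg, hψx]
    linarith
  have e2 : ∃ τ > 0, ∀ᶠ y in 𝓝[S] x, y ∈ frontier Ω → ψ y + τ < g y := by
    by_cases hxf : x ∈ frontier Ω
    · refine ⟨(g x - A) / 2, by linarith [hgx hxf], ?_⟩
      have h1 : ContinuousWithinAt (fun y => g y - ψ y) (frontier Ω) x :=
        (hg x hxf).sub hψ.continuous.continuousWithinAt
      have := h1.eventually_const_lt
        (show (g x - A) / 2 < g x - ψ x by rw [hψx]; linarith [hgx hxf])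
      filter_upwards [mem_nhdsWithin_of_mem_nhds (eventually_nhdsWithin_iff.1 this)] with y hy hyf
      linarith [hy hyf]
    · refine ⟨1, one_pos, mem_nhdsWithin_of_mem_nhds ?_⟩
      filter_upwards [isClosed_frontier.isOpen_compl.mem_nhds hxf] with y hy hyf
      exact absurd hyf hy
  obtain ⟨τ, hτ, e2⟩ := e2
  have e3 : ∀ᶠ y in 𝓝[S] x, y ∈ S ∧ ψ y + ‖y - x‖ ^ 2 ≤ U y := by
    filter_upwards [hmin, self_mem_nhdsWithin] with y hy hyS
    have h1 : lscEnv S U y ≤ U y := by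
      rw [lscEnv_eq_neg]
      linarith [le_uscEnv hyS (locBdd_of_bdd hCUn y)]
    refine ⟨hyS, ?_⟩
    simp only [hψdef]
    linarith
  obtain ⟨r, hr, hrS⟩ := Metric.nhdsWithin_basis_ball.mem_iff.1 (inter_mem (inter_mem e1 e2) e3)
  set δ := min (min τ (κ / 2 / lam)) ((r / 2) ^ 2) with hδ
  have hδpos : 0 < δ := lt_min (lt_min hτ (by positivity)) (by positivity)
  have hδτ : δ ≤ τ := (min_le_left _ _).trans (min_le_left _ _)
  have hδκ : lam * δ ≤ κ / 2 := by
    have : δ ≤ κ / 2 / lam := (min_le_left _ _).trans (min_le_right _ _)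
    calc lam * δ ≤ lam * (κ / 2 / lam) := by gcongr
      _ = κ / 2 := mul_div_cancel₀ _ hlam.ne'
  have hδr : δ ≤ (r / 2) ^ 2 := min_le_right _ _
  set v : Plane → ℝ := fun y => ψ y + δ with hv
  have hvcont : Continuous v := hψ.continuous.add continuous_const
  set V : Plane → ℝ := fun y => if y ∈ Metric.ball x r then max (U y) (v y) else U y with hV
  have hring : ∀ y ∈ S, r / 2 ≤ ‖y - x‖ → V y = U y := by
    intro y hy hyr
    by_cases hyb : y ∈ Metric.ball x r
    · have h1 := (hrS ⟨hyb, hy⟩).2.2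
      have h2 : (r / 2) ^ 2 ≤ ‖y - x‖ ^ 2 := by gcongr
      simp only [hV, if_pos hyb]
      refine max_eq_left ?_
      simp only [hv]
      linarith
    · simp only [hV, if_neg hyb]
  have hUV : ∀ y, U y ≤ V y := fun y => by
    simp only [hV]
    split_ifs
    · exact le_max_left _ _
    · exact le_rfl
  obtain ⟨Cv, hCv⟩ := (isCompact_closedBall x r).exists_bound_of_continuousOn hvcont.continuousOn
  have hVb : ∀ y ∈ S, |V y| ≤ max CU Cv := by
    intro y hy
    simp only [hV]
    split_ifs with hyb
    · rcases max_choice (U y) (v y) with h | h <;> rw [h]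
      · exact (hCU y hy).trans (le_max_left _ _)
      · exact (hCv y (Metric.ball_subset_closedBall hyb)).trans (le_max_right _ _)
    · exact (hCU y hy).trans (le_max_left _ _)
  have hVl := fun y => locBdd_of_bdd hVb y
  have hUl := fun y => locBdd_of_bdd hCU y
  have hUVenv : ∀ y ∈ S, uscEnv S U y ≤ uscEnv S V y := fun y hy =>
    uscEnv_mono (subset_closure hy) (hUl y) (hVl y) (Eventually.of_forall hUV)
  have hout : ∀ y ∈ S, r / 2 < ‖y - x‖ → uscEnv S V y = uscEnv S U y := by
    intro y hy hyr
    refine uscEnv_congr ?_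
    have h1 : ∀ᶠ w in 𝓝 y, r / 2 < ‖w - x‖ :=
      ((continuous_id.sub continuous_const).norm.continuousAt (x := y)).eventually_const_lt hyr
    filter_upwards [mem_nhdsWithin_of_mem_nhds h1, self_mem_nhdsWithin] with w hw hwS
    exact hring w hwS hw.le
  have hin : ∀ y ∈ S, y ∈ Metric.ball x r → v y ≤ uscEnv S V y ∧
      uscEnv S V y ≤ max (uscEnv S U y) (v y) := by
    intro y hy hyb
    have hev : ∀ᶠ w in 𝓝[S] y, V w = max (U w) (v w) := by
      filter_upwards [mem_nhdsWithin_of_mem_nhds (Metric.isOpen_ball.mem_nhds hyb)] with w hw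
      simp only [hV, if_pos hw]
    constructor
    · refine le_trans ?_ (le_uscEnv hy (hVl y))
      rw [hev.self_of_nhdsWithin hy]
      exact le_max_right _ _
    · refine le_of_forall_gt_imp_ge_of_dense fun c hc => ?_
      obtain ⟨hc1, hc2⟩ := max_lt_iff.1 hc
      refine uscEnv_le (subset_closure hy) (hVl y) ?_
      filter_upwards [hev, eventually_lt_of_uscEnv_lt (hUl y) hc1,
        mem_nhdsWithin_of_mem_nhds (hvcont.continuousAt.eventually_lt_const hc2)] with w h1 h2 h3
      rw [h1]
      exact (max_lt h2 h3).le
  refine ⟨V, ⟨_, hVb⟩, ?_, ?_⟩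
  · intro χ hχ y hy hmax
    -- Where the envelopes of `U` and `V` agree, the test for `V` is the test for `U`.
    have hsame : uscEnv S V y = uscEnv S U y → hjOp H G lam ε y (uscEnv S V y) (∇ χ y) ≤ 0 ∨
        (y ∈ frontier Ω ∧ uscEnv S V y ≤ g y) := by
      intro heq
      rw [heq]
      refine htest χ hχ y hy ?_
      filter_upwards [hmax, self_mem_nhdsWithin] with w hw hwS
      have := hUVenv w hwS
      rw [heq] at hw
      linarith
    by_cases hyr : r / 2 < ‖y - x‖
    · exact hsame (hout y hy hyr)
    have hyb : y ∈ Metric.ball x r := by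
      rw [Metric.mem_ball, dist_eq_norm]
      linarith
    obtain ⟨h1, h2⟩ := hin y hy hyb
    rcases le_total (v y) (uscEnv S U y) with hle | hle
    · rw [max_eq_left hle] at h2
      exact hsame (le_antisymm h2 (hUVenv y hy))
    · rw [max_eq_right hle] at h2
      have heq : uscEnv S V y = v y := le_antisymm h2 h1
      rw [heq]
      have hyS := hrS ⟨hyb, hy⟩
      by_cases hyΩ : y ∈ Ω
      · left
        have hloc : IsLocalMax (fun w => v w - χ w) y := by
          rw [IsLocalMaxOn, IsMaxFilter, nhdsWithin_closure_of_mem hΩ hyΩ,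
            hΩ.nhdsWithin_eq hyΩ] at hmax
          filter_upwards [hmax, hΩ.mem_nhds hyΩ, Metric.isOpen_ball.mem_nhds hyb] with w hw hwΩ hwb
          have := (hin w (subset_closure hwΩ) hwb).1
          rw [heq] at hw
          linarith
        have hgrad : ∇ χ y = ∇ ψ y := by
          have h0 := gradient_eq_zero_of_isLocalMax hloc
          have hvd : DifferentiableAt ℝ v y :=
            (hψ.differentiable one_ne_zero y).add_const δ
          rw [gradient_sub hvd (hχ.differentiable one_ne_zero y), hv, gradient_add_const',
            sub_eq_zero] at h0
          exact h0.symm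
        rw [hgrad, hjOp_sub_left y _ (ψ y)]
        have h3 : hjOp H G lam ε y (ψ y) (∇ ψ y) < -(κ / 2) := hyS.1.1
        have h4 : v y - ψ y = δ := by simp [hv]
        rw [h4]
        linarith
      · right
        have hyf : y ∈ frontier Ω := by
          rw [hΩ.frontier_eq]
          exact ⟨hy, hyΩ⟩
        refine ⟨hyf, ?_⟩
        have h3 := hyS.1.2 hyf
        simp only [hv]
        linarith
  · have h1 : ∃ᶠ y in 𝓝[S] x, -A - δ / 2 < -U y :=
      frequently_lt_of_lt_uscEnv (subset_closure hx) (locBdd_of_bdd hCUn x) (by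
        have := lscEnv_eq_neg S U x
        linarith)
    have h2 : ∀ᶠ y in 𝓝[S] x, A - δ / 2 < ψ y := mem_nhdsWithin_of_mem_nhds
      (hψ.continuous.continuousAt.eventually_const_lt (by rw [hψx]; linarith))
    have h3 : ∀ᶠ y in 𝓝[S] x, y ∈ Metric.ball x r :=
      mem_nhdsWithin_of_mem_nhds (Metric.ball_mem_nhds x hr)
    obtain ⟨y, hy1, hy2, hy3, hyS⟩ :=
      (h1.and_eventually (h2.and (h3.and self_mem_nhdsWithin))).exists
    refine ⟨y, hyS, ?_⟩
    simp only [hV, if_pos hy3, lt_max_iff]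
    right
    simp only [hv]
    linarith

/-- Perron's method: the Dirichlet problem has a viscosity solution for every `ε`. -/
theorem solutionSet_nonempty (hΩ : IsOpen Ω) (hcpt : IsCompact (closure Ω))
    (hb : Continuous (drift H)) (hlam : 0 < lam)
    (hG : ContinuousOn (Function.uncurry G) (closure Ω ×ˢ univ))
    (hg : ContinuousOn g (frontier Ω)) {M : ℝ} (hMG : ∀ x ∈ closure Ω, |G x 0| ≤ lam * M)
    (hMg : ∀ x ∈ frontier Ω, |g x| ≤ M) : (solutionSet Ω H G g lam ε).Nonempty := by
  set S := closure Ω with hS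
  let 𝓕 : Set (Plane → ℝ) :=
    {w | (∃ C : ℝ, ∀ x ∈ S, |w x| ≤ C) ∧ SubTest Ω H G g lam ε w}
  have hup : ∀ w ∈ 𝓕, ∀ x ∈ S, w x ≤ M := fun w hw x hx => by
    obtain ⟨⟨C, hC⟩, ht⟩ := hw
    exact (le_uscEnv hx (locBdd_of_bdd hC x)).trans (uscEnv_le_of_subTest hcpt hlam
      (fun y hy => by linarith [(abs_le.1 (hMG y hy)).1])
      (fun y hy => (abs_le.1 (hMg y hy)).2) ⟨C, hC⟩ ht hx)
  have hconst : (fun _ => -M) ∈ 𝓕 := by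
    refine ⟨⟨|M|, fun x _ => by rw [abs_neg]⟩, fun φ hφ x hx hmax => ?_⟩
    have henv : ∀ y ∈ S, uscEnv S (fun _ => -M) y = -M := fun y hy =>
      uscEnv_const (subset_closure hy) _
    change hjOp H G lam ε x (uscEnv S (fun _ => -M) x) (∇ φ x) ≤ 0 ∨
      (x ∈ frontier Ω ∧ uscEnv S (fun _ => -M) x ≤ g x)
    rw [henv x hx]
    by_cases hxΩ : x ∈ Ω
    · left
      have hloc : IsLocalMin φ x := by
        rw [IsLocalMaxOn, IsMaxFilter, nhdsWithin_closure_of_mem hΩ hxΩ,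
          hΩ.nhdsWithin_eq hxΩ] at hmax
        filter_upwards [hmax, hΩ.mem_nhds hxΩ] with y hy hyΩ
        have h1 := henv y (subset_closure hyΩ)
        have h2 := henv x hx
        simp only [hS] at h1 h2
        rw [h1, h2] at hy
        linarith
      rw [gradient_eq_zero_of_isLocalMin hloc]
      simp only [hjOp, inner_zero_right, mul_zero, sub_zero]
      linarith [(abs_le.1 (hMG x hx)).2]
    · right
      have hxf : x ∈ frontier Ω := by
        rw [hΩ.frontier_eq]
        exact ⟨hx, hxΩ⟩
      exact ⟨hxf, (abs_le.1 (hMg x hxf)).1⟩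
  set U : Plane → ℝ := fun x => sSup ((fun w : Plane → ℝ => w x) '' 𝓕) with hU
  have hbdd : ∀ x ∈ S, BddAbove ((fun w : Plane → ℝ => w x) '' 𝓕) := fun x hx =>
    ⟨M, by rintro _ ⟨w, hw, rfl⟩; exact hup w hw x hx⟩
  have hne : ∀ x, ((fun w : Plane → ℝ => w x) '' 𝓕).Nonempty := fun x => ⟨_, _, hconst, rfl⟩
  have hleU : ∀ w ∈ 𝓕, ∀ x ∈ S, w x ≤ U x := fun w hw x hx =>
    le_csSup (hbdd x hx) ⟨w, hw, rfl⟩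
  have hUb : ∃ C : ℝ, ∀ x ∈ S, |U x| ≤ C := ⟨M, fun x hx => abs_le.2
    ⟨hleU _ hconst x hx, csSup_le (hne x) (by rintro _ ⟨w, hw, rfl⟩; exact hup w hw x hx)⟩⟩
  have hUtest : SubTest Ω H G g lam ε U := subTest_sup hcpt hb hlam hG hg (fun w hw => hw) hUb hleU
    fun x hx a ha => by
      obtain ⟨_, ⟨w, hw, rfl⟩, haw⟩ := exists_lt_of_lt_csSup (hne x) ha
      exact ⟨w, hw, haw⟩
  refine ⟨U, (mem_solutionSet_iff hΩ).2 ⟨hUb, hUtest, fun φ hφ x hx hmax => ?_⟩⟩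
  by_contra! hcon
  obtain ⟨hF, hgx⟩ := hcon
  have hl := lscEnv_eq_neg S U x
  obtain ⟨V, hVb, hVt, y, hy, hlt⟩ := exists_subTest_gt hΩ hb hlam hG hg hUb hUtest
    (φ := fun y => -φ y) hφ.neg hx (by
      filter_upwards [hmax] with y hy
      rw [lscEnv_eq_neg, lscEnv_eq_neg]
      linarith) (by
      rw [gradient_neg, ← neg_neg (hjOp _ _ _ _ _ _ _), ← hjOp_neg, neg_neg, hl, neg_neg]
      linarith) (fun hxf => by
      have := hgx hxf
      rw [hl]
      linarith)
  exact absurd (hleU V ⟨hVb, hVt⟩ y hy) (not_le.2 hlt)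

end Perron

/-! ### Half-relaxed limits -/

/-- The standing assumptions on the Dirichlet problem under which it has viscosity solutions,
bounded uniformly in `ε`. -/
structure IsProblem (Ω : Set Plane) (H : Plane → ℝ) (G : Plane → Plane → ℝ) (g : Plane → ℝ)
    (lam : ℝ) : Prop where
  isOpen : IsOpen Ω
  isCompact : IsCompact (closure Ω)
  continuous_drift : Continuous (drift H)
  lam_pos : 0 < lam
  continuousOn_G : ContinuousOn (Function.uncurry G) (closure Ω ×ˢ univ)
  continuousOn_g : ContinuousOn g (frontier Ω)

namespace IsProblem

variable {Ω : Set Plane} {H : Plane → ℝ} {G : Plane → Plane → ℝ} {g : Plane → ℝ} {lam : ℝ}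

theorem dual (hP : IsProblem Ω H G g lam) : IsProblem Ω H (dualG G) (fun x => -g x) lam where
  isOpen := hP.isOpen
  isCompact := hP.isCompact
  continuous_drift := hP.continuous_drift
  lam_pos := hP.lam_pos
  continuousOn_G := by
    have : ContinuousOn (fun q : Plane × Plane => Function.uncurry G (q.1, -q.2))
        (closure Ω ×ˢ univ) :=
      hP.continuousOn_G.comp (by fun_prop) fun q hq => ⟨hq.1, mem_univ _⟩
    exact this.neg
  continuousOn_g := hP.continuousOn_g.neg

theorem continuousOn_G_zero (hP : IsProblem Ω H G g lam) :
    ContinuousOn (fun x => G x 0) (closure Ω) :=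
  hP.continuousOn_G.comp (f := fun x : Plane => (x, (0 : Plane))) (by fun_prop)
    fun x hx => ⟨hx, mem_univ _⟩

theorem exists_bound (hP : IsProblem Ω H G g lam) :
    ∃ M : ℝ, (∀ x ∈ closure Ω, |G x 0| ≤ lam * M) ∧ ∀ x ∈ frontier Ω, |g x| ≤ M := by
  obtain ⟨C₁, h₁⟩ := hP.isCompact.exists_bound_of_continuousOn hP.continuousOn_G_zero
  obtain ⟨C₂, h₂⟩ := (hP.isCompact.of_isClosed_subset isClosed_frontier
    frontier_subset_closure).exists_bound_of_continuousOn hP.continuousOn_g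
  refine ⟨max (C₁ / lam) C₂, fun x hx => ?_, fun x hx => (h₂ x hx).trans (le_max_right _ _)⟩
  calc |G x 0| ≤ C₁ := h₁ x hx
    _ = lam * (C₁ / lam) := (mul_div_cancel₀ _ hP.lam_pos.ne').symm
    _ ≤ lam * max (C₁ / lam) C₂ :=
      mul_le_mul_of_nonneg_left (le_max_left _ _) hP.lam_pos.le

theorem exists_solution_bound (hP : IsProblem Ω H G g lam) :
    ∃ M : ℝ, ∀ ε, ∀ u ∈ solutionSet Ω H G g lam ε, ∀ x ∈ closure Ω, |u x| ≤ M := by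
  obtain ⟨M, hMG, hMg⟩ := hP.exists_bound
  refine ⟨M, fun ε u hu x hx => ?_⟩
  obtain ⟨⟨C, hC⟩, h1, h2⟩ := (mem_solutionSet_iff hP.isOpen).1 hu
  have hC' : ∀ x ∈ closure Ω, |-u x| ≤ C := fun x hx => by rw [abs_neg]; exact hC x hx
  have e1 := uscEnv_le_of_subTest hP.isCompact hP.lam_pos
    (fun y hy => by linarith [(abs_le.1 (hMG y hy)).1]) (fun y hy => (abs_le.1 (hMg y hy)).2)
    ⟨C, hC⟩ h1 hx
  have e2 := uscEnv_le_of_subTest hP.isCompact hP.lam_pos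
    (fun y hy => by
      simp only [dualG, neg_zero, neg_neg]
      exact (abs_le.1 (hMG y hy)).2)
    (fun y hy => by linarith [(abs_le.1 (hMg y hy)).1]) ⟨C, hC'⟩ h2 hx
  have e3 := le_uscEnv hx (locBdd_of_bdd hC x)
  have e4 := le_uscEnv hx (locBdd_of_bdd hC' x)
  exact abs_le.2 ⟨by linarith, by linarith⟩

theorem solutionSet_nonempty (hP : IsProblem Ω H G g lam) (ε : ℝ) :
    (solutionSet Ω H G g lam ε).Nonempty := by
  obtain ⟨M, hMG, hMg⟩ := hP.exists_bound
  exact HamiltonianAveraging.solutionSet_nonempty hP.isOpen hP.isCompact hP.continuous_drift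
    hP.lam_pos hP.continuousOn_G hP.continuousOn_g hMG hMg

theorem nearValues_nonempty (hP : IsProblem Ω H G g lam) {x : Plane} (hx : x ∈ closure Ω) {r : ℝ}
    (hr : 0 < r) : (nearValues Ω H G g lam x r).Nonempty := by
  obtain ⟨u, hu⟩ := hP.solutionSet_nonempty (r / 2)
  exact ⟨u x, r / 2, ⟨by positivity, by linarith⟩, u, hu, x, ⟨Metric.mem_ball_self hr, hx⟩, rfl⟩

theorem nearValues_mono {x : Plane} {r r' : ℝ} (h : r ≤ r') :
    nearValues Ω H G g lam x r ⊆ nearValues Ω H G g lam x r' := by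
  rintro a ⟨ε, hε, u, hu, y, hy, rfl⟩
  exact ⟨ε, ⟨hε.1, hε.2.trans_le h⟩, u, hu, y, ⟨Metric.ball_subset_ball h hy.1, hy.2⟩, rfl⟩

theorem abs_le_of_mem_nearValues {M : ℝ}
    (hM : ∀ ε, ∀ u ∈ solutionSet Ω H G g lam ε, ∀ x ∈ closure Ω, |u x| ≤ M) {x : Plane} {r a : ℝ}
    (ha : a ∈ nearValues Ω H G g lam x r) : |a| ≤ M := by
  obtain ⟨ε, -, u, hu, y, hy, rfl⟩ := ha
  exact hM ε u hu y hy.2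

theorem bddAbove_nearValues (hP : IsProblem Ω H G g lam) (x : Plane) (r : ℝ) :
    BddAbove (nearValues Ω H G g lam x r) := by
  obtain ⟨M, hM⟩ := hP.exists_solution_bound
  exact ⟨M, fun a ha => (abs_le.1 (abs_le_of_mem_nearValues hM ha)).2⟩

/-- The suprema defining the half-relaxed limit decrease as `r → 0+`, so the limit exists. -/
theorem tendsto_vPlus (hP : IsProblem Ω H G g lam) {x : Plane} (hx : x ∈ closure Ω) :
    Tendsto (fun r => sSup (nearValues Ω H G g lam x r)) (𝓝[>] 0)
      (𝓝 (vPlus Ω H G g lam x)) := by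
  obtain ⟨M, hM⟩ := hP.exists_solution_bound
  have hmono : MonotoneOn (fun r => sSup (nearValues Ω H G g lam x r)) (Ioi 0) :=
    fun r hr r' _ h => csSup_le_csSup (hP.bddAbove_nearValues x r')
      (hP.nearValues_nonempty hx hr) (nearValues_mono h)
  have hbdd : BddBelow ((fun r => sSup (nearValues Ω H G g lam x r)) '' Ioi 0) := by
    refine ⟨-M, ?_⟩
    rintro _ ⟨r, hr, rfl⟩
    obtain ⟨a, ha⟩ := hP.nearValues_nonempty hx hr
    exact (abs_le.1 (abs_le_of_mem_nearValues hM ha)).1.trans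
      (le_csSup (hP.bddAbove_nearValues x r) ha)
  have h := hmono.tendsto_nhdsGT hbdd
  rw [vPlus, h.limUnder_eq]
  exact h

theorem exists_lt_of_vPlus_lt (hP : IsProblem Ω H G g lam) {x : Plane} (hx : x ∈ closure Ω) {c : ℝ}
    (hc : vPlus Ω H G g lam x < c) : ∃ r > 0, ∀ ε ∈ Ioo 0 r, ∀ u ∈ solutionSet Ω H G g lam ε,
      ∀ y ∈ Metric.ball x r ∩ closure Ω, u y < c := by
  have h1 := (hP.tendsto_vPlus hx).eventually_lt_const hc
  obtain ⟨r, hr, hr0⟩ := (h1.and self_mem_nhdsWithin).exists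
  exact ⟨r, hr0, fun ε hε u hu y hy =>
    (le_csSup (hP.bddAbove_nearValues x r) ⟨ε, hε, u, hu, y, hy, rfl⟩).trans_lt hr⟩

theorem exists_gt_of_lt_vPlus (hP : IsProblem Ω H G g lam) {x : Plane} (hx : x ∈ closure Ω) {c : ℝ}
    (hc : c < vPlus Ω H G g lam x) {r : ℝ} (hr : 0 < r) :
    ∃ ε ∈ Ioo 0 r, ∃ u ∈ solutionSet Ω H G g lam ε, ∃ y ∈ Metric.ball x r ∩ closure Ω,
      c < u y := by
  have h1 := (hP.tendsto_vPlus hx).eventually_const_lt hc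
  obtain ⟨r', hr', hr0⟩ := (h1.and (Ioc_mem_nhdsGT hr)).exists
  obtain ⟨_, ⟨ε, hε, u, hu, y, hy, rfl⟩, hlt⟩ :=
    exists_lt_of_lt_csSup (hP.nearValues_nonempty hx hr0.1) hr'
  exact ⟨ε, ⟨hε.1, hε.2.trans_le hr0.2⟩, u, hu, y,
    ⟨Metric.ball_subset_ball hr0.2 hy.1, hy.2⟩, hlt⟩

theorem exists_vPlus_bound (hP : IsProblem Ω H G g lam) :
    ∃ M : ℝ, ∀ x ∈ closure Ω, |vPlus Ω H G g lam x| ≤ M := by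
  obtain ⟨M, hM⟩ := hP.exists_solution_bound
  refine ⟨M, fun x hx => abs_le.2 ⟨?_, ?_⟩⟩
  · by_contra! h
    obtain ⟨r, hr, h1⟩ := hP.exists_lt_of_vPlus_lt hx h
    obtain ⟨u, hu⟩ := hP.solutionSet_nonempty (r / 2)
    have h2 := h1 (r / 2) ⟨by positivity, by linarith⟩ u hu x ⟨Metric.mem_ball_self hr, hx⟩
    linarith [(abs_le.1 (hM _ u hu x hx)).1]
  · by_contra! h
    obtain ⟨ε, -, u, hu, y, hy, hlt⟩ := hP.exists_gt_of_lt_vPlus hx h one_pos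
    linarith [(abs_le.1 (hM _ u hu y hy.2)).2]

/-- The lower limit is minus the upper limit of the dual problem. -/
theorem vMinus_eq (hP : IsProblem Ω H G g lam) {x : Plane} (hx : x ∈ closure Ω) :
    vMinus Ω H G g lam x = -vPlus Ω H (dualG G) (fun x => -g x) lam x := by
  have hset : ∀ r, nearValues Ω H (dualG G) (fun x => -g x) lam x r =
      -nearValues Ω H G g lam x r := by
    intro r
    ext a
    rw [Set.mem_neg]
    constructor
    · rintro ⟨ε, hε, u, hu, y, hy, rfl⟩
      have := neg_mem_solutionSet hP.isOpen hu
      simp only [dualG_dualG, neg_neg] at this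
      exact ⟨ε, hε, _, this, y, hy, rfl⟩
    · rintro ⟨ε, hε, u, hu, y, hy, h⟩
      exact ⟨ε, hε, _, neg_mem_solutionSet hP.isOpen hu, y, hy, by linarith⟩
  have h := (hP.dual.tendsto_vPlus hx).neg
  simp only [hset, Real.sSup_neg, neg_neg] at h
  exact h.limUnder_eq

/-- On a compact set, strict upper bounds for the half-relaxed limit are upper bounds for all
solutions with small `ε`. -/
theorem uscEnv_lt_of_vPlus_lt (hP : IsProblem Ω H G g lam) {R : Set Plane} (hR : IsCompact R)
    (hRΩ : R ⊆ closure Ω) {c : Plane → ℝ} (hc : ContinuousOn c R)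
    (hlt : ∀ x ∈ R, vPlus Ω H G g lam x < c x) :
    ∃ ε₀ > 0, ∀ ε ∈ Ioo 0 ε₀, ∀ u ∈ solutionSet Ω H G g lam ε, ∀ y ∈ R,
      uscEnv (closure Ω) u y < c y := by
  obtain ⟨M, hM⟩ := hP.exists_solution_bound
  refine hR.induction_on (p := fun s => ∃ ε₀ > (0 : ℝ), ∀ ε ∈ Ioo 0 ε₀,
    ∀ u ∈ solutionSet Ω H G g lam ε, ∀ y ∈ s, uscEnv (closure Ω) u y < c y) ?_ ?_ ?_ ?_
  · exact ⟨1, one_pos, fun _ _ _ _ y hy => absurd hy (notMem_empty y)⟩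
  · rintro s t hst ⟨ε₀, h0, h⟩
    exact ⟨ε₀, h0, fun ε hε u hu y hy => h ε hε u hu y (hst hy)⟩
  · rintro s t ⟨ε₁, h1, h1'⟩ ⟨ε₂, h2, h2'⟩
    refine ⟨min ε₁ ε₂, lt_min h1 h2, fun ε hε u hu y hy => ?_⟩
    rcases hy with hy | hy
    · exact h1' ε ⟨hε.1, hε.2.trans_le (min_le_left _ _)⟩ u hu y hy
    · exact h2' ε ⟨hε.1, hε.2.trans_le (min_le_right _ _)⟩ u hu y hy
  · intro x hx
    obtain ⟨d, hd, hdc⟩ := exists_between (hlt x hx)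
    obtain ⟨r, hr, hru⟩ := hP.exists_lt_of_vPlus_lt (hRΩ hx) hd
    refine ⟨{y | y ∈ R ∧ y ∈ Metric.ball x r ∧ d < c y}, ?_, r, hr, fun ε hε u hu y hy => ?_⟩
    · filter_upwards [self_mem_nhdsWithin, mem_nhdsWithin_of_mem_nhds (Metric.ball_mem_nhds x hr),
        (hc x hx).eventually_const_lt hdc] with y h1 h2 h3
      exact ⟨h1, h2, h3⟩
    · refine lt_of_le_of_lt ?_ hy.2.2
      have hyS := hRΩ hy.1
      refine uscEnv_le (subset_closure hyS) (locBdd_of_bdd (hM ε u hu) y) ?_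
      filter_upwards [self_mem_nhdsWithin,
        mem_nhdsWithin_of_mem_nhds (Metric.isOpen_ball.mem_nhds hy.2.1)] with w hw1 hw2
      exact (hru ε hε u hu w ⟨hw2, hw1⟩).le

end IsProblem

/-! ### Uniformity near a level curve -/

/-- What holds near every point of a level curve holds on a thin band around it. -/
theorem IsBand.exists_thin_band {H : Plane → ℝ} {W : Set Plane} {I : Set ℝ} (hH : Continuous H)
    (hW : IsBand H W I) {s : ℝ} (hs : s ∈ I) {V : Set Plane} (hV : IsOpen V)
    (hsub : W ∩ H ⁻¹' {s} ⊆ V) :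
    ∃ r > 0, Icc (s - r) (s + r) ⊆ I ∧ ∀ y ∈ W, |H y - s| ≤ r → y ∈ V := by
  obtain ⟨r₀, hr₀, hr₀I⟩ := Metric.nhds_basis_closedBall.mem_iff.1 (hW.isOpen_levels.mem_nhds hs)
  rw [Real.closedBall_eq_Icc] at hr₀I
  have hK := (hW.isCompact _ _ hr₀I).diff hV
  have hmem : ∀ y ∈ W, |H y - s| ≤ r₀ → y ∉ V → y ∈ (W ∩ H ⁻¹' Icc (s - r₀) (s + r₀)) \ V :=
    fun y hy hle hyV => ⟨⟨hy, by
      rw [abs_le] at hle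
      exact ⟨by linarith [hle.1], by linarith [hle.2]⟩⟩, hyV⟩
  have hsubI : ∀ r ≤ r₀, Icc (s - r) (s + r) ⊆ I := fun r hr =>
    (Icc_subset_Icc (by linarith) (by linarith)).trans hr₀I
  rcases ((W ∩ H ⁻¹' Icc (s - r₀) (s + r₀)) \ V).eq_empty_or_nonempty with hem | hne
  · refine ⟨r₀, hr₀, hr₀I, fun y hy hle => ?_⟩
    by_contra hyV
    exact notMem_empty y (hem ▸ hmem y hy hle hyV)
  · have hc : Continuous fun y => |H y - s| := (hH.sub continuous_const).abs
    obtain ⟨x, hx, hmin⟩ := hK.exists_isMinOn hne hc.continuousOn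
    have hpos : 0 < |H x - s| := by
      rw [abs_pos, sub_ne_zero]
      exact fun h => hx.2 (hsub ⟨hx.1.1, h⟩)
    refine ⟨min r₀ (|H x - s| / 2), lt_min hr₀ (by positivity), hsubI _ (min_le_left _ _),
      fun y hy hle => ?_⟩
    by_contra hyV
    have h1 := hmin (hmem y hy (hle.trans (min_le_left _ _)) hyV)
    have h2 := hle.trans (min_le_right _ _)
    simp only [mem_ofPred_eq] at h1
    linarith

/-- The version of `IsBand.exists_thin_band` with a small parameter. -/
theorem IsBand.exists_thin_band_param {H : Plane → ℝ} {W S : Set Plane} {I : Set ℝ}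
    (hH : Continuous H) (hW : IsBand H W I) {s : ℝ} (hs : s ∈ I) {P : ℝ → Plane → Prop}
    (hP : ∀ x ∈ W ∩ H ⁻¹' {s}, ∀ᶠ q in 𝓝 (0 : ℝ) ×ˢ 𝓝[S] x, P q.1 q.2) :
    ∃ r > 0, Icc (s - r) (s + r) ⊆ I ∧
      ∀ ε ∈ Ioo 0 r, ∀ y ∈ W ∩ S, |H y - s| ≤ r → P ε y := by
  have key : ∃ r > (0 : ℝ), ∃ V : Set Plane, IsOpen V ∧ W ∩ H ⁻¹' {s} ⊆ V ∧
      ∀ ε ∈ Ioo 0 r, ∀ y ∈ V ∩ S, P ε y := by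
    refine (hW.isCompact_level hs).induction_on (p := fun t => ∃ r > (0 : ℝ), ∃ V : Set Plane,
      IsOpen V ∧ t ⊆ V ∧ ∀ ε ∈ Ioo 0 r, ∀ y ∈ V ∩ S, P ε y) ?_ ?_ ?_ ?_
    · exact ⟨1, one_pos, ∅, isOpen_empty, Subset.rfl, fun _ _ y hy => absurd hy.1 (notMem_empty y)⟩
    · rintro t t' htt ⟨r, hr, V, hV, htV, h⟩
      exact ⟨r, hr, V, hV, htt.trans htV, h⟩
    · rintro t t' ⟨r, hr, V, hV, htV, h⟩ ⟨r', hr', V', hV', htV', h'⟩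
      refine ⟨min r r', lt_min hr hr', V ∪ V', hV.union hV', union_subset_union htV htV', ?_⟩
      rintro ε hε y ⟨hy | hy, hyS⟩
      · exact h ε ⟨hε.1, hε.2.trans_le (min_le_left _ _)⟩ y ⟨hy, hyS⟩
      · exact h' ε ⟨hε.1, hε.2.trans_le (min_le_right _ _)⟩ y ⟨hy, hyS⟩
    · intro x hx
      obtain ⟨A, hA, B, hB, hAB⟩ := mem_prod_iff.1 (hP x hx)
      obtain ⟨r, hr, hrA⟩ := Metric.mem_nhds_iff.1 hA
      obtain ⟨V, hV, hxV, hVB⟩ := mem_nhdsWithin.1 hB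
      refine ⟨V, mem_nhdsWithin_of_mem_nhds (hV.mem_nhds hxV), r, hr, V, hV, Subset.rfl,
        fun ε hε y hy => ?_⟩
      refine hAB (mk_mem_prod (hrA ?_) (hVB hy))
      rw [Metric.mem_ball, Real.dist_eq, sub_zero, abs_of_pos hε.1]
      exact hε.2
  obtain ⟨r, hr, V, hV, hsub, h⟩ := key
  obtain ⟨r', hr', hI, h'⟩ := hW.exists_thin_band hH hs hV hsub
  refine ⟨min r r', lt_min hr hr', (Icc_subset_Icc (by linarith [min_le_right r r'])
    (by linarith [min_le_right r r'])).trans hI, fun ε hε y hy hle => ?_⟩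
  exact h ε ⟨hε.1, hε.2.trans_le (min_le_left _ _)⟩ y
    ⟨h' y hy.1 (hle.trans (min_le_right _ _)), hy.2⟩

/-! ### The perturbed test function -/

section

variable {H : Plane → ℝ} {G : Plane → Plane → ℝ} {g : Plane → ℝ} {lam ε : ℝ}

theorem gradient_comp_real {χ : ℝ → ℝ} {x : Plane} (hχ : DifferentiableAt ℝ χ (H x))
    (hH : DifferentiableAt ℝ H x) : ∇ (fun y => χ (H y)) x = deriv χ (H x) • ∇ H x := by
  simp only [gradient]
  have h : HasFDerivAt (fun y => χ (H y)) (deriv χ (H x) • fderiv ℝ H x) x :=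
    hχ.hasDerivAt.comp_hasFDerivAt x hH.hasFDerivAt
  rw [h.fderiv, map_smul]

/-- The large drift term sees neither functions of `H` nor more than the order-`ε` part of the test
function. -/
theorem hjOp_perturbed (hε : ε ≠ 0) (x : Plane) (a q : ℝ) (p : Plane) :
    hjOp H G lam ε x a (q • ∇ H x + ε • p) =
      lam * a - inner ℝ (drift H x) p + G x (q • ∇ H x + ε • p) := by
  rw [hjOp, inner_add_right, inner_smul_right, inner_smul_right, inner_drift_gradient]
  field_simp
  ring

theorem gradient_perturbed {χ : ℝ → ℝ} {ψ : Plane → ℝ} {x : Plane}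
    (hχ : DifferentiableAt ℝ χ (H x)) (hH : DifferentiableAt ℝ H x)
    (hψ : DifferentiableAt ℝ ψ x) :
    ∇ (fun y => χ (H y) + ε * ψ y) x = deriv χ (H x) • ∇ H x + ε • ∇ ψ x := by
  rw [gradient_add (φ := fun y => χ (H y)) (hχ.comp x hH) (hψ.const_mul ε),
    gradient_comp_real hχ hH, gradient_const_smul ε hψ]

end

namespace IsEdge

variable {H : Plane → ℝ} {Ω W : Set Plane} {I : Set ℝ} {σ e : ℝ} {G : Plane → Plane → ℝ}
  {g : Plane → ℝ} {lam : ℝ}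

theorem level_subset_closure (hE : IsEdge H Ω W I σ e) {s : ℝ} (hs : s ∈ I ∩ {s | 0 ≤ σ * (s - e)}) :
    W ∩ H ⁻¹' {s} ⊆ closure Ω := by
  rintro x ⟨hxW, hxs⟩
  rw [mem_preimage, mem_singleton_iff] at hxs
  rw [hE.mem_closure_iff hxW, hxs]
  exact hs.2

theorem le_sSup_level (hE : IsEdge H Ω W I σ e) {v : Plane → ℝ} {C : ℝ}
    (hC : ∀ x ∈ closure Ω, |v x| ≤ C) {x : Plane} (hxW : x ∈ W) (hx : x ∈ closure Ω) :
    v x ≤ sSup (v '' (W ∩ H ⁻¹' {H x})) := by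
  refine le_csSup ⟨C, ?_⟩ ⟨x, ⟨hxW, rfl⟩, rfl⟩
  rintro _ ⟨y, hy, rfl⟩
  refine (abs_le.1 (hC y (hE.level_subset_closure ⟨?_, ?_⟩ hy))).2
  · exact hE.band.mem_levels x hxW
  · exact (hE.mem_closure_iff hxW).1 hx

theorem abs_sSup_level_le (hE : IsEdge H Ω W I σ e) {v : Plane → ℝ} {C : ℝ}
    (hC : ∀ x ∈ closure Ω, |v x| ≤ C) {s : ℝ} (hs : s ∈ I ∩ {s | 0 ≤ σ * (s - e)}) :
    |sSup (v '' (W ∩ H ⁻¹' {s}))| ≤ C := by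
  have hsub := hE.level_subset_closure hs
  obtain ⟨x, hx⟩ := hE.band.nonempty s hs.1
  have hbdd : ∀ a ∈ v '' (W ∩ H ⁻¹' {s}), a ≤ C := by
    rintro _ ⟨y, hy, rfl⟩
    exact (abs_le.1 (hC y (hsub hy))).2
  refine abs_le.2 ⟨(abs_le.1 (hC x (hsub hx))).1.trans (le_csSup ⟨C, hbdd⟩ ⟨x, hx, rfl⟩), ?_⟩
  exact csSup_le ⟨_, x, hx, rfl⟩ hbdd

set_option maxHeartbeats 600000 in
/-- The averaging principle. At a level where the upper envelope of `s ↦ max v⁺` over the level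
curves is touched from above by `φ`, the effective inequality holds, provided that `g` is below
the envelope in case the level is the boundary level `e`. -/
theorem effective_le_zero (hE : IsEdge H Ω W I σ e) (hP : IsProblem Ω H G g lam) {φ : ℝ → ℝ}
    (hφ : ContDiff ℝ 1 φ) {s : ℝ} (hs : s ∈ I ∩ {s | 0 ≤ σ * (s - e)}) {m : ℝ → ℝ}
    (hm : ∀ t ∈ I ∩ {s | 0 ≤ σ * (s - e)}, m t = sSup (vPlus Ω H G g lam '' (W ∩ H ⁻¹' {t})))
    (hmax : IsLocalMaxOn (fun t => uscEnv (I ∩ {s | 0 ≤ σ * (s - e)}) m t - φ t)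
      (I ∩ {s | 0 ≤ σ * (s - e)}) s)
    (hbd : s = e → ∀ x ∈ W ∩ H ⁻¹' {s}, g x < uscEnv (I ∩ {s | 0 ≤ σ * (s - e)}) m s) :
    lam * uscEnv (I ∩ {s | 0 ≤ σ * (s - e)}) m s +
      1 / (∫ x in W ∩ H ⁻¹' {s}, 1 / ‖∇ H x‖ ∂(Measure.hausdorffMeasure 1)) *
        ∫ x in W ∩ H ⁻¹' {s}, G x (deriv φ s • ∇ H x) / ‖∇ H x‖ ∂(Measure.hausdorffMeasure 1)
      ≤ 0 := by
  set E := I ∩ {s | 0 ≤ σ * (s - e)} with hEdef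
  set A := uscEnv E m s with hA
  set Gbar := 1 / (∫ x in W ∩ H ⁻¹' {s}, 1 / ‖∇ H x‖ ∂(Measure.hausdorffMeasure 1)) *
        ∫ x in W ∩ H ⁻¹' {s}, G x (deriv φ s • ∇ H x) / ‖∇ H x‖ ∂(Measure.hausdorffMeasure 1)
    with hGbar
  by_contra! hκ
  set κ := lam * A + Gbar with hκdef
  have hH1 : ContDiff ℝ 1 H := hE.contDiff.of_le (by norm_num)
  have hHc : Continuous H := hH1.continuous
  have hHd : Differentiable ℝ H := hH1.differentiable one_ne_zero
  have hlam := hP.lam_pos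
  obtain ⟨Mv, hMv⟩ := hP.exists_vPlus_bound
  obtain ⟨Mu, hMu⟩ := hP.exists_solution_bound
  have hmM : ∀ t ∈ E, |m t| ≤ Mv := fun t ht => by
    rw [hm t ht]
    exact hE.abs_sSup_level_le hMv ht
  have hmb := LocBddOn_of_bdd hmM
  have hlevsub : W ∩ H ⁻¹' {s} ⊆ closure Ω := hE.level_subset_closure hs
  have hGcont : ∀ q : ℝ, ContinuousOn (fun x => G x (q • ∇ H x)) (closure Ω) := fun q =>
    hP.continuousOn_G.comp (f := fun x : Plane => (x, q • ∇ H x))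
      (continuous_id.prodMk ((continuous_gradient hH1).const_smul q)).continuousOn
      fun x hx => ⟨hx, mem_univ _⟩
  -- The corrector removes the oscillation of `G` along the level curve.
  obtain ⟨ψ, hψ, hψe⟩ := hE.band.exists_corrector hE.contDiff hs.1
    ((hGcont (deriv φ s)).mono hlevsub)
  have hψd : Differentiable ℝ ψ := hψ.differentiable one_ne_zero
  have hφ' : Continuous (deriv φ) := hφ.continuous_deriv le_rfl
  set χ : ℝ → ℝ := fun t => φ t + (t - s) ^ 2 with hχdef
  have hχ : ContDiff ℝ 1 χ := hφ.add ((contDiff_id.sub contDiff_const).pow 2)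
  have hχd : Differentiable ℝ χ := hχ.differentiable one_ne_zero
  have hχs : deriv χ s = deriv φ s := by
    have h1 : HasDerivAt χ (deriv φ s + 2 * (s - s)) s := by
      have h2 := ((hasDerivAt_id s).sub_const s).pow 2
      have h3 := (hφ.differentiable one_ne_zero s).hasDerivAt.add h2
      exact h3.congr_deriv (by simp)
    rw [h1.deriv]
    ring
  have hχ' : Continuous (deriv χ) := hχ.continuous_deriv le_rfl
  -- On the level the operator applied to the perturbed test function equals `κ`, so it exceeds
  -- `κ / 2` nearby.
  obtain ⟨r₁, hr₁, hr₁I, hthin⟩ := hE.band.exists_thin_band_param (S := closure Ω) hHc hs.1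
    (P := fun ε y => κ / 2 < lam * A - inner ℝ (drift H y) (∇ ψ y) +
      G y (deriv χ (H y) • ∇ H y + ε • ∇ ψ y)) (by
    intro x hx
    have hxΩ := hlevsub hx
    have hxs : H x = s := hx.2
    have hc : ContinuousWithinAt (fun q : ℝ × Plane => lam * A -
        inner ℝ (drift H q.2) (∇ ψ q.2) + G q.2 (deriv χ (H q.2) • ∇ H q.2 + q.1 • ∇ ψ q.2))
        (univ ×ˢ closure Ω) (0, x) := by
      refine ContinuousWithinAt.add ?_ ?_
      · refine (Continuous.continuousWithinAt ?_)
        have hb := hP.continuous_drift.comp (continuous_snd (X := ℝ) (Y := Plane))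
        have hp := (continuous_gradient hψ).comp (continuous_snd (X := ℝ) (Y := Plane))
        exact continuous_const.sub (hb.inner hp)
      · refine ContinuousWithinAt.comp (t := closure Ω ×ˢ univ)
          (f := fun q : ℝ × Plane => (q.2, deriv χ (H q.2) • ∇ H q.2 + q.1 • ∇ ψ q.2))
          (hP.continuousOn_G _ ⟨hxΩ, mem_univ _⟩) (Continuous.continuousWithinAt ?_)
          fun q hq => ⟨hq.2, mem_univ _⟩
        have h1 := (continuous_gradient hψ).comp (continuous_snd (X := ℝ) (Y := Plane))
        have h2 := (continuous_gradient hH1).comp (continuous_snd (X := ℝ) (Y := Plane))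
        have h3 := (hχ'.comp hHc).comp (continuous_snd (X := ℝ) (Y := Plane))
        exact continuous_snd.prodMk ((h3.smul h2).add (continuous_fst.smul h1))
    have hval : lam * A - inner ℝ (drift H x) (∇ ψ x) +
        G x (deriv χ (H x) • ∇ H x + (0 : ℝ) • ∇ ψ x) = κ := by
      rw [hψe x hx, zero_smul, add_zero, hxs, hχs, hκdef, hGbar]
      ring
    have hlt : κ / 2 < lam * A - inner ℝ (drift H x) (∇ ψ x) +
        G x (deriv χ (H x) • ∇ H x + (0 : ℝ) • ∇ ψ x) := by
      rw [hval]
      linarith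
    have := hc.eventually_const_lt hlt
    rwa [nhdsWithin_prod_eq, nhdsWithin_univ] at this)
  -- At points where `u > A - δ` neither the equation nor the boundary condition can hold.
  obtain ⟨δ, hδ, hδlam, hδg⟩ : ∃ δ > 0, lam * δ ≤ κ / 2 ∧
      (s = e → ∀ x ∈ W ∩ H ⁻¹' {s}, g x ≤ A - δ) := by
    by_cases hse : s = e
    · have hfr : W ∩ H ⁻¹' {s} ⊆ frontier Ω := fun x hx =>
        (hE.mem_frontier_iff hx.1).2 ((show H x = s from hx.2).trans hse)
      obtain ⟨x₀, hx₀, hx₀max⟩ := (hE.band.isCompact_level hs.1).exists_isMaxOn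
        (hE.band.nonempty s hs.1) (hP.continuousOn_g.mono hfr)
      have h0 := hbd hse x₀ hx₀
      refine ⟨min (κ / 2 / lam) (A - g x₀), lt_min (by positivity) (by linarith), ?_,
        fun _ x hx => ?_⟩
      · calc lam * min (κ / 2 / lam) (A - g x₀) ≤ lam * (κ / 2 / lam) := by
              gcongr
              exact min_le_left _ _
          _ = κ / 2 := mul_div_cancel₀ _ hlam.ne'
      · have h1 : g x ≤ g x₀ := hx₀max hx
        linarith [min_le_right (κ / 2 / lam) (A - g x₀)]
    · exact ⟨κ / 2 / lam, by positivity, (mul_div_cancel₀ _ hlam.ne').le, fun h => absurd h hse⟩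
  -- The radius of the band.
  obtain ⟨r, hr, hrr₁, hrφ, hrmax, hre⟩ : ∃ r > 0, r ≤ r₁ ∧ (∀ t, |t - s| ≤ r → |φ t - φ s| < δ / 4) ∧
      (∀ t ∈ E, |t - s| ≤ r → m t ≤ A - φ s + φ t) ∧ (s ≠ e → r < |e - s|) := by
    obtain ⟨a, ha, hφa⟩ := Metric.continuousAt_iff.1 hφ.continuous.continuousAt (δ / 4)
      (by positivity)
    obtain ⟨b, hb, hmb'⟩ := Metric.mem_nhdsWithin_iff.1 hmax
    obtain ⟨d, hd, hde⟩ : ∃ d > 0, (s ≠ e → d < |e - s|) := by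
      by_cases hse : s = e
      · exact ⟨1, one_pos, fun h => absurd hse h⟩
      · have : 0 < |e - s| := abs_pos.2 (sub_ne_zero.2 (Ne.symm hse))
        exact ⟨|e - s| / 2, by positivity, fun _ => by linarith⟩
    refine ⟨min (min r₁ d) (min (a / 2) (b / 2)), by positivity,
      (min_le_left _ _).trans (min_le_left _ _), fun t ht => ?_, fun t htE ht => ?_,
      fun h => ((min_le_left _ _).trans (min_le_right _ _)).trans_lt (hde h)⟩
    · have h1 := ht.trans ((min_le_right _ _).trans (min_le_left _ _))
      exact hφa (by rw [Real.dist_eq]; linarith)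
    · have h1 := ht.trans ((min_le_right _ _).trans (min_le_right _ _))
      have h2 : uscEnv E m t - φ t ≤ A - φ s :=
        hmb' ⟨by rw [Metric.mem_ball, Real.dist_eq]; linarith, htE⟩
      linarith [le_uscEnv htE (hmb t htE)]
  set R : Set Plane := W ∩ H ⁻¹' Icc (s - r) (s + r) ∩ closure Ω with hRdef
  have hmemR : ∀ {y : Plane}, y ∈ R ↔ (y ∈ W ∧ |H y - s| ≤ r) ∧ y ∈ closure Ω := by
    intro y
    rw [hRdef, mem_inter_iff, mem_inter_iff, mem_preimage, mem_Icc, abs_le]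
    constructor
    · rintro ⟨⟨h1, h2, h3⟩, h4⟩
      exact ⟨⟨h1, by linarith, by linarith⟩, h4⟩
    · rintro ⟨⟨h1, h2, h3⟩, h4⟩
      exact ⟨⟨h1, by linarith, by linarith⟩, h4⟩
  have hRc : IsCompact R := (hE.band.isCompact _ _
    ((Icc_subset_Icc (by linarith) (by linarith)).trans hr₁I)).inter_right isClosed_closure
  have hRE : ∀ y ∈ R, H y ∈ E := fun y hy =>
    ⟨hE.band.mem_levels y hy.1.1, (hE.mem_closure_iff hy.1.1).1 hy.2⟩
  obtain ⟨B, hB⟩ := hRc.exists_bound_of_continuousOn hψ.continuous.continuousOn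
  simp only [Real.norm_eq_abs] at hB
  -- On the outer part of the band the term `(H - s)²` keeps the solutions below the test function.
  obtain ⟨ε₀, hε₀, hout⟩ := hP.uscEnv_lt_of_vPlus_lt
    (R := R ∩ {y | r / 2 ≤ |H y - s|})
    (hRc.inter_right (isClosed_le continuous_const (hHc.sub continuous_const).abs))
    (fun y hy => hy.1.2) (c := fun y => A - φ s + χ (H y) - r ^ 2 / 8)
    (((continuous_const.add (hχ.continuous.comp hHc)).sub continuous_const).continuousOn)
    (by
      rintro y ⟨hy, hyr⟩
      have hyr' : r / 2 ≤ |H y - s| := hyr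
      have h1 := hrmax (H y) (hRE y hy) (hmemR.1 hy).1.2
      have h2 := hE.le_sSup_level hMv hy.1.1 hy.2
      rw [← hm _ (hRE y hy)] at h2
      have h3 : r ^ 2 / 4 ≤ (H y - s) ^ 2 := by
        rw [← sq_abs (H y - s)]
        nlinarith
      simp only [hχdef]
      nlinarith)
  set η := min (δ / 4) (r ^ 2 / 16) with hηdef
  have hη : 0 < η := by positivity
  have hη1 : η ≤ δ / 4 := min_le_left _ _
  have hη2 : η ≤ r ^ 2 / 16 := min_le_right _ _
  have hχcont : ContinuousAt χ s := hχ.continuous.continuousAt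
  have hχss : χ s = φ s := by simp [hχdef]
  -- A point near the level, and a solution, with values close to `A`.
  obtain ⟨t, htA, htE, htr, htχ⟩ : ∃ t, A - η / 8 < m t ∧ t ∈ E ∧ |t - s| < r ∧
      |χ t - φ s| < η / 8 := by
    have h1 := frequently_lt_of_lt_uscEnv (subset_closure hs) (hmb s hs)
      (show A - η / 8 < uscEnv E m s by linarith)
    have h2 : ∀ᶠ t in 𝓝[E] s, |χ t - χ s| < η / 8 := nhdsWithin_le_nhds
      (Metric.tendsto_nhds.1 hχcont (η / 8) (by positivity))
    have h3 : ∀ᶠ t in 𝓝[E] s, |t - s| < r := nhdsWithin_le_nhds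
      (Metric.tendsto_nhds.1 continuousAt_id r hr)
    obtain ⟨t, ⟨⟨h4, h5⟩, h6⟩, h7⟩ := (((h1.and_eventually h2).and_eventually h3).and_eventually
      self_mem_nhdsWithin).exists
    exact ⟨t, h4, h7, h6, hχss ▸ h5⟩
  obtain ⟨x₁, hx₁, hx₁A⟩ : ∃ x ∈ W ∩ H ⁻¹' {t}, A - η / 8 < vPlus Ω H G g lam x := by
    rw [hm t htE] at htA
    obtain ⟨x, hx⟩ := hE.band.nonempty t htE.1
    obtain ⟨_, ⟨x', hx', rfl⟩, h⟩ := exists_lt_of_lt_csSup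
      (⟨_, x, hx, rfl⟩ : (vPlus Ω H G g lam '' (W ∩ H ⁻¹' {t})).Nonempty) htA
    exact ⟨x', hx', h⟩
  have hHx₁ : H x₁ = t := hx₁.2
  have hx₁Ω := hE.level_subset_closure htE hx₁
  have hnear : ∀ᶠ y in 𝓝 x₁, y ∈ W ∧ |H y - s| < r ∧ |χ (H y) - φ s| < η / 8 := by
    refine (eventually_mem_set.2 (hE.band.isOpen.mem_nhds hx₁.1)).and (Eventually.and ?_ ?_)
    · have hc : Continuous fun y => |H y - s| := (hHc.sub continuous_const).abs
      exact hc.continuousAt.eventually_lt_const (by simpa only [hHx₁] using htr)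
    · have hc : Continuous fun y => |χ (H y) - φ s| :=
        ((hχ.continuous.comp hHc).sub continuous_const).abs
      exact hc.continuousAt.eventually_lt_const (by simpa only [hHx₁] using htχ)
  obtain ⟨ρ, hρ, hball⟩ := Metric.eventually_nhds_iff_ball.1 hnear
  have hBpos : 0 < |B| + 1 := by positivity
  obtain ⟨ε, hε, u, hu, y₁, hy₁, huy₁⟩ := hP.exists_gt_of_lt_vPlus hx₁Ω hx₁A
    (r := min (min ρ ε₀) (min r₁ (η / 2 / (|B| + 1)))) (by positivity)
  have hε0 : 0 < ε := hε.1
  have hερ := hε.2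
  rw [lt_min_iff, lt_min_iff, lt_min_iff] at hερ
  obtain ⟨⟨-, hεε₀⟩, hεr₁, hεη⟩ := hερ
  have hεψ : ∀ y ∈ R, |ε * ψ y| ≤ η / 2 := by
    intro y hy
    rw [abs_mul, abs_of_pos hε0]
    have h1 : |ψ y| ≤ |B| + 1 := (hB y hy).trans ((le_abs_self B).trans (by linarith))
    rw [lt_div_iff₀ hBpos] at hεη
    nlinarith
  have hy₁' := hball y₁ (Metric.ball_subset_ball ((min_le_left _ _).trans (min_le_left _ _)) hy₁.1)
  have huC : ∀ x ∈ closure Ω, |u x| ≤ Mu := hMu ε u hu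
  have hub := LocBddOn_of_bdd huC
  obtain ⟨-, htest, -⟩ := (mem_solutionSet_iff hP.isOpen).1 hu
  have hwC : ContDiff ℝ 1 (fun y => χ (H y) + ε * ψ y) := (hχ.comp hH1).add (contDiff_const.mul hψ)
  obtain ⟨y, ⟨hyR, hyM⟩, hymax, hyc⟩ := exists_isLocalMaxOn (S := closure Ω) (u := u)
    (φ := fun y => χ (H y) + ε * ψ y) (c := A - φ s - η) (K := R)
    (M := {y | y ∈ W ∧ |H y - s| < r / 2}) hRc (fun y hy => hy.2) hub
    hwC.continuous.continuousOn
    (by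
      rintro y ⟨hyW, hyr⟩
      have hc : Continuous fun y => |H y - s| := (hHc.sub continuous_const).abs
      have h1 : ∀ᶠ y' in 𝓝 y, |H y' - s| < r :=
        hc.continuousAt.eventually_lt_const (by linarith)
      filter_upwards [mem_nhdsWithin_of_mem_nhds (hE.band.isOpen.mem_nhds hyW),
        nhdsWithin_le_nhds h1, self_mem_nhdsWithin] with y' h2 h3 h4
      exact hmemR.2 ⟨⟨h2, h3.le⟩, h4⟩)
    (by
      intro y hy hyM
      have h1 : r / 2 ≤ |H y - s| := by
        by_contra! h
        exact hyM ⟨hy.1.1, h⟩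
      have h2 := hout ε ⟨hε0, hεε₀⟩ u hu y ⟨hy, h1⟩
      have h3 := (abs_le.1 (hεψ y hy)).1
      linarith)
    (by
      refine ⟨y₁, hmemR.2 ⟨⟨hy₁'.1, hy₁'.2.1.le⟩, hy₁.2⟩, ?_⟩
      have hyR : y₁ ∈ R := hmemR.2 ⟨⟨hy₁'.1, hy₁'.2.1.le⟩, hy₁.2⟩
      have h1 := le_uscEnv hy₁.2 (hub y₁ hy₁.2)
      have h2 := (abs_lt.1 hy₁'.2.2).2
      have h3 := (abs_le.1 (hεψ y₁ hyR)).2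
      linarith)
  have hyRr := (hmemR.1 hyR).1.2
  have hval : A - δ < uscEnv (closure Ω) u y := by
    have h1 := (abs_lt.1 (hrφ (H y) hyRr)).1
    have h2 := (abs_le.1 (hεψ y hyR)).1
    have h3 : φ (H y) ≤ χ (H y) := by
      simp only [hχdef]
      nlinarith [sq_nonneg (H y - s)]
    linarith
  rcases htest _ hwC y hyR.2 hymax with h | ⟨hfr, hle⟩
  · rw [gradient_perturbed (hχd _) (hHd _) (hψd _), hjOp_perturbed hε0.ne'] at h
    have h1 := hthin ε ⟨hε0, hεr₁⟩ y ⟨hyR.1.1, hyR.2⟩ (hyRr.trans hrr₁)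
    have h2 := mul_lt_mul_of_pos_left hval hlam
    linarith
  · have hHy := (hE.mem_frontier_iff hyR.1.1).1 hfr
    by_cases hse : s = e
    · have h1 := hδg hse y ⟨hyR.1.1, by rw [mem_preimage, mem_singleton_iff, hHy, hse]⟩
      linarith
    · have h1 := hre hse
      rw [hHy] at hyRr
      linarith

end IsEdge

/-! ### The boundary condition for the upper limit -/

/-- The mean over a level curve of a nonnegative continuous function that is not identically zero
is positive. -/
theorem IsBand.mean_pos {H : Plane → ℝ} {W : Set Plane} {I : Set ℝ} (hH : ContDiff ℝ 2 H)
    (hW : IsBand H W I) {s : ℝ} (hs : s ∈ I) {f : Plane → ℝ}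
    (hf : ContinuousOn f (W ∩ H ⁻¹' {s})) (h0 : ∀ x ∈ W ∩ H ⁻¹' {s}, 0 ≤ f x) {y : Plane}
    (hy : y ∈ W ∩ H ⁻¹' {s}) (hfy : 0 < f y) :
    0 < 1 / (∫ x in W ∩ H ⁻¹' {s}, 1 / ‖∇ H x‖ ∂(Measure.hausdorffMeasure 1)) *
        ∫ x in W ∩ H ⁻¹' {s}, f x / ‖∇ H x‖ ∂(Measure.hausdorffMeasure 1) := by
  obtain ⟨X, T, hX, hT, hper, hran, -, hint⟩ := hW.exists_orbit_integral hH hs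
  rw [hint f, hint fun _ => 1]
  simp only [intervalIntegral.integral_const, smul_eq_mul, mul_one, sub_zero]
  refine mul_pos (by positivity) ?_
  obtain ⟨t, rfl⟩ := hran.ge hy
  obtain ⟨t', ht', htt'⟩ := hper.exists_mem_Ico₀ hT t
  exact intervalIntegral.integral_pos hT
    (hf.comp_continuous hX.continuous hX.2).continuousOn (fun r _ => h0 _ (hX.2 r))
    ⟨t', Ico_subset_Icc_self ht', by rw [← htt']; exact hfy⟩

/-- Comparison with a barrier `w` on a compact set `K` with inner part `M`. -/
theorem SubTest.uscEnv_le_barrier {Ω : Set Plane} {H : Plane → ℝ} {G : Plane → Plane → ℝ}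
    {g : Plane → ℝ} {lam ε : ℝ} {u : Plane → ℝ} (hu : SubTest Ω H G g lam ε u) (hlam : 0 < lam)
    {C : ℝ} (hC : ∀ x ∈ closure Ω, |u x| ≤ C) {K M : Set Plane} (hK : IsCompact K)
    (hKΩ : K ⊆ closure Ω) (hM : ∀ y ∈ M, K ∈ 𝓝[closure Ω] y) {w : Plane → ℝ}
    (hw : ContDiff ℝ 1 w) (hout : ∀ y ∈ K, y ∉ M → uscEnv (closure Ω) u y ≤ w y)
    (hfr : ∀ y ∈ K ∩ M, y ∈ frontier Ω → uscEnv (closure Ω) u y ≤ g y →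
      uscEnv (closure Ω) u y ≤ w y)
    (hint : ∀ y ∈ K ∩ M, w y < uscEnv (closure Ω) u y → 0 < hjOp H G lam ε y (-C) (∇ w y)) :
    ∀ y ∈ K, uscEnv (closure Ω) u y ≤ w y := by
  by_contra! hcon
  obtain ⟨y₁, hy₁, hlt⟩ := hcon
  obtain ⟨y, hy, hmax, hc⟩ := exists_isLocalMaxOn (c := 0) hK hKΩ (LocBddOn_of_bdd hC)
    hw.continuous.continuousOn hM (fun y hy hyM => by linarith [hout y hy hyM])
    ⟨y₁, hy₁, by linarith⟩
  rcases hu w hw y (hKΩ hy.1) hmax with h | ⟨h1, h2⟩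
  · have h1 := hint y hy (by linarith)
    have h2 := (abs_le.1 (abs_uscEnv_le hC (hKΩ hy.1))).1
    rw [hjOp_sub_left y _ (-C)] at h
    have h3 : 0 ≤ lam * (uscEnv (closure Ω) u y - -C) := mul_nonneg hlam.le (by linarith)
    linarith
  · linarith [hfr y hy h1 h2]

namespace IsEdge

variable {H : Plane → ℝ} {Ω W : Set Plane} {I : Set ℝ} {σ e : ℝ} {G : Plane → Plane → ℝ}
  {g : Plane → ℝ} {lam ε : ℝ} {u : Plane → ℝ}

/-- By coercivity, subsolutions satisfy the boundary condition in the classical sense: a steep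
function of `H` is not seen by the drift and forces the strict inequality. -/
theorem uscEnv_le_of_mem_level (hE : IsEdge H Ω W I σ e) (hP : IsProblem Ω H G g lam)
    (hG : CondG5 Ω G) {C : ℝ} (hC : ∀ x ∈ closure Ω, |u x| ≤ C)
    (hu : SubTest Ω H G g lam ε u) {x : Plane} (hx : x ∈ W ∩ H ⁻¹' {e}) :
    uscEnv (closure Ω) u x ≤ g x := by
  obtain ⟨ν, Mc, hν, hMc, hco⟩ := hG
  have hlam := hP.lam_pos
  have hH1 : ContDiff ℝ 1 H := hE.contDiff.of_le (by norm_num)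
  have hHx : H x = e := hx.2
  have hxfr : x ∈ frontier Ω := (hE.mem_frontier_iff hx.1).2 hHx
  have hxΩ : x ∈ closure Ω := frontier_subset_closure hxfr
  have hC0 : 0 ≤ C := (abs_nonneg _).trans (hC x hxΩ)
  by_contra! hlt
  set a := uscEnv (closure Ω) u x with ha
  have haC := (abs_le.1 (abs_uscEnv_le hC hxΩ)).1
  obtain ⟨τ, hτ, hgτ⟩ : ∃ τ > 0, g x < a - τ := ⟨(a - g x) / 2, by linarith, by linarith⟩
  have hg0 : 0 < ‖∇ H x‖ := norm_pos_iff.2 (hE.band.gradient_ne x hx.1)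
  have hgc : Continuous fun y => ‖∇ H y‖ := (continuous_gradient hH1).norm
  obtain ⟨ρ, hρ, hball⟩ : ∃ ρ > 0, ∀ y ∈ Metric.closedBall x ρ, y ∈ W ∧
      (y ∈ frontier Ω → g y < a - τ) ∧ ‖∇ H x‖ / 2 < ‖∇ H y‖ ∧ ‖∇ H y‖ < 2 * ‖∇ H x‖ := by
    have h1 : ∀ᶠ y in 𝓝 x, y ∈ W := eventually_mem_set.2 (hE.band.isOpen.mem_nhds hx.1)
    have h2 : ∀ᶠ y in 𝓝 x, y ∈ frontier Ω → g y < a - τ :=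
      eventually_nhdsWithin_iff.1 ((hP.continuousOn_g x hxfr).eventually_lt_const hgτ)
    have h3 : ∀ᶠ y in 𝓝 x, ‖∇ H x‖ / 2 < ‖∇ H y‖ :=
      hgc.continuousAt.eventually_const_lt (by linarith)
    have h4 : ∀ᶠ y in 𝓝 x, ‖∇ H y‖ < 2 * ‖∇ H x‖ :=
      hgc.continuousAt.eventually_lt_const (by linarith)
    obtain ⟨ρ, hρ, h⟩ := Metric.nhds_basis_closedBall.eventually_iff.1
      (h1.and (h2.and (h3.and h4)))
    exact ⟨ρ, hρ, fun y hy => h hy⟩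
  set k := (2 * C + τ) / ρ ^ 2 with hk
  have hk0 : 0 < k := by positivity
  set D := |ε⁻¹| * (2 * ‖∇ H x‖ * (2 * k * ρ)) with hD
  have hD0 : 0 ≤ D := by positivity
  set L := 2 * (lam * C + D + ν * (2 * k * ρ) + Mc + 1) / (ν * ‖∇ H x‖) with hL
  have hL0 : 0 < L := by positivity
  have hLe : ν * (L * (‖∇ H x‖ / 2)) = lam * C + D + ν * (2 * k * ρ) + Mc + 1 := by
    rw [hL]
    field_simp
  set w : Plane → ℝ := fun y => (k * ‖y - x‖ ^ 2 + L * σ * H y) + (a - τ - L * σ * e) with hw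
  have hsq := contDiff_dist_sq x
  have hwC : ContDiff ℝ 1 w :=
    ((contDiff_const.mul hsq).add (contDiff_const.mul hH1)).add contDiff_const
  have hgrad : ∀ y, ∇ w y = k • ((2 : ℝ) • (y - x)) + (L * σ) • ∇ H y := by
    intro y
    have h1 : DifferentiableAt ℝ (fun y : Plane => ‖y - x‖ ^ 2) y :=
      hsq.differentiable one_ne_zero y
    have h2 : DifferentiableAt ℝ H y := hH1.differentiable one_ne_zero y
    rw [hw, gradient_add_const', gradient_add (φ := fun y : Plane => k * ‖y - x‖ ^ 2)
      (h1.const_mul k) (h2.const_mul (L * σ)), gradient_const_smul k h1,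
      gradient_const_smul (L * σ) h2, gradient_norm_sub_sq]
  have hd0 : ∀ y ∈ W, y ∈ closure Ω → 0 ≤ σ * (H y - e) := fun y hy =>
    (hE.mem_closure_iff hy).1
  have hwge : ∀ y ∈ W, y ∈ closure Ω → a - τ + k * ‖y - x‖ ^ 2 ≤ w y := by
    intro y hyW hyΩ
    have := mul_nonneg hL0.le (hd0 y hyW hyΩ)
    simp only [hw]
    linarith
  have hσ : |σ| = 1 := by
    rcases hE.sign with h | h <;> simp [h]
  -- The quadratic term localizes at `x`, and the steep term `L σ (H - e)`, which vanishes on the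
  -- boundary, makes `w` a strict supersolution.
  have key := hu.uscEnv_le_barrier hlam hC (K := Metric.closedBall x ρ ∩ closure Ω)
    (M := Metric.ball x ρ) (w := w)
    ((isCompact_closedBall x ρ).inter_right isClosed_closure) inter_subset_right
    (fun y hy => inter_mem (mem_nhdsWithin_of_mem_nhds
      (mem_of_superset (Metric.isOpen_ball.mem_nhds hy) Metric.ball_subset_closedBall))
      self_mem_nhdsWithin) hwC
    (by
      rintro y ⟨hyB, hyΩ⟩ hyM
      have h1 := hwge y (hball y hyB).1 hyΩ
      have h2 : ρ ≤ ‖y - x‖ := by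
        rw [← dist_eq_norm]
        exact not_lt.1 hyM
      have h3 : k * ρ ^ 2 = 2 * C + τ := by
        rw [hk]
        field_simp
      have h4 : k * ρ ^ 2 ≤ k * ‖y - x‖ ^ 2 := by gcongr
      have h5 := (abs_le.1 (abs_uscEnv_le hC hyΩ)).2
      linarith)
    (by
      rintro y ⟨⟨hyB, hyΩ⟩, -⟩ hyfr hyg
      have h1 := hwge y (hball y hyB).1 hyΩ
      have h2 := (hball y hyB).2.1 hyfr
      have h3 : 0 ≤ k * ‖y - x‖ ^ 2 := by positivity
      linarith)
    (by
      rintro y ⟨⟨hyB, hyΩ⟩, -⟩ -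
      obtain ⟨hyW, -, hy1, hy2⟩ := hball y hyB
      have hyρ : ‖y - x‖ ≤ ρ := by
        rw [← dist_eq_norm]
        exact hyB
      have hp : ‖k • ((2 : ℝ) • (y - x))‖ ≤ 2 * k * ρ := by
        rw [norm_smul, norm_smul, Real.norm_of_nonneg hk0.le, Real.norm_two]
        nlinarith
      have hq : ‖(L * σ) • ∇ H y‖ = L * ‖∇ H y‖ := by
        rw [norm_smul, Real.norm_eq_abs, abs_mul, hσ, abs_of_pos hL0, mul_one]
      have h1 : L * (‖∇ H x‖ / 2) - 2 * k * ρ ≤ ‖∇ w y‖ := by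
        have h2 := norm_sub_le_norm_add ((L * σ) • ∇ H y) (k • ((2 : ℝ) • (y - x)))
        rw [hgrad, add_comm]
        have h3 : L * (‖∇ H x‖ / 2) ≤ L * ‖∇ H y‖ := by gcongr
        linarith
      have h2 := hco y hyΩ (∇ w y)
      have h3 : |ε⁻¹ * inner ℝ (drift H y) (∇ w y)| ≤ D := by
        rw [abs_mul, hgrad, inner_add_right, inner_smul_right (𝕜 := ℝ) _ (∇ H y),
          inner_drift_gradient, mul_zero, add_zero, hD]
        refine mul_le_mul_of_nonneg_left ?_ (abs_nonneg _)
        refine (abs_real_inner_le_norm _ _).trans ?_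
        rw [norm_drift]
        exact mul_le_mul hy2.le hp (norm_nonneg _) (by positivity)
      have h4 := (abs_le.1 h3).2
      have h5 := mul_le_mul_of_nonneg_left h1 hν.le
      rw [hjOp]
      linarith)
  have h1 := key x ⟨Metric.mem_closedBall_self hρ.le, hxΩ⟩
  simp only [hw, sub_self, norm_zero, hHx] at h1
  norm_num at h1
  linarith

/-- Near a compact level, `v⁺` inside the domain is at most slightly above any boundary value. In a
thin layer at the boundary the corrector carries the smallness of `g` near one point along the
whole level curve, and a steep function of `H` carries it from the layer to a fixed distance. -/
theorem exists_vPlus_le (hE : IsEdge H Ω W I σ e) (hP : IsProblem Ω H G g lam)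
    (hG : CondG5 Ω G) {y₀ : Plane} (hy₀ : y₀ ∈ W ∩ H ⁻¹' {e}) {c : ℝ} (hc : g y₀ < c) :
    ∃ r > 0, ∀ x ∈ W, 0 < σ * (H x - e) → σ * (H x - e) < r → vPlus Ω H G g lam x ≤ c := by
  obtain ⟨C₀, hC₀⟩ := hP.exists_solution_bound
  obtain ⟨ν, Mc, hν, hMc, hco⟩ := hG
  have hlam := hP.lam_pos
  have hH1 : ContDiff ℝ 1 H := hE.contDiff.of_le (by norm_num)
  have hHc : Continuous H := hH1.continuous
  have hHd : Differentiable ℝ H := hH1.differentiable one_ne_zero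
  have hσ : |σ| = 1 := by
    rcases hE.sign with h | h <;> simp [h]
  have hσσ : σ * σ = 1 := by
    rcases hE.sign with h | h <;> simp [h]
  have hfr : ∀ x ∈ W ∩ H ⁻¹' {e}, x ∈ frontier Ω := fun x hx =>
    (hE.mem_frontier_iff hx.1).2 hx.2
  have hdabs : ∀ x, |H x - e| = |σ * (H x - e)| := fun x => by rw [abs_mul, hσ, one_mul]
  set δ := (c - g y₀) / 4 with hδdef
  have hδ : 0 < δ := by
    rw [hδdef]
    linarith
  obtain ⟨C, hCC₀, hCg, hCpos⟩ : ∃ C, C₀ ≤ C ∧ |g y₀| ≤ C ∧ 0 < C :=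
    ⟨max C₀ (|g y₀| + 1), le_max_left _ _, by linarith [le_max_right C₀ (|g y₀| + 1)],
      lt_of_lt_of_le (by positivity) (le_max_right _ _)⟩
  have hC : ∀ ε, ∀ u ∈ solutionSet Ω H G g lam ε, ∀ x ∈ closure Ω, |u x| ≤ C :=
    fun ε u hu x hx => (hC₀ ε u hu x hx).trans hCC₀
  -- A ball around `y₀` with small boundary values.
  obtain ⟨ρ, hρ, hball⟩ : ∃ ρ > 0, ∀ y ∈ Metric.closedBall y₀ ρ, y ∈ frontier Ω →
      g y < g y₀ + δ := by
    have h2 : ∀ᶠ y in 𝓝 y₀, y ∈ frontier Ω → g y < g y₀ + δ :=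
      eventually_nhdsWithin_iff.1 ((hP.continuousOn_g y₀ (hfr y₀ hy₀)).eventually_lt_const
        (by linarith))
    obtain ⟨ρ, hρ, h⟩ := Metric.nhds_basis_closedBall.eventually_iff.1 h2
    exact ⟨ρ, hρ, fun y hy => h hy⟩
  -- A corrector that decreases fast along the drift off the ball.
  obtain ⟨ψ, hψ, hψlt⟩ : ∃ ψ : Plane → ℝ, ContDiff ℝ 1 ψ ∧
      ∀ x ∈ W ∩ H ⁻¹' {e}, x ∉ Metric.ball y₀ ρ →
        inner ℝ (drift H x) (∇ ψ x) < -(lam * C + Mc) := by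
    have hbump : Continuous fun x : Plane => max 0 (ρ - dist x y₀) := by fun_prop
    have hμ := hE.band.mean_pos hE.contDiff hE.mem hbump.continuousOn
      (fun x _ => le_max_left _ _) hy₀ (by simp [hρ])
    obtain ⟨ψ, hψ, hψe⟩ := hE.band.exists_corrector hE.contDiff hE.mem
      (hbump.continuousOn (s := W ∩ H ⁻¹' {e}))
    set μ := 1 / (∫ x in W ∩ H ⁻¹' {e}, 1 / ‖∇ H x‖ ∂(Measure.hausdorffMeasure 1)) *
        ∫ x in W ∩ H ⁻¹' {e}, max 0 (ρ - dist x y₀) / ‖∇ H x‖ ∂(Measure.hausdorffMeasure 1)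
      with hμdef
    set t := (lam * C + Mc + 1) / μ with ht
    refine ⟨fun x => t * ψ x, contDiff_const.mul hψ, fun x hx hxB => ?_⟩
    have h0 : max 0 (ρ - dist x y₀) = 0 := by
      refine max_eq_left ?_
      have : ρ ≤ dist x y₀ := not_lt.1 hxB
      linarith
    rw [gradient_const_smul t (hψ.differentiable one_ne_zero x), inner_smul_right, hψe x hx, h0,
      ht]
    have : (lam * C + Mc + 1) / μ * (0 - μ) = -(lam * C + Mc + 1) := by
      field_simp
      ring
    rw [this]
    linarith
  have hψd : Differentiable ℝ ψ := hψ.differentiable one_ne_zero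
  -- A band on which this persists.
  obtain ⟨r, hr, hrI, hband⟩ := hE.band.exists_thin_band hHc hE.mem
    (V := {x | inner ℝ (drift H x) (∇ ψ x) < -(lam * C + Mc)} ∪ Metric.ball y₀ ρ)
    ((isOpen_lt (hP.continuous_drift.inner (continuous_gradient hψ)) continuous_const).union
      Metric.isOpen_ball) (fun x hx => by
        by_cases hxB : x ∈ Metric.ball y₀ ρ
        · exact Or.inr hxB
        · exact Or.inl (hψlt x hx hxB))
  have hKc : ∀ b ≤ r, IsCompact ((W ∩ H ⁻¹' Icc (e - b) (e + b)) ∩ closure Ω) := fun b hb =>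
    (hE.band.isCompact _ _
      ((Icc_subset_Icc (by linarith) (by linarith)).trans hrI)).inter_right isClosed_closure
  have hmem : ∀ {b : ℝ} {y : Plane}, y ∈ (W ∩ H ⁻¹' Icc (e - b) (e + b)) ∩ closure Ω ↔
      y ∈ W ∧ 0 ≤ σ * (H y - e) ∧ σ * (H y - e) ≤ b := by
    intro b y
    rw [mem_inter_iff, mem_inter_iff, mem_preimage, mem_Icc]
    constructor
    · rintro ⟨⟨h1, h2, h3⟩, h4⟩
      refine ⟨h1, (hE.mem_closure_iff h1).1 h4, ?_⟩
      have : |H y - e| ≤ b := abs_le.2 ⟨by linarith, by linarith⟩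
      rw [hdabs] at this
      exact (le_abs_self _).trans this
    · rintro ⟨h1, h2, h3⟩
      have : |H y - e| ≤ b := by
        rw [hdabs, abs_of_nonneg h2]
        exact h3
      rw [abs_le] at this
      exact ⟨⟨h1, by linarith [this.1], by linarith [this.2]⟩, (hE.mem_closure_iff h1).2 h2⟩
  have hnhds : ∀ {b : ℝ} {y : Plane}, y ∈ W → σ * (H y - e) < b →
      (W ∩ H ⁻¹' Icc (e - b) (e + b)) ∩ closure Ω ∈ 𝓝[closure Ω] y := by
    intro b y hyW hyb
    have hcont : Continuous fun y => σ * (H y - e) :=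
      continuous_const.mul (hHc.sub continuous_const)
    filter_upwards [mem_nhdsWithin_of_mem_nhds (hE.band.isOpen.mem_nhds hyW),
      self_mem_nhdsWithin,
      nhdsWithin_le_nhds (hcont.continuousAt.eventually_lt_const hyb)] with y' h1 h2 h3
    exact hmem.2 ⟨h1, (hE.mem_closure_iff h1).1 h2, le_of_lt h3⟩
  obtain ⟨B, hB⟩ := (hKc r le_rfl).exists_bound_of_continuousOn hψ.continuous.continuousOn
  simp only [Real.norm_eq_abs] at hB
  have hB0 : 0 ≤ B := by
    refine (abs_nonneg _).trans (hB y₀ (hmem.2 ⟨hy₀.1, ?_, ?_⟩)) <;>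
      rw [show H y₀ = e from hy₀.2] <;> simp [hr.le]
  -- The slope of the barrier in the band.
  obtain ⟨L, hL0, hLr, hLg⟩ : ∃ L > 0, 2 * C ≤ L * r ∧
      ∀ y ∈ (W ∩ H ⁻¹' Icc (e - r) (e + r)) ∩ closure Ω, lam * C + Mc < ν * (L * ‖∇ H y‖) := by
    obtain ⟨y₁, hy₁, hmin⟩ := (hKc r le_rfl).exists_isMinOn
      ⟨y₀, hmem.2 ⟨hy₀.1, by simp [show H y₀ = e from hy₀.2], by
        simp [show H y₀ = e from hy₀.2, hr.le]⟩⟩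
      (f := fun y => ‖∇ H y‖) (continuous_gradient hH1).norm.continuousOn
    have hg0 : 0 < ‖∇ H y₁‖ := norm_pos_iff.2 (hE.band.gradient_ne y₁ hy₁.1.1)
    refine ⟨2 * C / r + (lam * C + Mc + 1) / (ν * ‖∇ H y₁‖), by positivity, ?_, fun y hy => ?_⟩
    · have h1 : 2 * C / r * r = 2 * C := by field_simp
      have h2 : 0 ≤ (lam * C + Mc + 1) / (ν * ‖∇ H y₁‖) * r := by positivity
      linarith
    · have h1 : ‖∇ H y₁‖ ≤ ‖∇ H y‖ := hmin hy
      calc lam * C + Mc < lam * C + Mc + 1 := by linarith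
        _ = ν * ((lam * C + Mc + 1) / (ν * ‖∇ H y₁‖) * ‖∇ H y₁‖) := by field_simp
        _ ≤ ν * ((2 * C / r + (lam * C + Mc + 1) / (ν * ‖∇ H y₁‖)) * ‖∇ H y‖) := by
          gcongr
          have : 0 ≤ 2 * C / r := by positivity
          linarith
  -- The bound for all solutions with small `ε`.
  have hall : ∀ ε ∈ Ioo 0 (δ / (2 * B + 1)), ∀ u ∈ solutionSet Ω H G g lam ε, ∀ x ∈ W,
      0 < σ * (H x - e) → σ * (H x - e) ≤ r →
      uscEnv (closure Ω) u x ≤ g y₀ + 3 * δ + L * (σ * (H x - e)) := by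
    intro ε hε u hu x hxW hx0 hxr
    have hε0 : 0 < ε := hε.1
    have hεB : ε * (2 * B) ≤ δ := by
      have h1 := hε.2
      rw [lt_div_iff₀ (by positivity)] at h1
      linarith
    have huC := hC ε u hu
    have hub := LocBddOn_of_bdd huC
    obtain ⟨-, htest, -⟩ := (mem_solutionSet_iff hP.isOpen).1 hu
    -- A layer in which `u` is small near `y₀`; its width depends on `ε` and `u`.
    obtain ⟨a', ha', -, hlayer⟩ := hE.band.exists_thin_band_param (S := closure Ω) hHc hE.mem
      (P := fun _ y => y ∈ Metric.closedBall y₀ ρ → uscEnv (closure Ω) u y < g y₀ + 2 * δ) (by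
      intro x hx
      suffices h : ∀ᶠ y in 𝓝[closure Ω] x, y ∈ Metric.closedBall y₀ ρ →
          uscEnv (closure Ω) u y < g y₀ + 2 * δ from h.prod_inr _
      have hxfr := hfr x hx
      have hxΩ := frontier_subset_closure hxfr
      by_cases hxB : x ∈ Metric.closedBall y₀ ρ
      · have h1 := hE.uscEnv_le_of_mem_level hP ⟨ν, Mc, hν, hMc, hco⟩ huC htest hx
        have h2 := hball x hxB hxfr
        exact (eventually_uscEnv_lt hxΩ hub (by linarith)).mono fun y hy _ => hy
      · filter_upwards [mem_nhdsWithin_of_mem_nhds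
          (Metric.isClosed_closedBall.isOpen_compl.mem_nhds hxB)] with y hy hyB
        exact absurd hyB hy)
    obtain ⟨a, ha0, haa', hax, har⟩ : ∃ a > 0, a ≤ a' ∧ a ≤ σ * (H x - e) ∧ a ≤ r :=
      ⟨min a' (min (σ * (H x - e)) r), by positivity, min_le_left _ _,
        (min_le_right _ _).trans (min_le_left _ _), (min_le_right _ _).trans (min_le_right _ _)⟩
    -- The barrier in the layer: the parabola exceeds the oscillation `2 C` at both ends of the layer
    -- and vanishes in the middle.
    set ℓ := 8 * C / a ^ 2 with hℓ
    have hℓa : ℓ * (a / 2) ^ 2 = 2 * C := by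
      rw [hℓ]
      field_simp
      ring
    set χ : ℝ → ℝ := fun s => ℓ * (σ * (s - e) - a / 2) ^ 2 + (g y₀ + 2 * δ + ε * B) with hχdef
    have hχ : ContDiff ℝ 1 χ := by fun_prop
    have hwC : ContDiff ℝ 1 fun y => χ (H y) + ε * ψ y :=
      (hχ.comp hH1).add (contDiff_const.mul hψ)
    have hgy := (abs_le.1 hCg).1
    have hℓ0 : 0 ≤ ℓ := by positivity
    have hwge : ∀ y ∈ (W ∩ H ⁻¹' Icc (e - a) (e + a)) ∩ closure Ω,
        g y₀ + 2 * δ + ℓ * (σ * (H y - e) - a / 2) ^ 2 ≤ χ (H y) + ε * ψ y := by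
      intro y hy
      rw [hmem] at hy
      have h1 := (abs_le.1 (hB y (hmem.2 ⟨hy.1, hy.2.1, hy.2.2.trans har⟩))).1
      have h2 : 0 ≤ ε * (ψ y + B) := mul_nonneg hε0.le (by linarith)
      simp only [hχdef]
      linarith
    have hin := htest.uscEnv_le_barrier hlam huC
      (M := {y | y ∈ W ∧ 0 < σ * (H y - e) ∧ σ * (H y - e) < a}) (hKc a har)
      inter_subset_right (fun y hy => hnhds hy.1 hy.2.2) hwC
      (by
        intro y hy hyM
        have h1 := hwge y hy
        rw [hmem] at hy
        have h2 : (σ * (H y - e) - a / 2) ^ 2 = (a / 2) ^ 2 := by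
          rcases hy.2.1.eq_or_lt with h | h
          · rw [← h]
            ring
          · have h3 : σ * (H y - e) = a :=
              le_antisymm hy.2.2 (not_lt.1 fun h4 => hyM ⟨hy.1, h, h4⟩)
            rw [h3]
            ring
        rw [h2, hℓa] at h1
        have h3 := (abs_le.1 (abs_uscEnv_le huC ((hE.mem_closure_iff hy.1).2 hy.2.1))).2
        linarith)
      (by
        rintro y ⟨-, hyW, hy0, -⟩ hyfr
        rw [(hE.mem_frontier_iff hyW).1 hyfr] at hy0
        simp at hy0)
      (by
        rintro y ⟨hyK, hyW, hy0, hya⟩ hlt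
        have hw := hwge y hyK
        have hyΩ := hyK.2
        have hsq : 0 ≤ ℓ * (σ * (H y - e) - a / 2) ^ 2 := by positivity
        have hHa : |H y - e| ≤ a := by
          rw [hdabs, abs_of_pos hy0]
          exact hya.le
        rcases hband y hyW (hHa.trans har) with h | h
        · have h' : inner ℝ (drift H y) (∇ ψ y) < -(lam * C + Mc) := h
          rw [gradient_perturbed (hχ.differentiable one_ne_zero _) (hHd _) (hψd _),
            hjOp_perturbed hε0.ne']
          have h2 := hco y hyΩ (deriv χ (H y) • ∇ H y + ε • ∇ ψ y)
          have h3 := mul_nonneg hν.le (norm_nonneg (deriv χ (H y) • ∇ H y + ε • ∇ ψ y))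
          linarith
        · have h2 := hlayer (a' / 2) ⟨by linarith, by linarith⟩ y ⟨hyW, hyΩ⟩ (hHa.trans haa')
            (Metric.ball_subset_closedBall h)
          linarith)
    -- The barrier beyond the layer.
    set χ' : ℝ → ℝ := fun s => L * (σ * (s - e)) + (g y₀ + 3 * δ) with hχ'def
    have hχ' : ContDiff ℝ 1 χ' := by fun_prop
    have hχ'd : ∀ s, deriv χ' s = L * σ := by
      intro s
      have h1 : HasDerivAt χ' (L * (σ * 1)) s :=
        ((((hasDerivAt_id s).sub_const e).const_mul σ).const_mul L).add_const _
      rw [h1.deriv, mul_one]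
    have hclosed : IsClosed {y | a / 2 ≤ σ * (H y - e)} :=
      isClosed_le continuous_const (continuous_const.mul (hHc.sub continuous_const))
    have hbeyond := htest.uscEnv_le_barrier hlam huC
      (K := (W ∩ H ⁻¹' Icc (e - r) (e + r)) ∩ closure Ω ∩ {y | a / 2 ≤ σ * (H y - e)})
      (M := {y | y ∈ W ∧ a / 2 < σ * (H y - e) ∧ σ * (H y - e) < r})
      ((hKc r le_rfl).inter_right hclosed)
      (fun y hy => hy.1.2)
      (by
        rintro y ⟨hyW, hya, hyr⟩
        have hcont : Continuous fun y => σ * (H y - e) :=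
          continuous_const.mul (hHc.sub continuous_const)
        filter_upwards [hnhds hyW hyr,
          nhdsWithin_le_nhds (hcont.continuousAt.eventually_const_lt hya)] with y' h1 h2
        exact ⟨h1, le_of_lt h2⟩)
      (w := fun y => χ' (H y)) (hχ'.comp hH1)
      (by
        rintro y ⟨hyK, hya⟩ hyM
        have hya' : a / 2 ≤ σ * (H y - e) := hya
        have hyK' := hmem.1 hyK
        simp only [hχ'def]
        rcases hya'.eq_or_lt with h | h
        · have h1 := hin y (hmem.2 ⟨hyK'.1, hyK'.2.1, by linarith⟩)
          have h2 := (abs_le.1 (hB y hyK)).2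
          have h3 : ε * ψ y ≤ ε * B := mul_le_mul_of_nonneg_left h2 hε0.le
          simp only [hχdef, ← h, sub_self] at h1
          have h4 : 0 ≤ L * (a / 2) := by positivity
          rw [← h]
          linarith
        · have h1 : σ * (H y - e) = r :=
            le_antisymm hyK'.2.2 (not_lt.1 fun h4 => hyM ⟨hyK'.1, h, h4⟩)
          have h2 := (abs_le.1 (abs_uscEnv_le huC hyK.2)).2
          rw [h1]
          linarith)
      (by
        rintro y ⟨-, hyW, hy0, -⟩ hyfr
        rw [(hE.mem_frontier_iff hyW).1 hyfr] at hy0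
        simp only [sub_self, mul_zero] at hy0
        linarith)
      (by
        rintro y ⟨⟨hyK, -⟩, -⟩ -
        rw [gradient_comp_real (hχ'.differentiable one_ne_zero _) (hHd _), hχ'd, hjOp,
          inner_smul_right, inner_drift_gradient]
        have h1 := hco y hyK.2 ((L * σ) • ∇ H y)
        rw [norm_smul, Real.norm_eq_abs, abs_mul, hσ, abs_of_pos hL0, mul_one] at h1
        have h2 := hLg y hyK
        linarith)
    have h1 := hbeyond x ⟨hmem.2 ⟨hxW, hx0.le, hxr⟩, show a / 2 ≤ σ * (H x - e) by linarith⟩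
    simp only [hχ'def] at h1
    linarith
  -- Passage to the limit.
  refine ⟨min r (δ / (2 * L)), by positivity, fun x hxW hx0 hxr => ?_⟩
  by_contra! hcon
  have hxΩ : x ∈ closure Ω := (hE.mem_closure_iff hxW).2 hx0.le
  have hcont : Continuous fun y => σ * (H y - e) :=
    continuous_const.mul (hHc.sub continuous_const)
  have hnear : ∀ᶠ y in 𝓝 x, y ∈ W ∧ 0 < σ * (H y - e) ∧ σ * (H y - e) < min r (δ / (2 * L)) :=
    (eventually_mem_set.2 (hE.band.isOpen.mem_nhds hxW)).and
      ((hcont.continuousAt.eventually_const_lt hx0).and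
        (hcont.continuousAt.eventually_lt_const hxr))
  obtain ⟨ρ', hρ', hnear'⟩ := Metric.eventually_nhds_iff_ball.1 hnear
  obtain ⟨ε, hε, u, hu, y, hy, huy⟩ := hP.exists_gt_of_lt_vPlus hxΩ hcon
    (r := min ρ' (δ / (2 * B + 1))) (by positivity)
  obtain ⟨hyW, hy0, hyr⟩ := hnear' y (Metric.ball_subset_ball (min_le_left _ _) hy.1)
  have h1 := hall ε ⟨hε.1, hε.2.trans_le (min_le_right _ _)⟩ u hu y hyW hy0
    (hyr.le.trans (min_le_left _ _))
  have h2 := le_uscEnv hy.2 (locBdd_of_bdd (hC ε u hu) y)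
  have h3 : L * (σ * (H y - e)) ≤ δ := by
    have h4 := hyr.trans_le (min_le_right _ _)
    rw [lt_div_iff₀ (by positivity)] at h4
    nlinarith
  rw [hδdef] at *
  linarith

end IsEdge

/-! ### The effective problem -/

/-- A `C¹` function on a compact interval extends to a `C¹` function on the line. -/
theorem exists_contDiff_eqOn_Icc {a b : ℝ} (hab : a < b) {φ : ℝ → ℝ}
    (hφ : ContDiffOn ℝ 1 φ (Icc a b)) : ∃ ψ : ℝ → ℝ, ContDiff ℝ 1 ψ ∧ EqOn φ ψ (Icc a b) := by
  have hc : ContinuousOn (derivWithin φ (Icc a b)) (Icc a b) :=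
    hφ.continuousOn_derivWithin (uniqueDiffOn_Icc hab) le_rfl
  set D : ℝ → ℝ := IccExtend hab.le ((Icc a b).domRestrict (derivWithin φ (Icc a b))) with hD
  have hDc : Continuous D := (continuousOn_iff_continuous_domRestrict.1 hc).Icc_extend'
  have hderiv : ∀ t, HasDerivAt (fun t => φ a + ∫ r in a..t, D r) (D t) t := fun t =>
    (hDc.integral_hasStrictDerivAt a t).hasDerivAt.const_add _
  refine ⟨fun t => φ a + ∫ r in a..t, D r, ?_, fun t ht => ?_⟩
  · rw [contDiff_one_iff_deriv]
    refine ⟨fun t => (hderiv t).differentiableAt, ?_⟩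
    rwa [show deriv (fun t => φ a + ∫ r in a..t, D r) = D from funext fun t => (hderiv t).deriv]
  · have h := intervalIntegral.integral_eq_sub_of_hasDerivAt_of_le ht.1
      (hφ.continuousOn.mono (Icc_subset_Icc_right ht.2)) (f' := D) (fun x hx => ?_)
      (hDc.intervalIntegrable a t)
    · simp only [h]
      ring
    · have hx' : x ∈ Icc a b := ⟨hx.1.le, hx.2.le.trans ht.2⟩
      have h1 : D x = derivWithin φ (Icc a b) x := by
        rw [hD, IccExtend_of_mem hab.le _ hx']
        rfl
      rw [h1]
      exact (hφ.differentiableOn one_ne_zero x hx').hasDerivWithinAt.hasDerivAt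
        (Icc_mem_nhds hx.1 (hx.2.trans_le ht.2))

section

variable {N : ℕ} [NeZero N] {H : Plane → ℝ} {z : Fin N → Plane} {h : Fin N → ℝ}
  {G : Plane → Plane → ℝ} {g : Plane → ℝ} {lam : ℝ} {i : Fin N}

theorem isOpen_edge : IsOpen (edge h i) := by
  by_cases hi : i = 0 <;> simp only [edge, hi, if_true, if_false] <;> exact isOpen_Ioo

theorem edge_subset_edgeClosed (hlev : CondLevels H z h) : edge h i ⊆ edgeClosed h i := by
  rw [edge_eq hlev, edgeClosed_eq hlev]
  exact fun s hs => ⟨hs.1, show 0 ≤ edgeSign i * (s - h i) from le_of_lt hs.2⟩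

theorem ne_of_mem_edge {s : ℝ} (hs : s ∈ edge h i) : s ≠ h i := by
  rintro rfl
  by_cases hi : i = 0 <;> simp [edge, hi] at hs

theorem mem_edge_of_ne (hlev : CondLevels H z h) {s : ℝ} (hs : s ∈ edgeClosed h i)
    (hne : s ≠ h i) : s ∈ edge h i := by
  rw [edgeClosed_eq hlev] at hs
  rw [edge_eq hlev]
  refine ⟨hs.1, lt_of_le_of_ne hs.2 (Ne.symm (mul_ne_zero ?_ (sub_ne_zero.2 hne)))⟩
  by_cases hi : i = 0 <;> simp [edgeSign, hi]

theorem mem_edgeClosed (hlev : CondLevels H z h) : h i ∈ edgeClosed h i := by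
  by_cases hi : i = 0
  · have h0 := hlev.1
    simpa [edgeClosed, edge, hi, closure_Ioo h0.ne, h0.le] using h0
  · have h0 := (hlev.2 i hi).2
    simpa [edgeClosed, edge, hi, closure_Ioo h0.ne, h0.le] using h0

theorem mem_closure_edge (hlev : CondLevels H z h) : h i ∈ closure (edge h i) :=
  (mem_edgeClosed hlev).1

theorem nhdsWithin_edge (hlev : CondLevels H z h) {s : ℝ} (hs : s ∈ edge h i) :
    𝓝[edgeClosed h i] s = 𝓝[edge h i] s := by
  rw [isOpen_edge.nhdsWithin_eq hs, nhdsWithin_eq_nhds.2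
    (mem_of_superset (isOpen_edge.mem_nhds hs) (edge_subset_edgeClosed hlev))]

/-- The outer end of the edge has compact intervals as relative neighbourhoods. -/
theorem exists_Icc_mem_nhdsWithin_edgeClosed (hlev : CondLevels H z h) :
    ∃ a b, a < b ∧ Icc a b ⊆ edgeClosed h i ∧ Icc a b ∈ 𝓝[edgeClosed h i] (h i) ∧
      UniqueDiffWithinAt ℝ (edgeClosed h i) (h i) := by
  by_cases hi : i = 0
  · have h0 := hlev.1
    have he : edgeClosed h i = Ioc 0 (h i) := by
      simp only [edgeClosed, edge, hi, if_true, closure_Ioo h0.ne, Icc_sdiff_left]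
    rw [← hi] at h0
    rw [he]
    refine ⟨h i / 2, h i, by linarith, fun s hs => ⟨by linarith [hs.1], hs.2⟩, ?_,
      uniqueDiffOn_Ioc _ _ _ ⟨h0, le_rfl⟩⟩
    filter_upwards [self_mem_nhdsWithin,
      mem_nhdsWithin_of_mem_nhds (Ioi_mem_nhds (show h i / 2 < h i by linarith))] with s h1 h2
    exact ⟨le_of_lt h2, h1.2⟩
  · have h0 := (hlev.2 i hi).2
    have he : edgeClosed h i = Ico (h i) 0 := by
      simp only [edgeClosed, edge, hi, if_false, closure_Ioo h0.ne, Icc_sdiff_right]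
    rw [he]
    refine ⟨h i, h i / 2, by linarith, fun s hs => ⟨hs.1, by linarith [hs.2]⟩, ?_,
      uniqueDiffOn_Ico _ _ _ ⟨le_rfl, h0⟩⟩
    filter_upwards [self_mem_nhdsWithin,
      mem_nhdsWithin_of_mem_nhds (Iio_mem_nhds (show h i < h i / 2 by linarith))] with s h1 h2
    exact ⟨h1.1, le_of_lt h2⟩

theorem effG_dualG (s q : ℝ) : effG H z h (dualG G) i s q = -effG H z h G i s (-q) := by
  simp only [effG, dualG, neg_smul, neg_div, integral_neg, mul_neg]

theorem effG_eq (hH1 : CondH1 H) (hH2 : CondH2 H z) (hlev : CondLevels H z h) {s : ℝ}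
    (hs : s ∈ edgeClosed h i) (q : ℝ) : effG H z h G i s q =
      1 / (∫ x in bandSet H z i ∩ H ⁻¹' {s}, 1 / ‖∇ H x‖ ∂(Measure.hausdorffMeasure 1)) *
        ∫ x in bandSet H z i ∩ H ⁻¹' {s}, G x (q • ∇ H x) / ‖∇ H x‖
          ∂(Measure.hausdorffMeasure 1) := by
  rw [effG, period, levelCurve_eq hH1 hH2 hlev hs]

theorem vEdgeMinus_eq (hH1 : CondH1 H) (hH2 : CondH2 H z) (hlev : CondLevels H z h)
    (hP : IsProblem (domain H z h) H G g lam) {s : ℝ} (hs : s ∈ edgeClosed h i) :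
    vEdgeMinus H z h G g lam i s = -curveMax H z h (dualG G) (fun x => -g x) lam i s := by
  have hE := isEdge_domain hH1 hH2 hlev i
  have hsub : levelCurve H z h i s ⊆ closure (domain H z h) := by
    rw [levelCurve_eq hH1 hH2 hlev hs]
    rw [edgeClosed_eq hlev] at hs
    exact hE.level_subset_closure hs
  rw [vEdgeMinus, curveMax, ← Real.sInf_neg]
  congr 1
  ext a
  rw [Set.mem_neg]
  constructor
  · rintro ⟨x, hx, rfl⟩
    exact ⟨x, hx, by rw [hP.vMinus_eq (hsub hx), neg_neg]⟩
  · rintro ⟨x, hx, hxa⟩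
    exact ⟨x, hx, by rw [hP.vMinus_eq (hsub hx), hxa, neg_neg]⟩

theorem exists_curveMax_bound (hH1 : CondH1 H) (hH2 : CondH2 H z) (hlev : CondLevels H z h)
    (hP : IsProblem (domain H z h) H G g lam) :
    ∃ C, ∀ s ∈ edgeClosed h i, |curveMax H z h G g lam i s| ≤ C := by
  obtain ⟨C, hC⟩ := hP.exists_vPlus_bound
  refine ⟨C, fun s hs => ?_⟩
  rw [curveMax, levelCurve_eq hH1 hH2 hlev hs]
  rw [edgeClosed_eq hlev] at hs
  exact (isEdge_domain hH1 hH2 hlev i).abs_sSup_level_le hC hs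

/-- The averaging principle on the closed edge. -/
theorem effective_le_zero (hH1 : CondH1 H) (hH2 : CondH2 H z) (hlev : CondLevels H z h)
    (hP : IsProblem (domain H z h) H G g lam) {φ : ℝ → ℝ} (hφ : ContDiff ℝ 1 φ) {s : ℝ}
    (hs : s ∈ edgeClosed h i)
    (hmax : IsLocalMaxOn (fun t => uscEnv (edgeClosed h i) (curveMax H z h G g lam i) t - φ t)
      (edgeClosed h i) s)
    (hbd : s = h i → ∀ x ∈ boundaryPart H z h i,
      g x < uscEnv (edgeClosed h i) (curveMax H z h G g lam i) s) :
    lam * uscEnv (edgeClosed h i) (curveMax H z h G g lam i) s +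
      effG H z h G i s (deriv φ s) ≤ 0 := by
  rw [effG_eq hH1 hH2 hlev hs]
  have hcm : ∀ t ∈ edgeClosed h i, curveMax H z h G g lam i t =
      sSup (vPlus (domain H z h) H G g lam '' (bandSet H z i ∩ H ⁻¹' {t})) := fun t ht => by
    rw [curveMax, levelCurve_eq hH1 hH2 hlev ht]
  have hbd' : s = h i → ∀ x ∈ bandSet H z i ∩ H ⁻¹' {s},
      g x < uscEnv (edgeClosed h i) (curveMax H z h G g lam i) s := by
    intro hsi x hx
    rw [← levelCurve_eq hH1 hH2 hlev hs] at hx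
    exact hbd hsi x ⟨hx.1, hx.2.trans hsi⟩
  rw [edgeClosed_eq hlev] at *
  exact (isEdge_domain hH1 hH2 hlev i).effective_le_zero hP hφ hs hcm hmax hbd'

theorem isSubEdge_curveMax (hH1 : CondH1 H) (hH2 : CondH2 H z) (hlev : CondLevels H z h)
    (hP : IsProblem (domain H z h) H G g lam) {m : ℝ → ℝ}
    (hm : EqOn m (curveMax H z h G g lam i) (edge h i)) :
    IsSubEdge (edge h i) (effG H z h G i) lam m := by
  have henv : ∀ t ∈ edge h i, uscEnv (edge h i) m t =
      uscEnv (edgeClosed h i) (curveMax H z h G g lam i) t := by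
    intro t ht
    rw [uscEnv_congr_set (nhdsWithin_edge hlev ht)]
    exact uscEnv_congr (eventually_mem_nhdsWithin.mono hm)
  obtain ⟨C, hC⟩ := exists_curveMax_bound (i := i) hH1 hH2 hlev hP
  refine ⟨LocBddOn_of_bdd (C := C) fun t ht => ?_, fun φ hφ s hs hmax => ?_⟩
  · rw [hm ht]
    exact hC t (edge_subset_edgeClosed hlev ht)
  · obtain ⟨ψ, hψ, hψe⟩ := exists_contDiff_eventuallyEq isOpen_edge hφ hs
    rw [henv s hs, ← hψe.deriv_eq]
    refine effective_le_zero hH1 hH2 hlev hP hψ (edge_subset_edgeClosed hlev hs) ?_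
      fun h0 => absurd h0 (ne_of_mem_edge hs)
    rw [IsLocalMaxOn, IsMaxFilter, nhdsWithin_edge hlev hs]
    filter_upwards [hmax, nhdsWithin_le_nhds hψe, self_mem_nhdsWithin] with t h1 h2 h3
    rwa [h2, hψe.self_of_nhds, ← henv t h3, ← henv s hs]

theorem isLocalMaxOn_neg_of_isLocalMinOn {S : Set ℝ} {u φ : ℝ → ℝ} {s : ℝ}
    (hmin : IsLocalMinOn (fun t => lscEnv S u t - φ t) S s) :
    IsLocalMaxOn (fun t => uscEnv S (fun r => -u r) t - -φ t) S s := by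
  filter_upwards [hmin] with t ht
  simp only [lscEnv_eq_neg] at ht
  linarith

theorem isSuperEffective_vEdgeMinus (hH1 : CondH1 H) (hH2 : CondH2 H z) (hlev : CondLevels H z h)
    (hP : IsProblem (domain H z h) H G g lam) :
    IsSuperEffective H z h G g lam i (vEdgeMinus H z h G g lam i) := by
  have heq : EqOn (fun s => -vEdgeMinus H z h G g lam i s)
      (curveMax H z h (dualG G) (fun x => -g x) lam i) (edgeClosed h i) := fun s hs => by
    simp only [vEdgeMinus_eq hH1 hH2 hlev hP hs, neg_neg]
  obtain ⟨C, hC⟩ := exists_curveMax_bound (i := i) hH1 hH2 hlev hP.dual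
  have hbound : ∀ s ∈ edgeClosed h i, |vEdgeMinus H z h G g lam i s| ≤ C := fun s hs => by
    rw [← abs_neg]
    have := heq hs
    simp only at this
    rw [this]
    exact hC s hs
  have hsub := isSubEdge_curveMax hH1 hH2 hlev hP.dual (heq.mono (edge_subset_edgeClosed hlev))
  refine ⟨LocBddOn_of_bdd hbound, ⟨LocBddOn_of_bdd fun s hs =>
    hbound s (edge_subset_edgeClosed hlev hs), fun φ hφ s hs hmin => ?_⟩, fun φ hφ hmin => ?_⟩
  · have h1 := hsub.2 (fun t => -φ t) hφ.neg s hs (isLocalMaxOn_neg_of_isLocalMinOn hmin)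
    rw [effG_dualG, deriv.fun_neg, neg_neg] at h1
    rw [lscEnv_eq_neg]
    linarith
  · by_contra! hneg
    rw [max_lt_iff] at hneg
    obtain ⟨hneg1, hneg2⟩ := hneg
    obtain ⟨a, b, hab, hsubI, hnhds, huniq⟩ := exists_Icc_mem_nhdsWithin_edgeClosed (i := i) hlev
    obtain ⟨ψ, hψ, hψe⟩ := exists_contDiff_eqOn_Icc hab (hφ.mono hsubI)
    have hi := mem_edgeClosed (i := i) hlev
    have hiab : h i ∈ Icc a b := mem_of_mem_nhdsWithin hi hnhds
    have hev : φ =ᶠ[𝓝[edgeClosed h i] (h i)] ψ := by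
      filter_upwards [hnhds] with t ht
      exact hψe ht
    have hderiv : derivWithin φ (edgeClosed h i) (h i) = deriv ψ (h i) := by
      rw [hev.derivWithin_eq (hψe hiab),
        (hψ.differentiable one_ne_zero (h i)).derivWithin huniq]
    have henv : ∀ t ∈ edgeClosed h i, uscEnv (edgeClosed h i)
        (fun s => -vEdgeMinus H z h G g lam i s) t = uscEnv (edgeClosed h i)
        (curveMax H z h (dualG G) (fun x => -g x) lam i) t := fun t _ =>
      uscEnv_congr (eventually_mem_nhdsWithin.mono heq)
    rw [lscEnv_eq_neg, henv _ hi] at hneg1 hneg2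
    -- `g` is bounded below on the boundary curve, so `effBdry` is a true lower bound.
    have hbdry : IsCompact (boundaryPart H z h i) ∧ boundaryPart H z h i ⊆
        frontier (domain H z h) := by
      have hE := isEdge_domain hH1 hH2 hlev i
      have h1 : boundaryPart H z h i = bandSet H z i ∩ H ⁻¹' {h i} :=
        levelCurve_eq hH1 hH2 hlev hi
      rw [h1]
      exact ⟨hE.band.isCompact_level hE.mem, fun x hx => (hE.mem_frontier_iff hx.1).2 hx.2⟩
    have h1 := effective_le_zero hH1 hH2 hlev hP.dual hψ.neg hi
      (by
        filter_upwards [isLocalMaxOn_neg_of_isLocalMinOn hmin, hev, self_mem_nhdsWithin]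
          with t h1 h2 h3
        rw [henv t h3, henv _ hi, h2, hev.self_of_nhdsWithin hi] at h1
        exact h1)
      (by
        intro _ x hx
        have h2 : effBdry H z h g i ≤ g x := csInf_le
          (hbdry.1.bddBelow_image (hP.continuousOn_g.mono hbdry.2)) ⟨x, hx, rfl⟩
        linarith)
    rw [effG_dualG, deriv.fun_neg, neg_neg, ← hderiv] at h1
    linarith

/-- Near the outer end of the edge, `max v⁺` over the level curves is at most slightly above
`min g`. -/
theorem exists_curveMax_le (hH1 : CondH1 H) (hH2 : CondH2 H z) (hlev : CondLevels H z h)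
    (hP : IsProblem (domain H z h) H G g lam) (hG : CondG5 (domain H z h) G) {c : ℝ}
    (hc : effBdry H z h g i < c) :
    ∀ᶠ s in 𝓝 (h i), s ∈ edge h i → curveMax H z h G g lam i s ≤ c := by
  have hE := isEdge_domain hH1 hH2 hlev i
  have h1 : boundaryPart H z h i = bandSet H z i ∩ H ⁻¹' {h i} :=
    levelCurve_eq hH1 hH2 hlev (mem_edgeClosed hlev)
  rw [effBdry, h1] at hc
  obtain ⟨_, ⟨y, hy, rfl⟩, hyc⟩ :=
    exists_lt_of_csInf_lt ((hE.band.nonempty _ hE.mem).image g) hc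
  obtain ⟨r, hr, hle⟩ := hE.exists_vPlus_le hP hG hy hyc
  have hcont : Continuous fun s => edgeSign i * (s - h i) := by fun_prop
  filter_upwards [hcont.continuousAt.eventually_lt_const (show edgeSign i * (h i - h i) < r by
    simpa using hr)] with s hs hse
  rw [curveMax, levelCurve_eq hH1 hH2 hlev (edge_subset_edgeClosed hlev hse)]
  rw [edge_eq hlev] at hse
  refine csSup_le ((hE.band.nonempty _ hse.1).image _) ?_
  rintro _ ⟨x, ⟨hxW, hxs⟩, rfl⟩
  have hxs' : H x = s := hxs
  exact hle x hxW (by rw [hxs']; exact hse.2) (by rw [hxs']; exact hs)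

theorem vEdgePlus_apply (s : ℝ) : vEdgePlus H z h G g lam i s =
    if s = h i then uscEnv (edge h i) (curveMax H z h G g lam i) (h i)
    else curveMax H z h G g lam i s := rfl

theorem vEdgePlus_le (hH1 : CondH1 H) (hH2 : CondH2 H z) (hlev : CondLevels H z h)
    (hP : IsProblem (domain H z h) H G g lam) (hG : CondG5 (domain H z h) G) :
    vEdgePlus H z h G g lam i (h i) ≤ effBdry H z h g i := by
  obtain ⟨C, hC⟩ := exists_curveMax_bound (i := i) hH1 hH2 hlev hP
  rw [vEdgePlus_apply, if_pos rfl]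
  refine le_of_forall_gt_imp_ge_of_dense fun c hc => ?_
  refine uscEnv_le (mem_closure_edge hlev)
    (locBdd_of_bdd (fun s hs => hC s (edge_subset_edgeClosed hlev hs)) _) ?_
  exact eventually_nhdsWithin_iff.2 (exists_curveMax_le hH1 hH2 hlev hP hG hc)

theorem isSubEffective_vEdgePlus (hH1 : CondH1 H) (hH2 : CondH2 H z) (hlev : CondLevels H z h)
    (hP : IsProblem (domain H z h) H G g lam) (hG : CondG5 (domain H z h) G) :
    IsSubEffective H z h G g lam i (vEdgePlus H z h G g lam i) := by
  obtain ⟨C, hC⟩ := exists_curveMax_bound (i := i) hH1 hH2 hlev hP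
  have hC' : ∀ s ∈ edge h i, |curveMax H z h G g lam i s| ≤ C := fun s hs =>
    hC s (edge_subset_edgeClosed hlev hs)
  have hloc := locBdd_of_bdd hC' (h i)
  have hcl := mem_closure_edge (i := i) hlev
  have hne : (𝓝[edge h i] (h i)).NeBot := mem_closure_iff_nhdsWithin_neBot.1 hcl
  have heq : EqOn (vEdgePlus H z h G g lam i) (curveMax H z h G g lam i) (edge h i) :=
    fun s hs => by rw [vEdgePlus_apply, if_neg (ne_of_mem_edge hs)]
  have hbound : ∀ s ∈ edgeClosed h i, |vEdgePlus H z h G g lam i s| ≤ C := by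
    intro s hs
    by_cases hsi : s = h i
    · rw [vEdgePlus_apply, if_pos hsi]
      refine abs_le.2 ⟨?_, uscEnv_le hcl hloc
        (eventually_mem_nhdsWithin.mono fun t ht => (abs_le.1 (hC' t ht)).2)⟩
      by_contra! hlt
      obtain ⟨t, ht1, ht2⟩ :=
        ((eventually_lt_of_uscEnv_lt hloc hlt).and self_mem_nhdsWithin).exists
      linarith [(abs_le.1 (hC' t ht2)).1]
    · rw [heq (mem_edge_of_ne hlev hs hsi)]
      exact hC s hs
  refine ⟨LocBddOn_of_bdd hbound, isSubEdge_curveMax hH1 hH2 hlev hP heq,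
    fun φ hφ hmax => min_le_of_right_le (sub_nonpos.2 ?_)⟩
  -- The boundary condition holds in the classical sense.
  refine le_of_forall_gt_imp_ge_of_dense fun c hc => ?_
  refine uscEnv_le (subset_closure (mem_edgeClosed hlev)) (locBdd_of_bdd hbound _) ?_
  filter_upwards [nhdsWithin_le_nhds (exists_curveMax_le hH1 hH2 hlev hP hG hc),
    self_mem_nhdsWithin] with s h1 h2
  by_cases hsi : s = h i
  · rw [hsi]
    exact (vEdgePlus_le hH1 hH2 hlev hP hG).trans hc.le
  · have hse := mem_edge_of_ne hlev h2 hsi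
    rw [heq hse]
    exact h1 hse

end

end HamiltonianAveraging

end

open HamiltonianAveraging
theorem theorem4p2 {N : ℕ} [NeZero N] (hN : 2 ≤ N)
    (H : Plane → ℝ) (z : Fin N → Plane) (h : Fin N → ℝ)
    (G : Plane → Plane → ℝ) (g : Plane → ℝ) (lam : ℝ) (hlam : 0 < lam)
    (hH1 : CondH1 H) (hH2 : CondH2 H z) (hH3 : CondH3 H) (hlev : CondLevels H z h)
    (hG1 : CondG1 (domain H z h) G g) (hG2 : CondG2 (domain H z h) G)
    (hG3 : CondG3 (domain H z h) G) (hG4 : CondG4 H z h G) (hG5 : CondG5 (domain H z h) G) :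
    ∀ i : Fin N,
      IsSubEffective H z h G g lam i (vEdgePlus H z h G g lam i) ∧
      IsSuperEffective H z h G g lam i (vEdgeMinus H z h G g lam i) ∧
      vEdgePlus H z h G g lam i (h i) ≤ effBdry H z h g i := by
  intro i
  have hP : IsProblem (domain H z h) H G g lam :=
    { isOpen := isOpen_domain hH1 hH2 hlev
      isCompact := isCompact_closure_domain hH1 hlev
      continuous_drift := (contDiff_drift hH1.1).continuous
      lam_pos := hlam
      continuousOn_G := hG1.1
      continuousOn_g := hG1.2 }
  exact ⟨isSubEffective_vEdgePlus hH1 hH2 hlev hP hG5,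
    isSuperEffective_vEdgeMinus hH1 hH2 hlev hP, vEdgePlus_le hH1 hH2 hlev hP hG5⟩
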